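/- **Notation.** Let $\mathbb D$ be the open unit disc and $\mathbb T$ the unit circle with normalized Lebesgue measure $m$. The closed unit ball of $H^\infty$ is the set of analytic $b:\mathbb D\to\mathbb C$ with $|b|\le 1$. For such $b$, the de Branges–Rovnyak space $\mathscr H(b)$ is the reproducing kernel Hilbert space of functions on $\mathbb D$ with kernel $$k^b_\lambda(z)=\frac{1-\overline{b(\lambda)}\,b(z)}{1-\overline\lambda z},\qquad \lambda,z\in\mathbb D .$$ $H^2$ is the Hardy space of analytic functions $f$ on $\mathbb D$ with $\sup_{0\le\rho<1}\int_{\mathbb T}|f(\rho\xi)|^2\,dm(\xi)<\infty$. A function on $\mathbb D$ is outer if it has the form $c\exp\int_{\mathbb T}\frac{\xi+z}{\xi-z}u(\xi)\,dm(\xi)$ with $|c|=1$ and $u\in L^1(\mathbb T,m)$ real. A Pythagorean mate of $b$ is an outer function $a$ in the closed unit ball of $H^\infty$ with $a(0)>0$ and $|a|^2+|b|^2=1$ a.e. on $\mathbb T$ (for radial boundary values). If $q$ is outer and $r>0$, then $q^r=\exp(r\log q)$, where $\log q$ is any analytic logarithm of $q$ on $\mathbb D$. If $\zeta\in\mathbb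 T$ and $q^r$ continues analytically to a neighbourhood of $\zeta$, then for $\ell\ge 0$ $$v^\ell_{r,\zeta}(z)=\left.\frac{d^\ell}{d\overline\lambda^\ell}\left(\frac{1-\overline{q^r(\lambda)}\,q^r(z)}{1-\overline\lambda z}\right)\right|_{\lambda=\zeta},\qquad z\in\mathbb D,$$ where $q^r(\lambda)$ near $\zeta$ denotes that continuation. **Theorem.** Let $q$ be a rational outer function in the closed unit ball of $H^\infty$, let $r>0$, and fix an analytic logarithm of $q$ on $\mathbb D$. Then: 1. $\mathscr H(q^r)=\mathscr H(q)$ as sets. 2. Suppose that $a$ is the Pythagorean mate of $q$ and that $\zeta_1,\dots,\zeta_n$ ($n\ge 0$) are the distinct zeros on $\mathbb T$ of (the analytic continuation of) $a$, with multiplicities $m_1,\dots,m_n\ge 1$. Then: (a) for $1\le j\le n$ and $0\le\ell\le m_j-1$ the function $v^\ell_{r,\zeta_j}$ is well defined and belongs to $\mathscr H(q^r)$; moreover $$aH^2=\Big(\prod_{j=1}^n(z-\zeta_j)^{m_j}\Big)H^2\subset\mathscr H(q^r),$$ and every $v^\ell_{r,\zeta_j}$ is orthogonal to $aH^2$ in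 $\mathscr H(q^r)$; (b) $\mathscr H(q^r)$ is the orthogonal sum, with respect to the inner product of $\mathscr H(q^r)$, $$\mathscr H(q^r)=\Big(\prod_{j=1}^n(z-\zeta_j)^{m_j}\Big)H^2\ \oplus\ \operatorname{span}\{v^\ell_{r,\zeta_j}:1\le j\le n,\ 0\le\ell\le m_j-1\}.$$ -/

import Mathlib

open Complex Metric Filter Topology
open scoped ComplexConjugate UnitDisc InnerProductSpace

noncomputable section

namespace DBR

/-- The closed unit ball of `H^∞`: analytic functions on the open unit disc bounded by `1` there.
Only the values on the open unit disc matter. -/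
structure SchurFunction where
  toFun : ℂ → ℂ
  differentiableOn : DifferentiableOn ℂ toFun (ball 0 1)
  norm_le_one : ∀ z ∈ ball (0 : ℂ) 1, ‖toFun z‖ ≤ 1

instance : CoeFun SchurFunction fun _ => ℂ → ℂ := ⟨SchurFunction.toFun⟩

/-! ### The space `H(b)` -/

/-- The kernel `k^b_w(z) = (1 - conj (b w) * b z) / (1 - conj w * z)`. -/
def kernelFun (b : ℂ → ℂ) (w z : ℂ) : ℂ :=
  (1 - conj (b w) * b z) / (1 - conj w * z)

/-- The same kernel in the operator-valued form used by `RKHS`; rows are indexed by `z`, columns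
by `w`. -/
def kernelMatrix (b : SchurFunction) : Matrix 𝔻 𝔻 (ℂ →L[ℂ] ℂ) :=
  .of fun z w => kernelFun b w z • ContinuousLinearMap.id ℂ ℂ

theorem one_sub_conj_mul_ne_zero {w z : ℂ} (hw : ‖w‖ < 1) (hz : ‖z‖ ≤ 1) :
    1 - conj w * z ≠ 0 := by
  intro h
  have h1 : conj w * z = 1 := (sub_eq_zero.mp h).symm
  have h2 : ‖w‖ * ‖z‖ = 1 := by simpa using congrArg norm h1
  nlinarith [norm_nonneg w, norm_nonneg z]

/-- Cauchy's formula on the unit circle, through the Szegő kernel. -/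
theorem circleAverage_mul_szego {f : ℂ → ℂ} (hf : DiffContOnCl ℂ f (ball 0 1)) {w : ℂ}
    (hw : ‖w‖ < 1) :
    Real.circleAverage (fun z => f z * conj (1 / (1 - conj w * z))) 0 1 = f w := by
  have h := DiffContOnCl.circleAverage_smul_div (R := 1) (c := 0) (f := f) (w := w)
    (by simpa using hf) (by simpa using hw)
  rw [← h]
  apply Real.circleAverage_congr_sphere
  intro z hz
  have hz1 : ‖z‖ = 1 := by simpa using hz
  have hzz : z * conj z = 1 := by rw [Complex.mul_conj, Complex.normSq_eq_norm_sq, hz1]; simp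
  have hz0 : z ≠ 0 := by rintro rfl; simp at hz1
  have hd : z - w ≠ 0 := by
    intro h; rw [sub_eq_zero] at h; rw [h] at hz1; linarith
  have hd2 : 1 - w * conj z ≠ 0 := by
    intro h'
    apply hd
    have : z * (1 - w * conj z) = 0 := by rw [h', mul_zero]
    linear_combination this + w * hzz
  simp only [map_div₀, map_one, map_sub, map_mul, Complex.conj_conj, sub_zero, smul_eq_mul]
  field_simp
  linear_combination (f z) * w * hzz

theorem kernel_form_nonneg_aux {b : ℂ → ℂ} (hb : DiffContOnCl ℂ b (ball 0 1))
    (hb1 : ∀ z, ‖z‖ ≤ 1 → ‖b z‖ ≤ 1) (s : Finset 𝔻) (c : 𝔻 → ℂ) :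
    0 ≤ (∑ w ∈ s, ∑ z ∈ s, kernelFun b w z * c w * conj (c z)).re := by
  set k : 𝔻 → ℂ → ℂ := fun w z => 1 / (1 - conj (w : ℂ) * z) with hk
  have hkd : ∀ w : 𝔻, DiffContOnCl ℂ (k w) (ball 0 1) := by
    intro w
    have : DifferentiableOn ℂ (k w) (closedBall 0 1) := by
      intro z hz
      have hne : 1 - conj (w : ℂ) * z ≠ 0 :=
        one_sub_conj_mul_ne_zero w.norm_lt_one (by simpa using hz)
      simp only [hk]
      have h1 : DifferentiableAt ℂ (fun z : ℂ => 1 - conj (w : ℂ) * z) z := by fun_prop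
      exact (DifferentiableAt.fun_div (differentiableAt_const _) h1 hne).differentiableWithinAt
    exact DifferentiableOn.diffContOnCl (by rwa [closure_ball _ one_ne_zero])
  set h : ℂ → ℂ := fun z => ∑ w ∈ s, c w * k w z with hh
  set g : ℂ → ℂ := fun z => ∑ w ∈ s, conj (b w) * c w * k w z with hg
  have hsum : ∀ d : 𝔻 → ℂ, DiffContOnCl ℂ (fun z => ∑ w ∈ s, d w * k w z) (ball 0 1) := by
    intro d
    constructor
    · exact DifferentiableOn.fun_sum fun w _ => (hkd w).1.const_mul _
    · exact continuousOn_finsetSum _ fun w _ => (hkd w).2.const_mul _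
  have hhd : DiffContOnCl ℂ h (ball 0 1) := hsum c
  have hgd : DiffContOnCl ℂ g (ball 0 1) := hsum fun w => conj (b w) * c w
  have hbgd : DiffContOnCl ℂ (fun z => b z * g z) (ball 0 1) :=
    ⟨hb.1.mul hgd.1, hb.2.mul hgd.2⟩
  have hsph : sphere (0 : ℂ) |1| ⊆ closure (ball (0 : ℂ) 1) := by
    rw [closure_ball _ one_ne_zero]; simpa using sphere_subset_closedBall
  have hci : ∀ F : ℂ → ℂ, ContinuousOn F (closure (ball (0 : ℂ) 1)) → CircleIntegrable F 0 1 := by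
    intro F hF
    exact ContinuousOn.circleIntegrable' (hF.mono hsph)
  have hpair : ∀ (F : ℂ → ℂ) (d : 𝔻 → ℂ), DiffContOnCl ℂ F (ball 0 1) →
      Real.circleAverage (fun z => F z * conj (∑ w ∈ s, d w * k w z)) 0 1
        = ∑ w ∈ s, conj (d w) * F w := by
    intro F d hF
    have e : (fun z => F z * conj (∑ w ∈ s, d w * k w z))
        = fun z => ∑ w ∈ s, conj (d w) • (F z * conj (k w z)) := by
      funext z
      rw [map_sum, Finset.mul_sum]
      refine Finset.sum_congr rfl fun w _ => ?_
      simp only [map_mul, smul_eq_mul]; ring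
    rw [e, Real.circleAverage_fun_sum]
    · refine Finset.sum_congr rfl fun w _ => ?_
      rw [Real.circleAverage_fun_smul, circleAverage_mul_szego hF w.norm_lt_one, smul_eq_mul]
    · intro w _
      apply hci
      exact (hF.2.mul (Complex.continuous_conj.comp_continuousOn (hkd w).2)).fun_const_smul _
  have A1 := hpair h c hhd
  have A2 := hpair g (fun w => conj (b w) * c w) hgd
  have A3 := hpair (fun z => b z * g z) c hbgd
  have cc : ∀ {F G : ℂ → ℂ}, ContinuousOn F (closure (ball (0 : ℂ) 1)) →
      ContinuousOn G (closure (ball (0 : ℂ) 1)) →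
      ContinuousOn (fun z => F z * conj (G z)) (closure (ball (0 : ℂ) 1)) := fun hF hG =>
    hF.mul (Complex.continuous_conj.comp_continuousOn hG)
  have I1 := hci _ (cc hhd.2 hhd.2)
  have I2 := hci _ (cc hgd.2 hgd.2)
  have I3 := hci _ (cc hbgd.2 hhd.2)
  set Φ : ℂ → ℂ := fun z => h z * conj (h z) + g z * conj (g z)
    - (2 : ℂ) • (b z * g z * conj (h z)) with hΦ
  have IΦ : CircleIntegrable Φ 0 1 := hci _ (((cc hhd.2 hhd.2).add (cc hgd.2 hgd.2)).sub
    ((cc hbgd.2 hhd.2).fun_const_smul _))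
  have key : Real.circleAverage Φ 0 1
      = ∑ w ∈ s, ∑ z ∈ s, kernelFun b w z * c w * conj (c z) := by
    rw [hΦ, Real.circleAverage_fun_sub (hci _ ((cc hhd.2 hhd.2).fun_add (cc hgd.2 hgd.2)))
      (hci _ ((cc hbgd.2 hhd.2).fun_const_smul _)),
      Real.circleAverage_fun_add I1 I2, Real.circleAverage_fun_smul]
    rw [A1, A2, A3, Finset.sum_comm, smul_eq_mul, Finset.mul_sum, ← Finset.sum_add_distrib,
      ← Finset.sum_sub_distrib]
    refine Finset.sum_congr rfl fun z _ => ?_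
    simp only [map_mul, Complex.conj_conj, hh, hg, Finset.mul_sum]
    rw [← Finset.sum_add_distrib, ← Finset.sum_sub_distrib]
    refine Finset.sum_congr rfl fun w _ => ?_
    simp only [kernelFun, hk]
    ring
  rw [← key]
  have hre : (Real.circleAverage Φ 0 1).re = Real.circleAverage (fun z => (Φ z).re) 0 1 :=
    (Complex.reCLM.circleAverage_comp_comm IΦ).symm
  rw [hre]
  apply Real.circleAverage_nonneg_of_nonneg
  intro z hz
  have hz1 : ‖z‖ ≤ 1 := by simpa using (sphere_subset_closedBall hz)
  have hbz := hb1 z hz1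
  have hbz2 : normSq (b z) ≤ 1 := by
    rw [Complex.normSq_eq_norm_sq]; nlinarith [norm_nonneg (b z)]
  have e : (Φ z).re = normSq (h z - b z * g z) + (1 - normSq (b z)) * normSq (g z) := by
    rw [Complex.normSq_sub, Complex.normSq_mul]
    simp only [hΦ, Complex.sub_re, Complex.add_re, Complex.mul_conj, Complex.ofReal_re,
      smul_eq_mul]
    have : ((2 : ℂ) * (b z * g z * conj (h z))).re
        = 2 * (h z * conj (b z * g z)).re := by
      simp [Complex.mul_re, Complex.mul_im]; ring
    rw [this]; ring
  show 0 ≤ (Φ z).re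
  rw [e]
  have := normSq_nonneg (h z - b z * g z)
  have := normSq_nonneg (g z)
  nlinarith [mul_nonneg (sub_nonneg.mpr hbz2) this]

theorem kernel_form_nonneg (b : SchurFunction) (s : Finset 𝔻) (c : 𝔻 → ℂ) :
    0 ≤ (∑ w ∈ s, ∑ z ∈ s, kernelFun b w z * c w * conj (c z)).re := by
  have hmaps : ∀ {t : ℝ}, 0 < t → t < 1 → ∀ z : ℂ, ‖z‖ ≤ 1 → (t : ℂ) * z ∈ ball (0 : ℂ) 1 := by
    intro t h0 h1 z hz
    rw [mem_ball_zero_iff, norm_mul, Complex.norm_real, Real.norm_of_nonneg h0.le]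
    nlinarith [norm_nonneg z]
  have hpos : ∀ t : ℝ, 0 < t → t < 1 →
      0 ≤ (∑ w ∈ s, ∑ z ∈ s,
        kernelFun (fun x => b ((t : ℂ) * x)) w z * c w * conj (c z)).re := by
    intro t h0 h1
    apply kernel_form_nonneg_aux
    · apply DifferentiableOn.diffContOnCl
      rw [closure_ball _ one_ne_zero]
      exact b.differentiableOn.comp (by fun_prop) fun z hz => hmaps h0 h1 z (by simpa using hz)
    · exact fun z hz => b.norm_le_one _ (hmaps h0 h1 z hz)
  have hlimb : ∀ z : 𝔻, Tendsto (fun t : ℝ => b ((t : ℂ) * z)) (𝓝[<] 1) (𝓝 (b z)) := by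
    intro z
    have hc : ContinuousAt b.toFun (z : ℂ) :=
      (b.differentiableOn.differentiableAt (isOpen_ball.mem_nhds
        (mem_ball_zero_iff.2 z.norm_lt_one))).continuousAt
    have h1 : Tendsto (fun t : ℝ => (t : ℂ) * (z : ℂ)) (𝓝 1) (𝓝 (z : ℂ)) := by
      have : Continuous fun t : ℝ => (t : ℂ) * (z : ℂ) := by fun_prop
      simpa using this.tendsto 1
    exact hc.tendsto.comp (h1.mono_left nhdsWithin_le_nhds)
  have hlim : Tendsto (fun t : ℝ => (∑ w ∈ s, ∑ z ∈ s,
        kernelFun (fun x => b ((t : ℂ) * x)) w z * c w * conj (c z)).re) (𝓝[<] 1)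
      (𝓝 (∑ w ∈ s, ∑ z ∈ s, kernelFun b w z * c w * conj (c z)).re) := by
    refine (Complex.continuous_re.tendsto _).comp ?_
    refine tendsto_finsetSum _ fun w _ => tendsto_finsetSum _ fun z _ => ?_
    refine Tendsto.mul_const _ (Tendsto.mul_const _ ?_)
    unfold kernelFun
    refine Tendsto.div_const (Tendsto.const_sub _ (Tendsto.mul ?_ (hlimb z))) _
    exact (Complex.continuous_conj.tendsto _).comp (hlimb w)
  refine ge_of_tendsto hlim ?_
  have h0 : ∀ᶠ t : ℝ in 𝓝[<] 1, 0 < t :=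
    nhdsWithin_le_nhds (lt_mem_nhds one_pos)
  filter_upwards [h0, self_mem_nhdsWithin] with t h0 h1 using hpos t h0 h1

theorem kernelMatrix_posSemidef (b : SchurFunction) : (kernelMatrix b).PosSemidef := by
  have htfae := (RKHS.posSemidef_tfae (K := kernelMatrix b)).out 0 2
  rw [htfae]
  refine ⟨?_, fun v => ?_⟩
  · ext z w
    have hadj : ∀ x : ℂ, ContinuousLinearMap.adjoint (x • ContinuousLinearMap.id ℂ ℂ)
        = conj x • ContinuousLinearMap.id ℂ ℂ := by
      intro x
      rw [map_smulₛₗ, ContinuousLinearMap.adjoint_id]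
    simp only [Matrix.conjTranspose_apply, ContinuousLinearMap.star_eq_adjoint, kernelMatrix,
      Matrix.of_apply, hadj]
    simp [kernelFun, mul_comm]
  · have h := kernel_form_nonneg b v.support v
    have e : (v.sum fun x w => v.sum fun x' w' => ⟪kernelMatrix b x' x w, w'⟫_ℂ)
        = conj (∑ w ∈ v.support, ∑ z ∈ v.support, kernelFun b w z * v w * conj (v z)) := by
      simp only [Finsupp.sum, map_sum]
      refine Finset.sum_congr rfl fun w _ => Finset.sum_congr rfl fun z _ => ?_
      simp [kernelMatrix]
      ring
    rw [e, RCLike.conj_re]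
    exact h

instance (b : SchurFunction) : Fact (kernelMatrix b).PosSemidef := ⟨kernelMatrix_posSemidef b⟩

/-- The de Branges–Rovnyak space `H(b)`: the reproducing kernel Hilbert space of functions on the
unit disc with kernel `k^b`. -/
abbrev Space (b : SchurFunction) : Type := RKHS.OfKernel (kernelMatrix b)

/-- `H(b)` as a vector space of functions on the unit disc. -/
def spaceFunctions (b : SchurFunction) : Submodule ℂ (𝔻 → ℂ) :=
  (RKHS.coeCLM ℂ : Space b →L[ℂ] 𝔻 → ℂ).range

/-- The subspace of `H(b)` consisting of those elements that, as functions, belong to `M`. -/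
def subspaceOf (b : SchurFunction) (M : Submodule ℂ (𝔻 → ℂ)) : Submodule ℂ (Space b) :=
  M.comap (RKHS.coeCLM ℂ : Space b →L[ℂ] 𝔻 → ℂ).toLinearMap

/-! ### The Hardy space `H²` -/

/-- `F` is analytic on the unit disc with bounded quadratic means over the circles `|z| = ρ < 1`. -/
def IsHardyTwo (F : ℂ → ℂ) : Prop :=
  DifferentiableOn ℂ F (ball 0 1) ∧
    ∃ C : ℝ, ∀ ρ : ℝ, 0 ≤ ρ → ρ < 1 → Real.circleAverage (fun z => ‖F z‖ ^ 2) 0 ρ ≤ C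

theorem circleIntegrable_norm_sq {F : ℂ → ℂ} (hF : DifferentiableOn ℂ F (ball 0 1)) {ρ : ℝ}
    (h0 : 0 ≤ ρ) (h1 : ρ < 1) : CircleIntegrable (fun z => ‖F z‖ ^ 2) 0 ρ := by
  apply ContinuousOn.circleIntegrable h0
  refine ((hF.continuousOn.mono ?_).norm).pow 2
  intro z hz
  have : ‖z‖ = ρ := by simpa using hz
  rw [mem_ball_zero_iff]; linarith

theorem IsHardyTwo.add {F G : ℂ → ℂ} (hF : IsHardyTwo F) (hG : IsHardyTwo G) :
    IsHardyTwo (fun z => F z + G z) := by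
  obtain ⟨hF, C, hC⟩ := hF
  obtain ⟨hG, D, hD⟩ := hG
  refine ⟨hF.add hG, 2 * C + 2 * D, fun ρ h0 h1 => ?_⟩
  have iF : CircleIntegrable (fun z => (2 : ℝ) • ‖F z‖ ^ 2) 0 ρ :=
    (circleIntegrable_norm_sq hF h0 h1).const_smul
  have iG : CircleIntegrable (fun z => (2 : ℝ) • ‖G z‖ ^ 2) 0 ρ :=
    (circleIntegrable_norm_sq hG h0 h1).const_smul
  have hle : Real.circleAverage (fun z => ‖F z + G z‖ ^ 2) 0 ρ
      ≤ Real.circleAverage (fun z => (2 : ℝ) • ‖F z‖ ^ 2 + (2 : ℝ) • ‖G z‖ ^ 2) 0 ρ := by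
    apply Real.circleAverage_mono (circleIntegrable_norm_sq (hF.add hG) h0 h1)
    · exact iF.add iG
    · intro z _
      simp only [smul_eq_mul, Pi.add_apply]
      have := norm_add_le (F z) (G z)
      nlinarith [norm_nonneg (F z + G z), sq_nonneg (‖F z‖ - ‖G z‖), norm_nonneg (F z),
        norm_nonneg (G z)]
  rw [Real.circleAverage_fun_add iF iG, Real.circleAverage_fun_smul, Real.circleAverage_fun_smul] at hle
  have := hC ρ h0 h1
  have := hD ρ h0 h1
  simp only [smul_eq_mul] at hle
  linarith

theorem IsHardyTwo.const_mul {F : ℂ → ℂ} (c : ℂ) (hF : IsHardyTwo F) :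
    IsHardyTwo (fun z => c * F z) := by
  obtain ⟨hF, C, hC⟩ := hF
  refine ⟨hF.const_mul c, ‖c‖ ^ 2 * C, fun ρ h0 h1 => ?_⟩
  have e : (fun z => ‖c * F z‖ ^ 2) = fun z => (‖c‖ ^ 2) • ‖F z‖ ^ 2 := by
    funext z; rw [norm_mul, mul_pow, smul_eq_mul]
  rw [e, Real.circleAverage_fun_smul, smul_eq_mul]
  exact mul_le_mul_of_nonneg_left (hC ρ h0 h1) (by positivity)

/-- The Hardy space `H²`, as a vector space of functions on the unit disc. -/
def hardyTwo : Submodule ℂ (𝔻 → ℂ) where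
  carrier := {f | ∃ F : ℂ → ℂ, IsHardyTwo F ∧ ∀ z : 𝔻, f z = F z}
  add_mem' := by
    rintro f g ⟨F, hF, hf⟩ ⟨G, hG, hg⟩
    exact ⟨_, hF.add hG, fun z => by simp [hf, hg]⟩
  zero_mem' := ⟨0, ⟨differentiableOn_const 0, 0, fun ρ _ _ => by simp [Real.circleAverage_const]⟩,
    fun _ => rfl⟩
  smul_mem' := by
    rintro c f ⟨F, hF, hf⟩
    exact ⟨_, hF.const_mul c, fun z => by simp [hf]⟩

/-- The vector space `φ H²` of functions on the unit disc. -/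
def mulHardyTwo (φ : ℂ → ℂ) : Submodule ℂ (𝔻 → ℂ) :=
  hardyTwo.map (LinearMap.mulLeft ℂ fun z : 𝔻 => φ z)

/-! ### Rational and outer functions, Pythagorean mates -/

/-- `f` agrees on the unit disc with a rational function without poles there. -/
def IsRational (f : ℂ → ℂ) : Prop :=
  ∃ P Q : Polynomial ℂ, ∀ z ∈ ball (0 : ℂ) 1, Q.eval z ≠ 0 ∧ f z = P.eval z / Q.eval z

/-- `f(z) = c exp (∫ (ζ + z) / (ζ - z) u(ζ) dm(ζ))` on the unit disc, with `|c| = 1` and `u` real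
and integrable on the unit circle. -/
def IsOuter (f : ℂ → ℂ) : Prop :=
  ∃ (c : ℂ) (u : ℂ → ℝ), ‖c‖ = 1 ∧ CircleIntegrable u 0 1 ∧
    ∀ z ∈ ball (0 : ℂ) 1,
      f z = c * exp (Real.circleAverage (fun ζ => (ζ + z) / (ζ - z) * (u ζ : ℂ)) 0 1)

/-- `a` is outer, `a(0) > 0`, and `|a|² + |b|² = 1` almost everywhere on the unit circle in the
sense of radial boundary values. -/
def IsPythagoreanMate (a b : SchurFunction) : Prop :=
  IsOuter a ∧ (0 < (a 0).re ∧ (a 0).im = 0) ∧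
    ∀ᵐ t : ℝ, ∃ α β : ℂ,
      Tendsto (fun ρ : ℝ => a (circleMap 0 ρ t)) (𝓝[<] 1) (𝓝 α) ∧
      Tendsto (fun ρ : ℝ => b (circleMap 0 ρ t)) (𝓝[<] 1) (𝓝 β) ∧
      ‖α‖ ^ 2 + ‖β‖ ^ 2 = 1

/-! ### Powers -/

/-- An analytic logarithm of `q` on the unit disc. -/
structure LogBranch (q : SchurFunction) where
  toFun : ℂ → ℂ
  differentiableOn : DifferentiableOn ℂ toFun (ball 0 1)
  exp_eq : ∀ z ∈ ball (0 : ℂ) 1, exp (toFun z) = q z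

/-- The power `q^r = exp (r log q)` for a given analytic logarithm of `q`. -/
def SchurFunction.power (q : SchurFunction) (L : LogBranch q) (r : ℝ) (hr : 0 < r) :
    SchurFunction where
  toFun z := exp (r * L.toFun z)
  differentiableOn := (L.differentiableOn.const_mul (r : ℂ)).cexp
  norm_le_one z hz := by
    have h := q.norm_le_one z hz
    rw [← L.exp_eq z hz, Complex.norm_exp, Real.exp_le_one_iff] at h
    rw [Complex.norm_exp, Real.exp_le_one_iff, Complex.re_ofReal_mul]
    exact mul_nonpos_of_nonneg_of_nonpos hr.le h

/-- A nonvanishing `q` has an analytic logarithm. -/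
theorem nonempty_logBranch (q : SchurFunction) (hq : ∀ z ∈ ball (0 : ℂ) 1, q z ≠ 0) :
    Nonempty (LogBranch q) := by
  have hqd : ∀ z ∈ ball (0 : ℂ) 1, DifferentiableAt ℂ q.toFun z := fun z hz =>
    q.differentiableOn.differentiableAt (isOpen_ball.mem_nhds hz)
  have hd : DifferentiableOn ℂ (fun z => deriv q.toFun z / q z) (ball 0 1) :=
    (q.differentiableOn.deriv isOpen_ball).fun_div q.differentiableOn hq
  have h0 : (0 : ℂ) ∈ ball (0 : ℂ) 1 := by simp
  obtain ⟨P, hP0, hP⟩ := hd.isExactOn_ball.with_val_at 0 (log (q 0))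
  have hconst : ∀ z ∈ ball (0 : ℂ) 1, q z * exp (-P z) = q 0 * exp (-P 0) := by
    intro z hz
    have hder : ∀ w ∈ ball (0 : ℂ) 1, HasDerivAt (fun w => q w * exp (-P w)) 0 w := by
      intro w hw
      have h := (hqd w hw).hasDerivAt.fun_mul (hP w hw).fun_neg.cexp
      convert! h using 1
      have := hq w hw
      field_simp
      ring
    exact (convex_ball (0 : ℂ) 1).is_const_of_fderivWithin_eq_zero (𝕜 := ℂ)
      (f := fun w => q w * exp (-P w))
      (fun w hw => (hder w hw).differentiableAt.differentiableWithinAt)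
      (fun w hw => by
        rw [fderivWithin_of_isOpen isOpen_ball hw, (hder w hw).hasFDerivAt.fderiv]
        ext; simp) hz h0
  refine ⟨⟨P, fun z hz => (hP z hz).differentiableAt.differentiableWithinAt, fun z hz => ?_⟩⟩
  have h := hconst z hz
  have h2 : q 0 * exp (-P 0) = 1 := by
    rw [hP0, Complex.exp_neg, Complex.exp_log (hq 0 h0), mul_inv_cancel₀ (hq 0 h0)]
  rw [h2, Complex.exp_neg] at h
  field_simp at h
  exact h.symm

/-! ### Boundary behaviour -/

/-- `F` continues `f` analytically from the unit disc to a neighbourhood of `ζ`. -/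
def IsAnalyticExtensionAt (f : ℂ → ℂ) (ζ : ℂ) (F : ℂ → ℂ) : Prop :=
  AnalyticAt ℂ F ζ ∧ ∀ᶠ z in 𝓝[ball (0 : ℂ) 1] ζ, F z = f z

/-- `ζ` is a zero of (the analytic continuation of) `f` of multiplicity `k`. -/
def HasZeroOfMultiplicity (f : ℂ → ℂ) (ζ : ℂ) (k : ℕ) : Prop :=
  0 < k ∧ ∃ F, IsAnalyticExtensionAt f ζ F ∧ analyticOrderAt F ζ = k

/-- `ζ 1, …, ζ n` are the distinct zeros of `f` on the unit circle, with multiplicities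
`m 1, …, m n`. -/
def IsCircleZeros (f : ℂ → ℂ) {n : ℕ} (ζ : Fin n → ℂ) (m : Fin n → ℕ) : Prop :=
  Function.Injective ζ ∧ (∀ j, ‖ζ j‖ = 1) ∧ (∀ j, HasZeroOfMultiplicity f (ζ j) (m j)) ∧
    ∀ η : ℂ, ‖η‖ = 1 → ∀ k, HasZeroOfMultiplicity f η k → ∃ j, ζ j = η

/-- `v` is the derivative kernel `z ↦ (d/d(conj w))^ℓ k^b_w(z)` at `w = ζ`, where `ζ` lies in the
closed unit disc and `b` continues analytically to a neighbourhood of `ζ`. The variable `x` below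
stands for `conj w`. -/
def IsKernelDeriv (b : ℂ → ℂ) (ℓ : ℕ) (ζ : ℂ) (v : 𝔻 → ℂ) : Prop :=
  ∃ B : ℂ → ℂ, IsAnalyticExtensionAt b ζ B ∧ ∀ z : 𝔻,
    v z = iteratedDeriv ℓ (fun x : ℂ => (1 - conj (B (conj x)) * b z) / (1 - x * z)) (conj ζ)

end DBR

end

open DBR

open Complex Metric Filter Topology
open scoped ComplexConjugate UnitDisc InnerProductSpace

noncomputable section

namespace DBR

/-! ### The unit circle as an additive circle, and the `L²` norm of continuous functions on it -/

/-! Let `b` be `q` or `q^r`, and suppose first that `|q|` is not identically 1 on the circle.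
Everything rests on one polynomial `p`, the same for every exponent, with all its roots on the
circle and `|p|²` comparable there to `1 - |b|²`. By a Fejér–Riesz argument `1 - |q|² = |p e^g|²` on
the circle, with `g` analytic near the closed disc (`exists_outer_factor`), and `1 - y^r` is
comparable to `1 - y` on `[0,1]`.

For a finite combination `h` of Szegő kernels put `g = P₊(b̄ h)`. The corresponding combination of
kernels of `H(b)` has squared norm `‖h‖² - ‖g‖²`, which is rewritten in two ways as an integral over
the circle (`norm_kernelSum_sq`, `norm_kernelSum_sq'`). A function `f` belongs to `H(b)` exactly
when `h ↦ ⟨h, f⟩` is bounded in this norm, so estimates of the norm become inclusions. The bound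
`|p|² ≤ C (1 - |b|²)` puts `p H²` and all polynomials into `H(b)` (`mul_mem_spaceFunctions`,
`pow_mem_spaceFunctions`). Conversely, `b̄` agrees on the circle up to `O(|p|)` with a polynomial,
obtained by Hermite interpolation at the roots of `p`; hence the norm is at most a constant times
`‖p h‖` in `L²` (`norm_kernelSum_le`). Each `f` in `H(b)` is then `P₊(p̄ ψ)` with `ψ` in `L²`. As
`p̄` is a constant times `z̄^(deg p) p` on the circle, such a function is `p φ + S` with `φ` in `H²`
and `S` a polynomial of degree below `deg p` (`exists_decomposition`). So `H(b) = p H² +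
{polynomials of degree < deg p}`, a description in which `r` does not occur; this is the first
claim. If `|q| = 1` on the whole circle, then `q`, being zero-free, is unimodular in the disc and
both spaces are zero.

For the second claim, the growth estimate `|φ(w)|² (1 - |w|²) ≤ D` for `H²` functions shows that `p
φ` cannot coincide in the disc with a function analytic at a root of `p` and vanishing there to
lower order than `p`. Hence `S` is determined by `f`, and `f ↦ S^(ℓ)(ζ_j)` is a bounded functional.
Evaluating it on kernel functions identifies its representing vector as the derivative kernel `v^ℓ`
at `ζ_j`. These vectors are orthogonal to `p H²`, where `S = 0`; and a function orthogonal to all of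
them has `S = 0` by counting zeros, so it lies in `p H²`.

Finally `a = c p e^g`: both sides are outer and have the same boundary modulus almost everywhere, so
uniqueness for Poisson integrals applies (`IsPythagoreanMate.exists_eq`). Thus `a H² = p H²`, and
the circle zeros of `a` are the roots of `p`. -/

instance fact_two_pi_pos : Fact (0 < 2 * Real.pi) := ⟨Real.two_pi_pos⟩

/-- Continuous functions on the unit circle. -/
abbrev CircleFun := C(AddCircle (2 * Real.pi), ℂ)

/-- The coordinate function of the unit circle. -/
def coordFun : CircleFun := ⟨fun θ => θ.toCircle, by fun_prop⟩

theorem coordFun_apply (θ : AddCircle (2 * Real.pi)) : coordFun θ = (θ.toCircle : ℂ) := rfl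

theorem norm_coordFun_apply (θ : AddCircle (2 * Real.pi)) : ‖coordFun θ‖ = 1 := by
  rw [coordFun_apply]; exact Circle.norm_coe _

/-- The restriction of a function to the unit circle. -/
def onCircle (F : ℂ → ℂ) (hF : ContinuousOn F (sphere 0 1)) : CircleFun :=
  ⟨fun θ => F θ.toCircle, by
    refine hF.comp_continuous (by fun_prop) fun θ => ?_
    rw [mem_sphere_zero_iff_norm]; exact Circle.norm_coe _⟩

theorem onCircle_apply (F : ℂ → ℂ) (hF : ContinuousOn F (sphere 0 1))
    (θ : AddCircle (2 * Real.pi)) : onCircle F hF θ = F θ.toCircle := rfl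

/-- The class of a continuous function on the unit circle in `L²`. -/
abbrev toL2 : CircleFun →L[ℂ] MeasureTheory.Lp ℂ 2 (AddCircle.haarAddCircle (T := 2 * Real.pi)) :=
  ContinuousMap.toLp 2 AddCircle.haarAddCircle ℂ

theorem integral_toCircle {E : Type*} [NormedAddCommGroup E] [NormedSpace ℝ E] (f : ℂ → E) :
    ∫ θ : AddCircle (2 * Real.pi), f θ.toCircle ∂AddCircle.haarAddCircle
      = Real.circleAverage f 0 1 := by
  rw [AddCircle.integral_haarAddCircle, Real.circleAverage,
    ← AddCircle.intervalIntegral_preimage (2 * Real.pi) 0]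
  simp [AddCircle.toCircle, circleMap]

theorem inner_toL2_onCircle {F G : ℂ → ℂ} (hF : ContinuousOn F (sphere 0 1))
    (hG : ContinuousOn G (sphere 0 1)) :
    ⟪toL2 (onCircle G hG), toL2 (onCircle F hF)⟫_ℂ
      = Real.circleAverage (fun z => F z * conj (G z)) 0 1 := by
  rw [MeasureTheory.ContinuousMap.inner_toLp, ← integral_toCircle]
  rfl

theorem norm_toL2_onCircle_sq {F : ℂ → ℂ} (hF : ContinuousOn F (sphere 0 1)) :
    ‖toL2 (onCircle F hF)‖ ^ 2 = Real.circleAverage (fun z => ‖F z‖ ^ 2) 0 1 := by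
  have h := inner_toL2_onCircle hF hF
  rw [inner_self_eq_norm_sq_to_K] at h
  have e : (fun z => F z * conj (F z)) = Complex.ofRealCLM ∘ fun z => ‖F z‖ ^ 2 := by
    funext z; simp [Complex.mul_conj, Complex.normSq_eq_norm_sq]
  rw [e, ContinuousLinearMap.circleAverage_comp_comm] at h
  · rw [Complex.ofRealCLM_apply] at h
    exact Complex.ofReal_injective (by rw [← h]; push_cast; rfl)
  · exact ContinuousOn.circleIntegrable zero_le_one (by fun_prop)

theorem norm_toL2_congr {F G : CircleFun} (h : ∀ θ, ‖F θ‖ = ‖G θ‖) : ‖toL2 F‖ = ‖toL2 G‖ := by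
  have key : ∀ F : CircleFun, ‖toL2 F‖ ^ 2
      = ∫ θ, ‖F θ‖ ^ 2 ∂AddCircle.haarAddCircle (T := 2 * Real.pi) := by
    intro F
    have h := MeasureTheory.ContinuousMap.inner_toLp (𝕜 := ℂ)
      (AddCircle.haarAddCircle (T := 2 * Real.pi)) F F
    rw [inner_self_eq_norm_sq_to_K] at h
    have e : ∀ θ, F θ * conj (F θ) = ((‖F θ‖ ^ 2 : ℝ) : ℂ) := by
      intro θ; simp [Complex.mul_conj, Complex.normSq_eq_norm_sq]
    simp only [e] at h
    rw [integral_complex_ofReal] at h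
    exact Complex.ofReal_injective (by rw [← h]; push_cast; rfl)
  rw [← sq_eq_sq₀ (norm_nonneg _) (norm_nonneg _), key, key]
  simp only [h]

theorem norm_circleAverage_mul_conj_le {F G : ℂ → ℂ} (hF : ContinuousOn F (sphere 0 1))
    (hG : ContinuousOn G (sphere 0 1)) :
    ‖Real.circleAverage (fun z => F z * conj (G z)) 0 1‖
      ≤ √(Real.circleAverage (fun z => ‖F z‖ ^ 2) 0 1)
        * √(Real.circleAverage (fun z => ‖G z‖ ^ 2) 0 1) := by
  rw [← inner_toL2_onCircle hF hG, ← norm_toL2_onCircle_sq hF, ← norm_toL2_onCircle_sq hG,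
    Real.sqrt_sq (norm_nonneg _), Real.sqrt_sq (norm_nonneg _)]
  exact (norm_inner_le_norm _ _).trans_eq (mul_comm _ _)

theorem continuousOn_sphere_of_diffContOnCl {F : ℂ → ℂ} (hF : DiffContOnCl ℂ F (ball 0 1)) :
    ContinuousOn F (sphere 0 1) :=
  hF.2.mono (by rw [closure_ball _ one_ne_zero]; exact sphere_subset_closedBall)

theorem circleIntegrable_of_continuousOn {E : Type*} [NormedAddCommGroup E] {F : ℂ → E}
    (hF : ContinuousOn F (sphere 0 1)) : CircleIntegrable F 0 1 :=
  hF.circleIntegrable zero_le_one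

/-! ### Szegő kernels -/

/-- The Szegő kernel of the unit disc. -/
def szego (w z : ℂ) : ℂ := 1 / (1 - conj w * z)

theorem szego_eq (w : 𝔻) {z : ℂ} (hz : ‖z‖ ≤ 1) :
    szego w z = 1 + conj (w : ℂ) * z * szego w z := by
  have := one_sub_conj_mul_ne_zero w.norm_lt_one hz
  unfold szego
  field_simp
  ring

theorem diffContOnCl_szego (w : 𝔻) : DiffContOnCl ℂ (szego w) (ball 0 1) := by
  have : DifferentiableOn ℂ (szego w) (closedBall 0 1) := by
    intro z hz
    have hne : 1 - conj (w : ℂ) * z ≠ 0 :=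
      one_sub_conj_mul_ne_zero w.norm_lt_one (by simpa using hz)
    unfold szego
    have h1 : DifferentiableAt ℂ (fun z : ℂ => 1 - conj (w : ℂ) * z) z := by fun_prop
    exact (DifferentiableAt.fun_div (differentiableAt_const _) h1 hne).differentiableWithinAt
  exact DifferentiableOn.diffContOnCl (by rwa [closure_ball _ one_ne_zero])

/-- The linear combination of Szegő kernels with coefficients `c`. -/
def szegoSum (c : 𝔻 →₀ ℂ) (z : ℂ) : ℂ := ∑ w ∈ c.support, c w * szego w z

theorem diffContOnCl_sum_szego (s : Finset 𝔻) (d : 𝔻 → ℂ) :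
    DiffContOnCl ℂ (fun z => ∑ w ∈ s, d w * szego w z) (ball 0 1) :=
  ⟨DifferentiableOn.fun_sum fun w _ => (diffContOnCl_szego w).1.const_mul _,
    continuousOn_finsetSum _ fun w _ => (diffContOnCl_szego w).2.const_mul _⟩

theorem diffContOnCl_szegoSum (c : 𝔻 →₀ ℂ) : DiffContOnCl ℂ (szegoSum c) (ball 0 1) :=
  diffContOnCl_sum_szego _ _

theorem _root_.DiffContOnCl.mul' {F G : ℂ → ℂ} {s : Set ℂ} (hF : DiffContOnCl ℂ F s)
    (hG : DiffContOnCl ℂ G s) : DiffContOnCl ℂ (fun z => F z * G z) s :=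
  ⟨hF.1.mul hG.1, hF.2.mul hG.2⟩

/-- The reproducing property of linear combinations of Szegő kernels. -/
theorem circleAverage_mul_conj_sum_szego {F : ℂ → ℂ} (hF : DiffContOnCl ℂ F (ball 0 1))
    (s : Finset 𝔻) (d : 𝔻 → ℂ) :
    Real.circleAverage (fun z => F z * conj (∑ w ∈ s, d w * szego w z)) 0 1
      = ∑ w ∈ s, conj (d w) * F w := by
  have e : (fun z => F z * conj (∑ w ∈ s, d w * szego w z))
      = fun z => ∑ w ∈ s, conj (d w) • (F z * conj (szego w z)) := by
    funext z
    rw [map_sum, Finset.mul_sum]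
    refine Finset.sum_congr rfl fun w _ => ?_
    simp only [map_mul, smul_eq_mul]; ring
  rw [e, Real.circleAverage_fun_sum]
  · refine Finset.sum_congr rfl fun w _ => ?_
    rw [Real.circleAverage_fun_smul]
    unfold szego
    rw [circleAverage_mul_szego hF w.norm_lt_one, smul_eq_mul]
  · intro w _
    apply circleIntegrable_of_continuousOn
    have := continuousOn_sphere_of_diffContOnCl (diffContOnCl_szego w)
    have := continuousOn_sphere_of_diffContOnCl hF
    fun_prop

/-! ### A representation lemma -/

/-- A linear functional dominated by the norm of a linear map into a Hilbert space is represented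
by a vector of that Hilbert space. -/
theorem exists_inner_eq_of_norm_le {V E : Type*} [AddCommGroup V] [Module ℂ V]
    [NormedAddCommGroup E] [InnerProductSpace ℂ E] [CompleteSpace E] (T : V →ₗ[ℂ] E)
    (φ : V →ₗ[ℂ] ℂ) {C : ℝ} (hC : 0 ≤ C) (h : ∀ x, ‖φ x‖ ≤ C * ‖T x‖) :
    ∃ y : E, ‖y‖ ≤ C ∧ ∀ x, ⟪y, T x⟫_ℂ = φ x := by
  -- A merely linear section suffices: the bound makes `φ` vanish on the kernel of `T`, so `φ ∘ g`
  -- does not depend on the section and inherits continuity from the same bound.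
  obtain ⟨g, hg⟩ := T.rangeRestrict.exists_rightInverse_of_surjective T.range_rangeRestrict
  have hTg : ∀ y, T (g y) = y := fun y =>
    congrArg Subtype.val (LinearMap.congr_fun hg y)
  let ψ : LinearMap.range T →L[ℂ] ℂ := (φ ∘ₗ g).mkContinuous C fun y => by
    refine (h (g y)).trans_eq ?_
    rw [hTg]; rfl
  have hψ : ∀ x, ψ (T.rangeRestrict x) = φ x := by
    intro x
    have h1 := h (g (T.rangeRestrict x) - x)
    rw [map_sub, map_sub T, hTg] at h1
    rw [show ((T.rangeRestrict x : LinearMap.range T) : E) = T x from rfl, sub_self, norm_zero,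
      mul_zero] at h1
    exact sub_eq_zero.1 (norm_le_zero_iff.1 h1)
  obtain ⟨f, hf, hfn⟩ := exists_extension_norm_eq _ ψ
  refine ⟨(InnerProductSpace.toDual ℂ E).symm f, ?_, fun x => ?_⟩
  · rw [LinearIsometryEquiv.norm_map, hfn]
    exact LinearMap.mkContinuous_norm_le _ hC _
  · rw [InnerProductSpace.toDual_symm_apply, ← hψ]
    exact hf (T.rangeRestrict x)

/-! ### Kernel functions in `H(b)` -/

/-- The kernel function of `H(b)` at `w`. -/
def kernelVec (b : SchurFunction) (w : 𝔻) : Space b := RKHS.kerFun (Space b) w 1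

theorem kernelVec_apply (b : SchurFunction) (w z : 𝔻) :
    kernelVec b w z = kernelFun b w z := by
  rw [kernelVec, RKHS.kerFun_apply, RKHS.OfKernel.kernel_ofKernel]
  simp [kernelMatrix]

theorem inner_kernelVec (b : SchurFunction) (w : 𝔻) (f : Space b) :
    ⟪kernelVec b w, f⟫_ℂ = f w := by
  rw [kernelVec, RKHS.kerFun_inner]
  simp

/-- Linear combinations of kernel functions. -/
def kernelSum (b : SchurFunction) : (𝔻 →₀ ℂ) →ₗ[ℂ] Space b :=
  Finsupp.linearCombination ℂ (kernelVec b)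

theorem inner_kernelSum (b : SchurFunction) (c : 𝔻 →₀ ℂ) (f : Space b) :
    ⟪kernelSum b c, f⟫_ℂ = ∑ w ∈ c.support, conj (c w) * f w := by
  rw [kernelSum, Finsupp.linearCombination_apply, Finsupp.sum, sum_inner]
  refine Finset.sum_congr rfl fun w _ => ?_
  rw [inner_smul_left, inner_kernelVec]

theorem kernelSum_apply (b : SchurFunction) (c : 𝔻 →₀ ℂ) (z : 𝔻) :
    kernelSum b c z = ∑ w ∈ c.support, c w * kernelFun b w z := by
  rw [← inner_kernelVec, ← inner_conj_symm, inner_kernelSum, map_sum]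
  refine Finset.sum_congr rfl fun w _ => ?_
  rw [← inner_kernelVec, map_mul, inner_conj_symm, inner_kernelVec, kernelVec_apply,
    Complex.conj_conj]

theorem inner_kernelSum_self (b : SchurFunction) (c : 𝔻 →₀ ℂ) :
    ⟪kernelSum b c, kernelSum b c⟫_ℂ
      = ∑ w ∈ c.support, ∑ z ∈ c.support, kernelFun b w z * c w * conj (c z) := by
  rw [inner_kernelSum, Finset.sum_comm]
  refine Finset.sum_congr rfl fun z _ => ?_
  rw [kernelSum_apply, Finset.mul_sum]
  exact Finset.sum_congr rfl fun w _ => by ring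

theorem mem_spaceFunctions (b : SchurFunction) (f : 𝔻 → ℂ) :
    f ∈ spaceFunctions b ↔ ∃ F : Space b, ⇑F = f := Iff.rfl

/-- A function belongs to `H(b)` as soon as the functional that it induces on linear combinations
of kernel functions is bounded. -/
theorem mem_spaceFunctions_of_norm_le (b : SchurFunction) (f : 𝔻 → ℂ) {C : ℝ} (hC : 0 ≤ C)
    (h : ∀ c : 𝔻 →₀ ℂ, ‖∑ w ∈ c.support, conj (c w) * f w‖ ≤ C * ‖kernelSum b c‖) :
    f ∈ spaceFunctions b := by
  obtain ⟨F, -, hF⟩ := exists_inner_eq_of_norm_le (kernelSum b)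
    (Finsupp.linearCombination ℂ fun w => conj (f w)) hC fun c => by
      have e : Finsupp.linearCombination ℂ (fun w => conj (f w)) c
          = conj (∑ w ∈ c.support, conj (c w) * f w) := by
        rw [Finsupp.linearCombination_apply, Finsupp.sum, map_sum]
        exact Finset.sum_congr rfl fun w _ => by simp
      rw [e, RCLike.norm_conj]
      exact h c
  refine (mem_spaceFunctions b f).2 ⟨F, funext fun w => ?_⟩
  have h1 := hF (Finsupp.single w 1)
  rw [kernelSum, Finsupp.linearCombination_single, Finsupp.linearCombination_single, one_smul,
    one_smul] at h1
  rw [← inner_kernelVec, ← inner_conj_symm, h1, Complex.conj_conj]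

/-! ### The norm of a linear combination of kernel functions as an integral over the circle -/

/-- `B` is an extension of `b` to the closed unit disc, analytic inside and continuous up to the
boundary. -/
structure IsDiscExtension (b : SchurFunction) (B : ℂ → ℂ) : Prop where
  diffContOnCl : DiffContOnCl ℂ B (ball 0 1)
  eqOn : Set.EqOn B b (ball 0 1)

theorem IsDiscExtension.norm_le_one {b : SchurFunction} {B : ℂ → ℂ} (hB : IsDiscExtension b B)
    {z : ℂ} (hz : ‖z‖ ≤ 1) : ‖B z‖ ≤ 1 := by
  have hz' : z ∈ closure (ball (0 : ℂ) 1) := by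
    rw [closure_ball _ one_ne_zero]; simpa using hz
  refine le_on_closure (f := fun z => ‖B z‖) (g := fun _ => (1 : ℝ)) (fun w hw => ?_)
    hB.diffContOnCl.2.norm continuousOn_const hz'
  show ‖B w‖ ≤ 1
  rw [hB.eqOn hw]
  exact b.norm_le_one w hw

/-- The analytic function `∑ c w * conj (b w) / (1 - conj w * z)`. -/
def twistedSum (b : SchurFunction) (c : 𝔻 →₀ ℂ) (z : ℂ) : ℂ :=
  ∑ w ∈ c.support, (conj (b w) * c w) * szego w z

theorem diffContOnCl_twistedSum (b : SchurFunction) (c : 𝔻 →₀ ℂ) :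
    DiffContOnCl ℂ (twistedSum b c) (ball 0 1) := diffContOnCl_sum_szego _ _

/-- Here `twistedSum b c` is `g = P₊(b̄ h)` for `h = szegoSum c`. By the reproducing property both
`‖g‖²` and the mean of `B g h̄` equal the same double sum, so the integral is `‖h‖² - ‖g‖²`. This
form displays two nonnegative pieces, `h - B g` without weight and `g` with weight `1 - |B|²`; it
serves the proofs of membership in `H(b)`. -/
theorem norm_kernelSum_sq {b : SchurFunction} {B : ℂ → ℂ} (hB : IsDiscExtension b B)
    (c : 𝔻 →₀ ℂ) :
    ‖kernelSum b c‖ ^ 2 = Real.circleAverage (fun z => ‖szegoSum c z - B z * twistedSum b c z‖ ^ 2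
      + (1 - ‖B z‖ ^ 2) * ‖twistedSum b c z‖ ^ 2) 0 1 := by
  set h := szegoSum c with hh
  set g := twistedSum b c with hg
  have hbgd := hB.diffContOnCl.mul' (diffContOnCl_twistedSum b c)
  have ch := continuousOn_sphere_of_diffContOnCl (diffContOnCl_szegoSum c)
  have cg := continuousOn_sphere_of_diffContOnCl (diffContOnCl_twistedSum b c)
  have cB := continuousOn_sphere_of_diffContOnCl hB.diffContOnCl
  rw [← hh] at ch
  rw [← hg] at cg hbgd
  have A1 : Real.circleAverage (fun z => h z * conj (h z)) 0 1 = _ :=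
    circleAverage_mul_conj_sum_szego (diffContOnCl_szegoSum c) c.support c
  have A2 : Real.circleAverage (fun z => g z * conj (g z)) 0 1 = _ :=
    circleAverage_mul_conj_sum_szego (diffContOnCl_twistedSum b c) c.support
      fun w => conj (b w) * c w
  have A3 : Real.circleAverage (fun z => B z * g z * conj (h z)) 0 1 = _ :=
    circleAverage_mul_conj_sum_szego hbgd c.support c
  set Φ : ℂ → ℂ := fun z => h z * conj (h z) + g z * conj (g z)
    - (2 : ℂ) • (B z * g z * conj (h z)) with hΦ
  have IΦ : CircleIntegrable Φ 0 1 := circleIntegrable_of_continuousOn (by fun_prop)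
  have key : Real.circleAverage Φ 0 1 = ⟪kernelSum b c, kernelSum b c⟫_ℂ := by
    rw [hΦ, Real.circleAverage_fun_sub (circleIntegrable_of_continuousOn (by fun_prop))
      (circleIntegrable_of_continuousOn (by fun_prop)),
      Real.circleAverage_fun_add (circleIntegrable_of_continuousOn (by fun_prop))
      (circleIntegrable_of_continuousOn (by fun_prop)), Real.circleAverage_fun_smul]
    rw [A1, A2, A3, inner_kernelSum_self, Finset.sum_comm, smul_eq_mul, Finset.mul_sum,
      ← Finset.sum_add_distrib, ← Finset.sum_sub_distrib]
    refine Finset.sum_congr rfl fun z _ => ?_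
    have hBz : B z = b z := hB.eqOn (mem_ball_zero_iff.2 z.norm_lt_one)
    simp only [map_mul, Complex.conj_conj, hg, szegoSum, twistedSum, Finset.mul_sum, hBz]
    rw [← Finset.sum_add_distrib, ← Finset.sum_sub_distrib]
    refine Finset.sum_congr rfl fun w _ => ?_
    simp only [kernelFun, szego]
    ring
  have hre : (Real.circleAverage Φ 0 1).re = Real.circleAverage (fun z => (Φ z).re) 0 1 :=
    (Complex.reCLM.circleAverage_comp_comm IΦ).symm
  rw [← inner_self_eq_norm_sq (𝕜 := ℂ), ← key]
  refine hre.trans (congrArg (fun F => Real.circleAverage F 0 1) (funext fun z => ?_))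
  have : ((2 : ℂ) * (B z * g z * conj (h z))).re = 2 * (h z * conj (B z * g z)).re := by
    simp [Complex.mul_re, Complex.mul_im]; ring
  simp only [hΦ, Complex.sub_re, Complex.add_re, Complex.mul_conj, Complex.ofReal_re,
      smul_eq_mul, this]
  rw [← Complex.normSq_eq_norm_sq, ← Complex.normSq_eq_norm_sq, ← Complex.normSq_eq_norm_sq,
    Complex.normSq_sub, Complex.normSq_mul]
  ring

/-- Pointwise the same integrand, regrouped so that `b̄ h - g` appears. That term is the component
of `b̄ h` orthogonal to `H²`; this form serves the upper estimate of the norm. -/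
theorem norm_kernelSum_sq' {b : SchurFunction} {B : ℂ → ℂ} (hB : IsDiscExtension b B)
    (c : 𝔻 →₀ ℂ) :
    ‖kernelSum b c‖ ^ 2 = Real.circleAverage (fun z => (1 - ‖B z‖ ^ 2) * ‖szegoSum c z‖ ^ 2
      + ‖conj (B z) * szegoSum c z - twistedSum b c z‖ ^ 2) 0 1 := by
  rw [norm_kernelSum_sq hB]
  refine congrArg (fun F => Real.circleAverage F 0 1) (funext fun z => ?_)
  simp only [← Complex.normSq_eq_norm_sq, Complex.normSq_sub, Complex.normSq_mul,
    Complex.normSq_conj]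
  have : (szegoSum c z * conj (B z * twistedSum b c z)).re
      = (conj (B z) * szegoSum c z * conj (twistedSum b c z)).re := by
    congr 1; simp only [map_mul]; ring
  rw [this]
  ring

/-- A function dominated by a product on the circle: the Cauchy–Schwarz inequality. -/
theorem norm_circleAverage_le_of_norm_le_mul {F G H : ℂ → ℂ} (hF : ContinuousOn F (sphere 0 1))
    (hG : ContinuousOn G (sphere 0 1)) (hH : ContinuousOn H (sphere 0 1))
    (h : ∀ z ∈ sphere (0 : ℂ) 1, ‖F z‖ ≤ ‖G z‖ * ‖H z‖) :
    ‖Real.circleAverage F 0 1‖ ≤ √(Real.circleAverage (fun z => ‖G z‖ ^ 2) 0 1)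
        * √(Real.circleAverage (fun z => ‖H z‖ ^ 2) 0 1) := by
  have h1 : ‖Real.circleAverage F 0 1‖ ≤ Real.circleAverage (fun z => ‖F z‖) 0 1 := by
    rw [Real.circleAverage, Real.circleAverage, norm_smul, Real.norm_of_nonneg (by positivity),
      smul_eq_mul]
    exact mul_le_mul_of_nonneg_left
      (intervalIntegral.norm_integral_le_integral_norm Real.two_pi_pos.le) (by positivity)
  have h2 : Real.circleAverage (fun z => ‖F z‖) 0 1
      ≤ Real.circleAverage (fun z => ‖G z‖ * ‖H z‖) 0 1 := by
    apply Real.circleAverage_mono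
    · exact circleIntegrable_of_continuousOn (by fun_prop)
    · exact circleIntegrable_of_continuousOn (by fun_prop)
    · simpa using h
  have h3 := norm_circleAverage_mul_conj_le (F := fun z => (‖G z‖ : ℂ)) (G := fun z => (‖H z‖ : ℂ))
    (by fun_prop) (by fun_prop)
  have e : (fun z => (‖G z‖ : ℂ) * conj (‖H z‖ : ℂ))
      = Complex.ofRealCLM ∘ fun z => ‖G z‖ * ‖H z‖ := by
    funext z; simp
  rw [e, ContinuousLinearMap.circleAverage_comp_comm _
    (circleIntegrable_of_continuousOn (by fun_prop))] at h3
  simp only [Complex.ofRealCLM_apply, Complex.norm_real, norm_norm] at h3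
  exact h1.trans (h2.trans ((le_abs_self _).trans h3))

theorem circleAverage_norm_sq_mul_le {F : ℂ → ℂ} (hF : ContinuousOn F (sphere 0 1))
    {G : ℂ → ℝ} (hG : ContinuousOn G (sphere 0 1)) {C : ℝ}
    (h : ∀ z ∈ sphere (0 : ℂ) 1, ‖F z‖ ^ 2 ≤ C * G z) :
    Real.circleAverage (fun z => ‖F z‖ ^ 2) 0 1 ≤ C * Real.circleAverage G 0 1 := by
  rw [← smul_eq_mul C, ← Real.circleAverage_fun_smul]
  apply Real.circleAverage_mono
  · exact circleIntegrable_of_continuousOn (by fun_prop)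
  · exact circleIntegrable_of_continuousOn (by fun_prop)
  · simpa using h

theorem circleAverage_sub_le_norm_kernelSum_sq {b : SchurFunction} {B : ℂ → ℂ}
    (hB : IsDiscExtension b B) (c : 𝔻 →₀ ℂ) :
    Real.circleAverage (fun z => ‖szegoSum c z - B z * twistedSum b c z‖ ^ 2) 0 1
      ≤ ‖kernelSum b c‖ ^ 2 := by
  have ch := continuousOn_sphere_of_diffContOnCl (diffContOnCl_szegoSum c)
  have cg := continuousOn_sphere_of_diffContOnCl (diffContOnCl_twistedSum b c)
  have cB := continuousOn_sphere_of_diffContOnCl hB.diffContOnCl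
  rw [norm_kernelSum_sq hB]
  apply Real.circleAverage_mono
  · exact circleIntegrable_of_continuousOn (by fun_prop)
  · exact circleIntegrable_of_continuousOn (by fun_prop)
  · intro z hz
    have := hB.norm_le_one (z := z) (by simpa using (sphere_subset_closedBall hz))
    have : 0 ≤ 1 - ‖B z‖ ^ 2 := by nlinarith [norm_nonneg (B z)]
    have := mul_nonneg this (sq_nonneg ‖twistedSum b c z‖)
    simpa using this

theorem circleAverage_twistedSum_le_norm_kernelSum_sq {b : SchurFunction} {B : ℂ → ℂ}
    (hB : IsDiscExtension b B) (c : 𝔻 →₀ ℂ) :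
    Real.circleAverage (fun z => (1 - ‖B z‖ ^ 2) * ‖twistedSum b c z‖ ^ 2) 0 1
      ≤ ‖kernelSum b c‖ ^ 2 := by
  have ch := continuousOn_sphere_of_diffContOnCl (diffContOnCl_szegoSum c)
  have cg := continuousOn_sphere_of_diffContOnCl (diffContOnCl_twistedSum b c)
  have cB := continuousOn_sphere_of_diffContOnCl hB.diffContOnCl
  rw [norm_kernelSum_sq hB]
  apply Real.circleAverage_mono
  · exact circleIntegrable_of_continuousOn (by fun_prop)
  · exact circleIntegrable_of_continuousOn (by fun_prop)
  · intro z hz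
    simp

/-- Split `h = (h - B g) + B g`. The first summand is controlled in `L²` by the kernel norm. The
second is controlled only with the weight `√(1 - |B|²)`, and the factor `p` contained in `θ`
supplies that weight. Only the modulus of `θ` matters, so it may be `p φ` as well as `p̄ φ`. -/
theorem norm_circleAverage_mul_conj_szegoSum_le {b : SchurFunction} {B : ℂ → ℂ}
    (hB : IsDiscExtension b B) {p : Polynomial ℂ} {C M : ℝ} (hM : 0 ≤ M)
    (hpM : ∀ z ∈ sphere (0 : ℂ) 1, ‖p.eval z‖ ≤ M) (hC : 0 ≤ C)
    (hp : ∀ z ∈ sphere (0 : ℂ) 1, ‖p.eval z‖ ^ 2 ≤ C * (1 - ‖B z‖ ^ 2))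
    {θ φ : ℂ → ℂ} (hθ : ContinuousOn θ (sphere 0 1)) (hφ : ContinuousOn φ (sphere 0 1))
    (h : ∀ z ∈ sphere (0 : ℂ) 1, ‖θ z‖ ≤ ‖p.eval z‖ * ‖φ z‖) (c : 𝔻 →₀ ℂ) :
    ‖Real.circleAverage (fun z => θ z * conj (szegoSum c z)) 0 1‖
      ≤ (M + √C) * √(Real.circleAverage (fun z => ‖φ z‖ ^ 2) 0 1) * ‖kernelSum b c‖ := by
  have ch := continuousOn_sphere_of_diffContOnCl (diffContOnCl_szegoSum c)
  have cg := continuousOn_sphere_of_diffContOnCl (diffContOnCl_twistedSum b c)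
  have cB := continuousOn_sphere_of_diffContOnCl hB.diffContOnCl
  have cp : ContinuousOn (fun z => p.eval z) (sphere 0 1) := p.continuous.continuousOn
  set K := ‖kernelSum b c‖
  have e : (fun z => θ z * conj (szegoSum c z))
      = fun z => θ z * conj (szegoSum c z - B z * twistedSum b c z)
        + θ z * conj (B z * twistedSum b c z) := by
    funext z; rw [← mul_add, ← map_add, sub_add_cancel]
  rw [e, Real.circleAverage_fun_add (circleIntegrable_of_continuousOn (by fun_prop))
    (circleIntegrable_of_continuousOn (by fun_prop))]
  have h1 : ‖Real.circleAverage (fun z => θ z * conj (szegoSum c z - B z * twistedSum b c z)) 0 1‖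
      ≤ √(Real.circleAverage (fun z => ‖(M : ℂ) * φ z‖ ^ 2) 0 1) * K := by
    refine (norm_circleAverage_le_of_norm_le_mul (G := fun z => (M : ℂ) * φ z)
      (H := fun z => szegoSum c z - B z * twistedSum b c z) (by fun_prop) (by fun_prop)
      (by fun_prop) fun z hz => ?_).trans ?_
    · rw [norm_mul, RCLike.norm_conj, norm_mul, Complex.norm_real, Real.norm_of_nonneg hM]
      refine mul_le_mul_of_nonneg_right ((h z hz).trans ?_) (norm_nonneg _)
      exact mul_le_mul_of_nonneg_right (hpM z hz) (norm_nonneg _)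
    · refine mul_le_mul_of_nonneg_left ?_ (Real.sqrt_nonneg _)
      exact Real.sqrt_le_iff.2 ⟨norm_nonneg _, circleAverage_sub_le_norm_kernelSum_sq hB c⟩
  have h2 : ‖Real.circleAverage (fun z => θ z * conj (B z * twistedSum b c z)) 0 1‖
      ≤ √(Real.circleAverage (fun z => ‖φ z‖ ^ 2) 0 1) * (√C * K) := by
    refine (norm_circleAverage_le_of_norm_le_mul (G := φ)
      (H := fun z => p.eval z * twistedSum b c z) (by fun_prop) (by fun_prop)
      (by fun_prop) fun z hz => ?_).trans ?_
    · have hBz := hB.norm_le_one (z := z) (by simpa using (sphere_subset_closedBall hz))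
      rw [norm_mul, RCLike.norm_conj, norm_mul, norm_mul]
      calc ‖θ z‖ * (‖B z‖ * ‖twistedSum b c z‖)
          ≤ (‖p.eval z‖ * ‖φ z‖) * (1 * ‖twistedSum b c z‖) := by
            gcongr; exact h z hz
        _ = _ := by ring
    · refine mul_le_mul_of_nonneg_left ?_ (Real.sqrt_nonneg _)
      refine Real.sqrt_le_iff.2 ⟨by positivity, ?_⟩
      rw [mul_pow, Real.sq_sqrt hC]
      refine (circleAverage_norm_sq_mul_le (C := C)
        (G := fun z => (1 - ‖B z‖ ^ 2) * ‖twistedSum b c z‖ ^ 2) (by fun_prop)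
        (by fun_prop) fun z hz => ?_).trans ?_
      · rw [norm_mul, mul_pow, ← mul_assoc]
        exact mul_le_mul_of_nonneg_right (hp z hz) (sq_nonneg _)
      · exact mul_le_mul_of_nonneg_left (circleAverage_twistedSum_le_norm_kernelSum_sq hB c) hC
  have h3 : √(Real.circleAverage (fun z => ‖(M : ℂ) * φ z‖ ^ 2) 0 1)
      = M * √(Real.circleAverage (fun z => ‖φ z‖ ^ 2) 0 1) := by
    have : (fun z => ‖(M : ℂ) * φ z‖ ^ 2) = fun z => (M ^ 2) • ‖φ z‖ ^ 2 := by
      funext z; rw [norm_mul, mul_pow, Complex.norm_real, Real.norm_of_nonneg hM, smul_eq_mul]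
    rw [this, Real.circleAverage_fun_smul, smul_eq_mul, Real.sqrt_mul (sq_nonneg _),
      Real.sqrt_sq hM]
  rw [h3] at h1
  refine (norm_add_le _ _).trans ((add_le_add h1 h2).trans_eq ?_)
  ring

/-- The norm of a linear combination of kernel functions of `H(b)` is dominated by a weighted `L²`
norm of the corresponding combination of Szegő kernels. -/
theorem norm_kernelSum_le {b : SchurFunction} {B : ℂ → ℂ} (hB : IsDiscExtension b B)
    {p : Polynomial ℂ} {C D : ℝ} (hC : 0 ≤ C) {κ : ℂ → ℂ}
    (hκ : DiffContOnCl ℂ κ (ball 0 1))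
    (hp : ∀ z ∈ sphere (0 : ℂ) 1, 1 - ‖B z‖ ^ 2 ≤ C * ‖p.eval z‖ ^ 2)
    (hκp : ∀ z ∈ sphere (0 : ℂ) 1, ‖conj (B z) - κ z‖ ≤ D * ‖p.eval z‖) (c : 𝔻 →₀ ℂ) :
    ‖kernelSum b c‖
      ≤ √(C + D ^ 2) * √(Real.circleAverage (fun z => ‖p.eval z * szegoSum c z‖ ^ 2) 0 1) := by
  have dh := diffContOnCl_szegoSum c
  have dg := diffContOnCl_twistedSum b c
  have ch := continuousOn_sphere_of_diffContOnCl dh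
  have cg := continuousOn_sphere_of_diffContOnCl dg
  have cB := continuousOn_sphere_of_diffContOnCl hB.diffContOnCl
  have cκ := continuousOn_sphere_of_diffContOnCl hκ
  have cp : ContinuousOn (fun z => p.eval z) (sphere 0 1) := p.continuous.continuousOn
  set A := Real.circleAverage (fun z => ‖p.eval z * szegoSum c z‖ ^ 2) 0 1 with hA
  set R := Real.circleAverage (fun z => ‖conj (B z) * szegoSum c z - twistedSum b c z‖ ^ 2) 0 1
    with hR
  have hR0 : 0 ≤ R := Real.circleAverage_nonneg_of_nonneg fun z _ => sq_nonneg _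
  have hA0 : 0 ≤ A := Real.circleAverage_nonneg_of_nonneg fun z _ => sq_nonneg _
  -- `conj B * h - g` is orthogonal to analytic functions
  have orth : ∀ F : ℂ → ℂ, DiffContOnCl ℂ F (ball 0 1) →
      Real.circleAverage (fun z => F z * conj (conj (B z) * szegoSum c z - twistedSum b c z)) 0 1
        = 0 := by
    intro F hF
    have cF := continuousOn_sphere_of_diffContOnCl hF
    have e : (fun z => F z * conj (conj (B z) * szegoSum c z - twistedSum b c z))
        = fun z => F z * B z * conj (szegoSum c z) - F z * conj (twistedSum b c z) := by
      funext z; simp only [map_sub, map_mul, Complex.conj_conj]; ring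
    rw [e, Real.circleAverage_fun_sub (circleIntegrable_of_continuousOn (by fun_prop))
      (circleIntegrable_of_continuousOn (by fun_prop))]
    have a1 : Real.circleAverage (fun z => F z * B z * conj (szegoSum c z)) 0 1 = _ :=
      circleAverage_mul_conj_sum_szego (hF.mul' hB.diffContOnCl) c.support c
    have a2 : Real.circleAverage (fun z => F z * conj (twistedSum b c z)) 0 1 = _ :=
      circleAverage_mul_conj_sum_szego hF c.support fun w => conj (b w) * c w
    rw [a1, a2, ← Finset.sum_sub_distrib]
    refine Finset.sum_eq_zero fun w _ => ?_
    rw [hB.eqOn (mem_ball_zero_iff.2 w.norm_lt_one)]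
    simp only [map_mul, Complex.conj_conj]
    ring
  -- Because `b̄ h - g` is orthogonal to `κ h - g`, its squared norm equals its pairing with `(b̄ -
  -- κ) h`. Cauchy–Schwarz and `|b̄ - κ| ≤ D |p|` then give `R ≤ √(D² A) √R`.
  have hRle : R ≤ D ^ 2 * A := by
    have e1 : (R : ℂ) = Real.circleAverage (fun z => ((conj (B z) - κ z) * szegoSum c z)
        * conj (conj (B z) * szegoSum c z - twistedSum b c z)) 0 1 := by
      have e2 : (R : ℂ) = Real.circleAverage (fun z => (conj (B z) * szegoSum c z - twistedSum b c z)
          * conj (conj (B z) * szegoSum c z - twistedSum b c z)) 0 1 := by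
        rw [hR, ← Complex.ofRealCLM_apply, ← ContinuousLinearMap.circleAverage_comp_comm _
          (circleIntegrable_of_continuousOn (by fun_prop))]
        refine congrArg (fun F => Real.circleAverage F 0 1) (funext fun z => ?_)
        rw [Complex.mul_conj, Complex.normSq_eq_norm_sq]; rfl
      have e3 := orth (fun z => κ z * szegoSum c z - twistedSum b c z)
        ((hκ.mul' dh).sub dg)
      have cQ := continuousOn_sphere_of_diffContOnCl ((hκ.mul' dh).sub dg)
      rw [e2]
      refine ((sub_zero _).symm.trans (congrArg _ e3.symm)).trans ?_
      rw [← Real.circleAverage_fun_sub (circleIntegrable_of_continuousOn (by fun_prop))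
        (circleIntegrable_of_continuousOn (by fun_prop))]
      refine congrArg (fun F => Real.circleAverage F 0 1) (funext fun z => ?_)
      ring
    have e4 := norm_circleAverage_mul_conj_le (F := fun z => (conj (B z) - κ z) * szegoSum c z)
      (G := fun z => conj (B z) * szegoSum c z - twistedSum b c z) (by fun_prop) (by fun_prop)
    rw [← e1, ← hR, Complex.norm_real, Real.norm_of_nonneg hR0] at e4
    have e5 : Real.circleAverage (fun z => ‖(conj (B z) - κ z) * szegoSum c z‖ ^ 2) 0 1
        ≤ D ^ 2 * A := by
      refine circleAverage_norm_sq_mul_le (by fun_prop) (by fun_prop) fun z hz => ?_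
      rw [← mul_pow]
      refine pow_le_pow_left₀ (norm_nonneg _) ?_ 2
      rw [norm_mul, norm_mul, ← mul_assoc]
      exact mul_le_mul_of_nonneg_right (hκp z hz) (norm_nonneg _)
    have e6 : R ≤ √(D ^ 2 * A) * √R :=
      e4.trans (mul_le_mul_of_nonneg_right (Real.sqrt_le_sqrt e5) (Real.sqrt_nonneg _))
    have h7 := Real.sq_sqrt (x := D ^ 2 * A) (by positivity)
    have h8 := Real.sq_sqrt hR0
    nlinarith [Real.sqrt_nonneg (D ^ 2 * A), Real.sqrt_nonneg R,
      sq_nonneg (√(D ^ 2 * A) - √R)]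
  rw [← Real.sqrt_mul (by positivity)]
  refine Real.le_sqrt_of_sq_le ?_
  rw [norm_kernelSum_sq' hB, Real.circleAverage_fun_add
    (circleIntegrable_of_continuousOn (by fun_prop))
    (circleIntegrable_of_continuousOn (by fun_prop)), add_mul]
  refine add_le_add ?_ hRle
  rw [hA, ← smul_eq_mul C, ← Real.circleAverage_fun_smul]
  apply Real.circleAverage_mono
  · exact circleIntegrable_of_continuousOn (by fun_prop)
  · exact circleIntegrable_of_continuousOn (by fun_prop)
  · intro z hz
    simp only [smul_eq_mul]
    rw [norm_mul, mul_pow, ← mul_assoc]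
    exact mul_le_mul_of_nonneg_right (hp z (by simpa using hz)) (sq_nonneg _)

/-! ### Dilations -/

theorem ofReal_mul_mem_ball {t : ℝ} (h0 : 0 ≤ t) (h1 : t < 1) {z : ℂ} (hz : ‖z‖ ≤ 1) :
    (t : ℂ) * z ∈ ball (0 : ℂ) 1 := by
  rw [mem_ball_zero_iff, norm_mul, Complex.norm_real, Real.norm_of_nonneg h0]
  nlinarith [norm_nonneg z]

theorem diffContOnCl_dilate {F : ℂ → ℂ} (hF : DifferentiableOn ℂ F (ball 0 1)) {t : ℝ}
    (h0 : 0 ≤ t) (h1 : t < 1) : DiffContOnCl ℂ (fun z => F ((t : ℂ) * z)) (ball 0 1) := by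
  apply DifferentiableOn.diffContOnCl
  rw [closure_ball _ one_ne_zero]
  exact hF.comp (by fun_prop) fun z hz => ofReal_mul_mem_ball h0 h1 (by simpa using hz)

theorem circleAverage_dilate {E : Type*} [NormedAddCommGroup E] [NormedSpace ℝ E] (F : ℂ → E)
    (t : ℝ) : Real.circleAverage (fun z => F ((t : ℂ) * z)) 0 1 = Real.circleAverage F 0 t := by
  rw [Real.circleAverage_eq_circleAverage_zero_one (R := t)]
  simp

theorem tendsto_dilate {F : ℂ → ℂ} (hF : DifferentiableOn ℂ F (ball 0 1)) {z : ℂ}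
    (hz : z ∈ ball (0 : ℂ) 1) :
    Tendsto (fun t : ℝ => F ((t : ℂ) * z)) (𝓝[<] 1) (𝓝 (F z)) := by
  have hc : ContinuousAt F z :=
    (hF.differentiableAt (isOpen_ball.mem_nhds hz)).continuousAt
  have h1 : Tendsto (fun t : ℝ => (t : ℂ) * z) (𝓝 1) (𝓝 z) := by
    have : Continuous fun t : ℝ => (t : ℂ) * z := by fun_prop
    simpa using this.tendsto 1
  exact hc.tendsto.comp (h1.mono_left nhdsWithin_le_nhds)

theorem eventually_mem_Ioo_nhdsLT_one : ∀ᶠ t : ℝ in 𝓝[<] 1, 0 < t ∧ t < 1 := by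
  have h0 : ∀ᶠ t : ℝ in 𝓝[<] 1, 0 < t := nhdsWithin_le_nhds (lt_mem_nhds one_pos)
  filter_upwards [h0, self_mem_nhdsWithin] with t h0 h1 using ⟨h0, h1⟩

/-! ### Functions that belong to `H(b)` -/

/-- The estimate is applied to the dilations `φ(t z)`, which are continuous up to the circle and
have `L²` means bounded uniformly in `t`; letting `t → 1` spares any boundary values of `φ`. -/
theorem mul_mem_spaceFunctions {b : SchurFunction} {B : ℂ → ℂ} (hB : IsDiscExtension b B)
    {p : Polynomial ℂ} {C : ℝ} (hC : 0 ≤ C)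
    (hp : ∀ z ∈ sphere (0 : ℂ) 1, ‖p.eval z‖ ^ 2 ≤ C * (1 - ‖B z‖ ^ 2))
    {φ : ℂ → ℂ} (hφ : IsHardyTwo φ) :
    (fun z : 𝔻 => p.eval (z : ℂ) * φ z) ∈ spaceFunctions b := by
  obtain ⟨hd, D, hD⟩ := hφ
  obtain ⟨M, hM⟩ := (isCompact_sphere (0 : ℂ) 1).exists_bound_of_continuousOn
    (f := fun z => p.eval z) p.continuous.continuousOn
  have hM0 : 0 ≤ M := (norm_nonneg _).trans (hM 1 (by simp))
  refine mem_spaceFunctions_of_norm_le b _ (C := (M + √C) * √D) (by positivity) fun c => ?_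
  have lim : Tendsto (fun t : ℝ => ‖∑ w ∈ c.support,
      conj (c w) * (p.eval (w : ℂ) * φ ((t : ℂ) * w))‖) (𝓝[<] 1)
      (𝓝 ‖∑ w ∈ c.support, conj (c w) * (p.eval (w : ℂ) * φ w)‖) := by
    refine (tendsto_finsetSum _ fun w _ => ?_).norm
    exact ((tendsto_dilate hd (mem_ball_zero_iff.2 w.norm_lt_one)).const_mul _).const_mul _
  refine le_of_tendsto lim ?_
  filter_upwards [eventually_mem_Ioo_nhdsLT_one] with t ht
  have hdt := diffContOnCl_dilate hd ht.1.le ht.2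
  have hpd : DiffContOnCl ℂ (fun z => p.eval z) (ball 0 1) := p.differentiable.diffContOnCl
  have h1 := norm_circleAverage_mul_conj_szegoSum_le hB hM0 hM hC hp
    (continuousOn_sphere_of_diffContOnCl (hpd.mul' hdt))
    (continuousOn_sphere_of_diffContOnCl hdt) (fun z _ => (norm_mul _ _).le) c
  have h2 : Real.circleAverage (fun z => p.eval z * φ ((t : ℂ) * z) * conj (szegoSum c z)) 0 1
      = _ := circleAverage_mul_conj_sum_szego (hpd.mul' hdt) c.support c
  rw [h2] at h1
  refine h1.trans (mul_le_mul_of_nonneg_right ?_ (norm_nonneg _))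
  refine mul_le_mul_of_nonneg_left (Real.sqrt_le_sqrt ?_) (by positivity)
  rw [circleAverage_dilate (fun z => ‖φ z‖ ^ 2)]
  exact hD t ht.1.le ht.2

/-- On the circle `z̄^i z^k = z^(k-i)`, and projection onto `H²` kills the negative powers: for `i >
k` the conjugate of the integrand is analytic and vanishes at the origin. -/
theorem circleAverage_conj_pow_mul_pow (i k : ℕ) (c : 𝔻 →₀ ℂ) :
    Real.circleAverage (fun z => conj z ^ i * z ^ k * conj (szegoSum c z)) 0 1
      = ∑ w ∈ c.support, conj (c w) * (if i ≤ k then (w : ℂ) ^ (k - i) else 0) := by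
  have hzz : ∀ z ∈ sphere (0 : ℂ) |1|, conj z * z = 1 := by
    intro z hz
    have hz1 : ‖z‖ = 1 := by simpa using hz
    rw [mul_comm, Complex.mul_conj, Complex.normSq_eq_norm_sq, hz1]; simp
  split_ifs with hik
  · have hd : DiffContOnCl ℂ (fun z : ℂ => z ^ (k - i)) (ball 0 1) :=
      (differentiable_pow (k - i)).diffContOnCl
    refine Eq.trans ?_ (circleAverage_mul_conj_sum_szego hd c.support c)
    apply Real.circleAverage_congr_sphere
    intro z hz
    show _ = z ^ (k - i) * conj (szegoSum c z)
    obtain ⟨j, rfl⟩ := Nat.exists_eq_add_of_le hik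
    simp only [add_tsub_cancel_left, pow_add]
    rw [← mul_assoc, ← mul_pow, hzz z hz, one_pow, one_mul]
  · obtain ⟨j, rfl⟩ := Nat.exists_eq_add_of_lt (not_le.1 hik)
    have hd : DiffContOnCl ℂ (fun z : ℂ => z ^ (j + 1) * szegoSum c z) (ball 0 1) :=
      ((differentiable_pow (j + 1)).diffContOnCl).mul' (diffContOnCl_szegoSum c)
    have hd' : DiffContOnCl ℂ (fun z : ℂ => z ^ (j + 1) * szegoSum c z) (ball 0 |(1 : ℝ)|) := by
      rwa [abs_one]
    have h0 := hd'.circleAverage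
    have e : Real.circleAverage (fun z => conj z ^ (k + j + 1) * z ^ k * conj (szegoSum c z)) 0 1
        = Real.circleAverage (Complex.conjCLE ∘ fun z => z ^ (j + 1) * szegoSum c z) 0 1 := by
      apply Real.circleAverage_congr_sphere
      intro z hz
      simp only [Function.comp_apply, Complex.conjCLE_apply, map_mul, map_pow]
      rw [add_assoc, pow_add]
      have := hzz z hz
      calc conj z ^ k * conj z ^ (j + 1) * z ^ k * conj (szegoSum c z)
          = (conj z * z) ^ k * (conj z ^ (j + 1) * conj (szegoSum c z)) := by rw [mul_pow]; ring
        _ = _ := by rw [this, one_pow, one_mul]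
    rw [e]
    have hci := circleIntegrable_of_continuousOn (continuousOn_sphere_of_diffContOnCl hd)
    have := (Complex.conjCLE : ℂ →L[ℝ] ℂ).circleAverage_comp_comm hci
    refine this.trans ?_
    rw [h0]
    simp

theorem conj_eval_eq_sum (p : Polynomial ℂ) (z : ℂ) :
    conj (p.eval z) = ∑ i ∈ Finset.range (p.natDegree + 1), conj (p.coeff i) * conj z ^ i := by
  rw [Polynomial.eval_eq_sum_range, map_sum]
  simp

/-- Take `θ = p̄ z^k` in the preceding estimate: `P₊(p̄ z^k) = ∑ conj(p_i) z^(k-i)` lies in `H(b)`.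
Its coefficient at `z^k` is `conj(p(0)) ≠ 0` and all other terms are lower powers, so strong
induction on `k` isolates `z^k`. -/
theorem pow_mem_spaceFunctions {b : SchurFunction} {B : ℂ → ℂ} (hB : IsDiscExtension b B)
    {p : Polynomial ℂ} {C : ℝ} (hC : 0 ≤ C)
    (hp : ∀ z ∈ sphere (0 : ℂ) 1, ‖p.eval z‖ ^ 2 ≤ C * (1 - ‖B z‖ ^ 2)) (hp0 : p.coeff 0 ≠ 0)
    (k : ℕ) : (fun z : 𝔻 => (z : ℂ) ^ k) ∈ spaceFunctions b := by
  obtain ⟨M, hM⟩ := (isCompact_sphere (0 : ℂ) 1).exists_bound_of_continuousOn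
    (f := fun z => p.eval z) p.continuous.continuousOn
  have hM0 : 0 ≤ M := (norm_nonneg _).trans (hM 1 (by simp))
  have key : ∀ k : ℕ, (fun w : 𝔻 => ∑ i ∈ Finset.range (p.natDegree + 1),
      conj (p.coeff i) * (if i ≤ k then (w : ℂ) ^ (k - i) else 0)) ∈ spaceFunctions b := by
    intro k
    have cp : ContinuousOn (fun z => p.eval z) (sphere 0 1) := p.continuous.continuousOn
    refine mem_spaceFunctions_of_norm_le b _
      (C := (M + √C) * √(Real.circleAverage (fun z : ℂ => ‖z ^ k‖ ^ 2) 0 1)) (by positivity)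
      fun c => ?_
    have ch := continuousOn_sphere_of_diffContOnCl (diffContOnCl_szegoSum c)
    have h1 := norm_circleAverage_mul_conj_szegoSum_le hB hM0 hM hC hp
      (θ := fun z => conj (p.eval z) * z ^ k) (φ := fun z => z ^ k) (by fun_prop) (by fun_prop)
      (fun z _ => by rw [norm_mul, RCLike.norm_conj]) c
    refine le_of_eq_of_le (congrArg norm ?_) h1
    have e : (fun z => conj (p.eval z) * z ^ k * conj (szegoSum c z))
        = fun z => ∑ i ∈ Finset.range (p.natDegree + 1),
          conj (p.coeff i) • (conj z ^ i * z ^ k * conj (szegoSum c z)) := by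
      funext z
      rw [conj_eval_eq_sum, Finset.sum_mul, Finset.sum_mul]
      exact Finset.sum_congr rfl fun i _ => by rw [smul_eq_mul]; ring
    rw [e, Real.circleAverage_fun_sum fun i _ => circleIntegrable_of_continuousOn (by fun_prop)]
    simp only [Finset.mul_sum]
    rw [Finset.sum_comm]
    refine Finset.sum_congr rfl fun i _ => ?_
    rw [Real.circleAverage_fun_smul, circleAverage_conj_pow_mul_pow, Finset.smul_sum]
    exact Finset.sum_congr rfl fun w _ => by rw [smul_eq_mul]; ring
  induction k using Nat.strong_induction_on with
  | _ k ih =>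
    have h1 := key k
    have h2 : (fun w : 𝔻 => ∑ i ∈ Finset.range p.natDegree,
        conj (p.coeff (i + 1)) * (if i + 1 ≤ k then (w : ℂ) ^ (k - (i + 1)) else 0))
        ∈ spaceFunctions b := by
      have e : (fun w : 𝔻 => ∑ i ∈ Finset.range p.natDegree,
          conj (p.coeff (i + 1)) * (if i + 1 ≤ k then (w : ℂ) ^ (k - (i + 1)) else 0))
          = ∑ i ∈ Finset.range p.natDegree, conj (p.coeff (i + 1)) •
            (if i + 1 ≤ k then fun w : 𝔻 => (w : ℂ) ^ (k - (i + 1)) else 0) := by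
        funext w
        rw [Finset.sum_apply]
        refine Finset.sum_congr rfl fun i _ => ?_
        split_ifs <;> simp
      rw [e]
      refine Submodule.sum_mem _ fun i _ => Submodule.smul_mem _ _ ?_
      split_ifs with h
      · exact ih _ (by omega)
      · exact Submodule.zero_mem _
    have h3 := Submodule.smul_mem _ (conj (p.coeff 0))⁻¹ (Submodule.sub_mem _ h1 h2)
    refine (congrArg (· ∈ spaceFunctions b) (funext fun w => ?_)).mp h3
    have hne : conj (p.coeff 0) ≠ 0 := by simpa using hp0
    simp only [Pi.smul_apply, Pi.sub_apply, Finset.sum_range_succ', smul_eq_mul]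
    simp [hne]

/-! ### Functions of class `H²` from functionals bounded in `L²` of the circle -/

theorem circleAverage_norm_sq_sum (d : ℕ → ℂ) (k : ℕ) :
    Real.circleAverage (fun z => ‖∑ n ∈ Finset.range k, d n * z ^ n‖ ^ 2) 0 1
      = ∑ n ∈ Finset.range k, ‖d n‖ ^ 2 := by
  set P : Polynomial ℂ := ∑ n ∈ Finset.range k, Polynomial.monomial n (d n) with hP
  have hev : ∀ z, P.eval z = ∑ n ∈ Finset.range k, d n * z ^ n := by
    intro z; simp [hP, Polynomial.eval_finsetSum, Polynomial.eval_monomial]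
  have hco : ∀ n, P.coeff n = if n < k then d n else 0 := by
    intro n; simp [hP, Polynomial.finsetSum_coeff, Polynomial.coeff_monomial]
  simp only [← hev]
  rw [← Polynomial.sum_sq_norm_coeff_eq_circleAverage]
  have hsub : P.support ⊆ Finset.range k := by
    intro n hn
    rw [Polynomial.mem_support_iff, hco] at hn
    simpa using fun h => hn (if_neg (not_lt.2 h))
  rw [Finset.sum_subset hsub fun n _ hn => by
    rw [Polynomial.notMem_support_iff.1 hn, norm_zero, zero_pow two_ne_zero]]
  exact Finset.sum_congr rfl fun n hn => by rw [hco, if_pos (Finset.mem_range.1 hn)]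

/-- Parseval on the circle of radius `ρ` bounds the means of the partial sums by the coefficient
sums, and dominated convergence passes to the full series. -/
theorem isHardyTwo_tsum {a : ℕ → ℂ} {A : ℝ} (hA : ∀ k, ∑ n ∈ Finset.range k, ‖a n‖ ^ 2 ≤ A ^ 2) :
    IsHardyTwo fun z => ∑' n, a n * z ^ n := by
  have hA' : ∀ n, ‖a n‖ ≤ |A| := fun n => by
    rw [← abs_norm, ← sq_le_sq]
    exact (Finset.single_le_sum (f := fun n => ‖a n‖ ^ 2) (fun i _ => sq_nonneg _)
      (Finset.self_mem_range_succ n)).trans (hA (n + 1))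
  have hb : ∀ (ρ : ℝ) (z : ℂ), ‖z‖ ≤ ρ → ∀ n, ‖a n * z ^ n‖ ≤ |A| * ρ ^ n := fun ρ z hz n => by
    rw [norm_mul, norm_pow]
    exact mul_le_mul (hA' n) (pow_le_pow_left₀ (norm_nonneg _) hz n) (by positivity) (abs_nonneg _)
  have hs : ∀ ρ : ℝ, 0 ≤ ρ → ρ < 1 → Summable fun n : ℕ => |A| * ρ ^ n := fun ρ h0 h1 =>
    (summable_geometric_of_lt_one h0 h1).mul_left _
  refine ⟨fun z hz => ?_, A ^ 2, fun ρ h0 h1 => ?_⟩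
  · obtain ⟨ρ, hzρ, hρ⟩ := exists_between (mem_ball_zero_iff.1 hz)
    have := Complex.differentiableOn_tsum_of_summable_norm (F := fun n (z : ℂ) => a n * z ^ n)
      (hs ρ ((norm_nonneg z).trans hzρ.le) hρ) (fun n => by fun_prop) (isOpen_ball (x := (0 : ℂ)))
      (fun n w hw => hb ρ w (mem_ball_zero_iff.1 hw).le n)
    exact (this.differentiableAt
      (isOpen_ball.mem_nhds (mem_ball_zero_iff.2 hzρ))).differentiableWithinAt
  · have lim : Tendsto (fun k => Real.circleAverage
        (fun z => ‖∑ n ∈ Finset.range k, a n * z ^ n‖ ^ 2) 0 ρ) atTop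
        (𝓝 (Real.circleAverage (fun z => ‖∑' n, a n * z ^ n‖ ^ 2) 0 ρ)) := by
      refine Tendsto.const_smul ?_ _
      refine intervalIntegral.tendsto_integral_filter_of_dominated_convergence
        (fun _ => (∑' n : ℕ, |A| * ρ ^ n) ^ 2) ?_ ?_ ?_ ?_
      · refine Eventually.of_forall fun k => Continuous.aestronglyMeasurable ?_
        fun_prop
      · refine Eventually.of_forall fun k => Eventually.of_forall fun t _ => ?_
        rw [Real.norm_of_nonneg (sq_nonneg _)]
        refine pow_le_pow_left₀ (norm_nonneg _) ?_ 2
        refine (norm_sum_le _ _).trans ?_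
        refine (Finset.sum_le_sum fun n _ => hb ρ _ (by simp [abs_of_nonneg h0]) n).trans ?_
        exact (hs ρ h0 h1).sum_le_tsum _ fun n _ => by positivity
      · exact intervalIntegrable_const
      · refine Eventually.of_forall fun t _ => ?_
        have : Summable fun n => a n * circleMap 0 ρ t ^ n :=
          Summable.of_norm_bounded (hs ρ h0 h1) (hb ρ _ (by simp [abs_of_nonneg h0]))
        exact (this.hasSum.tendsto_sum_nat.norm).pow 2
    refine le_of_tendsto lim (Eventually.of_forall fun k => ?_)
    rw [← circleAverage_dilate]
    have e : (fun z : ℂ => ‖∑ n ∈ Finset.range k, a n * ((ρ : ℂ) * z) ^ n‖ ^ 2)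
        = fun z => ‖∑ n ∈ Finset.range k, (a n * (ρ : ℂ) ^ n) * z ^ n‖ ^ 2 := by
      funext z; simp only [mul_pow, mul_assoc]
    rw [e, circleAverage_norm_sq_sum (fun n => a n * (ρ : ℂ) ^ n)]
    refine (Finset.sum_le_sum fun n _ => ?_).trans (hA k)
    rw [norm_mul, norm_pow, Complex.norm_real, Real.norm_of_nonneg h0]
    refine pow_le_pow_left₀ (by positivity) ?_ 2
    exact mul_le_of_le_one_right (norm_nonneg _) (pow_le_one₀ h0 h1.le)

/-- The Szegő kernel on the unit circle. -/
def szegoFun (w : 𝔻) : CircleFun :=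
  onCircle (szego w) (continuousOn_sphere_of_diffContOnCl (diffContOnCl_szego w))

/-- Peeling one term off the geometric series. This identity also drives the induction over the
nodes in `exists_decomposition_of_functional`. -/
theorem szegoFun_eq (w : 𝔻) :
    szegoFun w = 1 + conj (w : ℂ) • (coordFun * szegoFun w) := by
  ext θ
  have := szego_eq w (z := (θ.toCircle : ℂ)) (Circle.norm_coe _).le
  simp only [szegoFun, ContinuousMap.add_apply, ContinuousMap.one_apply, ContinuousMap.smul_apply,
    ContinuousMap.mul_apply, onCircle_apply, coordFun_apply, smul_eq_mul]
  rw [← mul_assoc]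
  exact this

/-- A geometric series in the Banach algebra of continuous functions: the ratio `conj w · z` has sup
norm at most `|w| < 1`, so convergence is uniform on the circle. -/
theorem hasSum_szegoFun (w : 𝔻) :
    HasSum (fun n : ℕ => conj (w : ℂ) ^ n • coordFun ^ n) (szegoFun w) := by
  set x : CircleFun := conj (w : ℂ) • coordFun with hx
  have hx1 : ‖x‖ < 1 := by
    refine lt_of_le_of_lt ?_ w.norm_lt_one
    rw [ContinuousMap.norm_le _ (norm_nonneg _)]
    intro θ
    rw [hx, ContinuousMap.smul_apply, norm_smul, norm_coordFun_apply, mul_one, RCLike.norm_conj]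
  have h1 : (fun n : ℕ => conj (w : ℂ) ^ n • coordFun ^ n) = fun n => x ^ n := by
    funext n; rw [hx, smul_pow]
  have h2 := summable_geometric_of_norm_lt_one hx1
  have h3 : szegoFun w * (1 - x) = 1 := by
    have := szegoFun_eq w
    rw [mul_sub, mul_one, hx, mul_smul_comm, mul_comm (szegoFun w)]
    exact sub_eq_of_eq_add this
  have h4 : szegoFun w = ∑' n, x ^ n := by
    have h5 := mul_neg_geom_series x hx1
    calc szegoFun w = szegoFun w * ((1 - x) * ∑' n, x ^ n) := by rw [h5, mul_one]
      _ = _ := by rw [← mul_assoc, h3, one_mul]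
  rw [h1, h4]
  exact h2.hasSum

theorem coordFun_pow_apply (n : ℕ) (θ : AddCircle (2 * Real.pi)) :
    (coordFun ^ n) θ = (θ.toCircle : ℂ) ^ n := by
  rw [ContinuousMap.pow_apply, coordFun_apply]

/-- A functional bounded in `L²` is `F ↦ ⟨ψ, F⟩`, and the function produced is `P₊ψ`, with Taylor
coefficients `conj(Γ(z^n))`. Their square summability is obtained by duality. -/
theorem exists_isHardyTwo_of_functional (Γ : CircleFun →ₗ[ℂ] ℂ) {A : ℝ}
    (hΓ : ∀ F, ‖Γ F‖ ≤ A * ‖toL2 F‖) :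
    ∃ φ : ℂ → ℂ, IsHardyTwo φ ∧ ∀ w : 𝔻, conj (Γ (szegoFun w)) = φ w := by
  set a : ℕ → ℂ := fun n => conj (Γ (coordFun ^ n)) with ha
  refine ⟨_, isHardyTwo_tsum (a := a) (A := A) fun k => ?_, fun w => ?_⟩
  · set T := ∑ n ∈ Finset.range k, ‖a n‖ ^ 2 with hT
    have hT0 : 0 ≤ T := Finset.sum_nonneg fun n _ => sq_nonneg _
    -- The extremal test function: `Γ F` and `‖F‖²` are both equal to `T`, so `T ≤ A √T` and hence
    -- `T ≤ A²`.
    set F : CircleFun := ∑ n ∈ Finset.range k, a n • coordFun ^ n with hF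
    have h1 : Γ F = T := by
      rw [hF, map_sum, hT, Complex.ofReal_sum]
      refine Finset.sum_congr rfl fun n _ => ?_
      rw [map_smul, smul_eq_mul, mul_comm, ← Complex.normSq_eq_norm_sq, ← Complex.mul_conj, mul_comm]
      simp [ha]
    have hc : ContinuousOn (fun z => ∑ n ∈ Finset.range k, a n * z ^ n) (sphere 0 1) := by fun_prop
    have h2 : ‖toL2 F‖ ^ 2 = T := by
      rw [hT, ← circleAverage_norm_sq_sum, ← norm_toL2_onCircle_sq hc]
      congr 3
      ext θ
      rw [hF, ContinuousMap.sum_apply, onCircle_apply]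
      refine Finset.sum_congr rfl fun n _ => ?_
      rw [ContinuousMap.smul_apply, coordFun_pow_apply, smul_eq_mul]
    have h3 := hΓ F
    rw [h1, Complex.norm_real, Real.norm_of_nonneg hT0] at h3
    nlinarith [norm_nonneg (toL2 F), sq_nonneg (‖toL2 F‖ - A)]
  · let Γ' : CircleFun →L[ℂ] ℂ := Γ.mkContinuous (|A| * ‖toL2‖) fun F => by
      refine (hΓ F).trans ((mul_le_mul_of_nonneg_right (le_abs_self A) (norm_nonneg _)).trans ?_)
      rw [mul_assoc]
      exact mul_le_mul_of_nonneg_left (toL2.le_opNorm F) (abs_nonneg A)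
    have h1 := (hasSum_szegoFun w).mapL Γ'
    have h2 := Complex.hasSum_conj'.2 h1
    refine h2.tsum_eq.symm.trans (tsum_congr fun n => ?_)
    rw [map_smul, smul_eq_mul, map_mul, map_pow, Complex.conj_conj, mul_comm]
    rfl

/-! ### Polynomials with prescribed nodes and division of Cauchy transforms by them -/

/-- The monic polynomial with the given multiset of roots. -/
def nodePoly (s : Multiset ℂ) : Polynomial ℂ := (s.map fun η => Polynomial.X - Polynomial.C η).prod

@[simp] theorem nodePoly_zero : nodePoly 0 = 1 := by simp [nodePoly]

theorem nodePoly_cons (η : ℂ) (s : Multiset ℂ) :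
    nodePoly (η ::ₘ s) = (Polynomial.X - Polynomial.C η) * nodePoly s := by simp [nodePoly]

theorem nodePoly_monic (s : Multiset ℂ) : (nodePoly s).Monic :=
  Polynomial.monic_multisetProd_X_sub_C s

theorem nodePoly_roots (s : Multiset ℂ) : (nodePoly s).roots = s :=
  Polynomial.roots_multiset_prod_X_sub_C s

theorem nodePoly_eval_eq_zero {s : Multiset ℂ} {z : ℂ} : (nodePoly s).eval z = 0 ↔ z ∈ s := by
  have := Polynomial.mem_roots (p := nodePoly s) (a := z) (nodePoly_monic s).ne_zero
  rw [nodePoly_roots] at this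
  exact this.symm

/-- The restriction of a polynomial to the unit circle. -/
def polyFun (p : Polynomial ℂ) : CircleFun :=
  onCircle (fun z => p.eval z) p.continuous.continuousOn

theorem polyFun_apply (p : Polynomial ℂ) (θ : AddCircle (2 * Real.pi)) :
    polyFun p θ = p.eval (θ.toCircle : ℂ) := rfl

theorem norm_toL2_coordFun_mul (F : CircleFun) : ‖toL2 (coordFun * F)‖ = ‖toL2 F‖ :=
  norm_toL2_congr fun θ => by rw [ContinuousMap.mul_apply, norm_mul, norm_coordFun_apply, one_mul]

/-- The Cauchy transform of `conj p * ψ` with `ψ` in `L²` of the circle belongs to `p H²` up to a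
polynomial of smaller degree, the size of which is controlled by the norm of `ψ`. -/
theorem exists_decomposition_of_functional (s : Multiset ℂ) (hs : ∀ η ∈ s, ‖η‖ = 1) :
    ∃ C : ℝ, 0 ≤ C ∧ ∀ (A : ℝ) (Γ : CircleFun →ₗ[ℂ] ℂ), 0 ≤ A → (∀ F, ‖Γ F‖ ≤ A * ‖toL2 F‖) →
      ∃ (φ : ℂ → ℂ) (S : Polynomial ℂ), IsHardyTwo φ ∧ S.degree < s.card ∧
        (∀ i, ‖S.coeff i‖ ≤ C * A) ∧ ∀ w : 𝔻, conj (Γ (polyFun (nodePoly s) * szegoFun w))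
          = (nodePoly s).eval (w : ℂ) * φ w + S.eval (w : ℂ) := by
  induction s using Multiset.induction with
  | empty =>
    refine ⟨0, le_rfl, fun A Γ hA hΓ => ?_⟩
    obtain ⟨φ, hφ, h⟩ := exists_isHardyTwo_of_functional Γ hΓ
    refine ⟨φ, 0, hφ, by simp, by simp, fun w => ?_⟩
    have e : polyFun (nodePoly 0) = 1 := by ext θ; simp [polyFun_apply]
    rw [e, one_mul, h]
    simp
  | cons ζ s ih =>
    obtain ⟨C, hC, ih⟩ := ih fun η hη => hs η (Multiset.mem_cons_of_mem hη)
    have hζ : ‖ζ‖ = 1 := hs ζ (Multiset.mem_cons_self ζ s)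
    have hζζ : conj ζ * ζ = 1 := by
      rw [mul_comm, Complex.mul_conj, Complex.normSq_eq_norm_sq, hζ]; simp
    set p := nodePoly s with hp
    -- Multiplying `S` by `X - ζ` with `|ζ| = 1` at most doubles the coefficient bound, and the
    -- constant term gains a multiple of `Γ(p)`, of size at most `A ‖p‖`.
    refine ⟨2 * C + ‖toL2 (polyFun p)‖, by positivity, fun A Γ hA hΓ => ?_⟩
    -- Since `|z| = 1`, `Γ'` obeys the same bound as `Γ`. With `X = conj(Γ'(p s_w))`, where `s_w` is
    -- the Szegő kernel, peeling one term off `s_w` gives `conj(Γ((z - ζ) p s_w)) = (1 - ζ̄ w) X -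
    -- ζ̄ conj(Γ(p))`. As `ζ` is unimodular, `1 - ζ̄ w = -ζ̄ (w - ζ)`, which produces the factor for
    -- the new node.
    set Γ' : CircleFun →ₗ[ℂ] ℂ := Γ ∘ₗ LinearMap.mulLeft ℂ coordFun with hΓ'
    have hΓ'a : ∀ F, Γ' F = Γ (coordFun * F) := fun F => rfl
    obtain ⟨φ, S, hφ, hSd, hSc, h⟩ := ih A Γ' hA fun F => by
      rw [hΓ'a, ← norm_toL2_coordFun_mul F]; exact hΓ _
    have hCA : 0 ≤ C * A := mul_nonneg hC hA
    refine ⟨fun z => -conj ζ * φ z, Polynomial.C (-conj ζ) * ((Polynomial.X - Polynomial.C ζ) * S)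
      - Polynomial.C (conj ζ * conj (Γ (polyFun p))), hφ.const_mul _, ?_, fun i => ?_, fun w => ?_⟩
    · have hcard : ((ζ ::ₘ s).card : WithBot ℕ) = s.card + 1 := by simp
      rw [hcard]
      refine (Polynomial.degree_sub_le _ _).trans_lt (max_lt ?_ ?_)
      · have hζ0 : -conj ζ ≠ 0 := neg_ne_zero.2 (left_ne_zero_of_mul_eq_one hζζ)
        rw [Polynomial.degree_C_mul hζ0, Polynomial.degree_mul, Polynomial.degree_X_sub_C, add_comm]
        by_cases hS0 : S = 0
        · rw [hS0, Polynomial.degree_zero, WithBot.bot_add]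
          exact_mod_cast WithBot.bot_lt_coe _
        · rw [Polynomial.degree_eq_natDegree hS0] at hSd ⊢
          have : S.natDegree < s.card := by exact_mod_cast hSd
          exact_mod_cast Nat.succ_lt_succ this
      · refine Polynomial.degree_C_le.trans_lt ?_
        exact_mod_cast Nat.succ_pos _
    · have h1 : ‖(Polynomial.C (-conj ζ) * ((Polynomial.X - Polynomial.C ζ) * S)).coeff i‖
          ≤ C * A + C * A := by
        rw [Polynomial.coeff_C_mul, norm_mul, norm_neg, RCLike.norm_conj, hζ, one_mul, sub_mul,
          Polynomial.coeff_sub, Polynomial.coeff_C_mul]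
        refine (norm_sub_le _ _).trans (add_le_add ?_ ?_)
        · cases i with
          | zero => simpa using hCA
          | succ i => rw [Polynomial.coeff_X_mul]; exact hSc i
        · rw [norm_mul, hζ, one_mul]; exact hSc i
      have h2 : ‖(Polynomial.C (conj ζ * conj (Γ (polyFun p)))).coeff i‖
          ≤ A * ‖toL2 (polyFun p)‖ := by
        rw [Polynomial.coeff_C]
        split_ifs
        · rw [norm_mul, RCLike.norm_conj, RCLike.norm_conj, hζ, one_mul]; exact hΓ _
        · rw [norm_zero]; positivity
      rw [Polynomial.coeff_sub]
      refine (norm_sub_le _ _).trans ((add_le_add h1 h2).trans_eq ?_)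
      ring
    · have e1 : polyFun (nodePoly (ζ ::ₘ s)) * szegoFun w
          = coordFun * (polyFun p * szegoFun w) - ζ • (polyFun p * szegoFun w) := by
        ext θ
        simp only [nodePoly_cons, ContinuousMap.mul_apply, ContinuousMap.sub_apply,
          ContinuousMap.smul_apply, polyFun_apply, coordFun_apply, Polynomial.eval_mul,
          Polynomial.eval_sub, Polynomial.eval_X, Polynomial.eval_C, smul_eq_mul]
        ring
      have e2 : polyFun p * szegoFun w
          = polyFun p + conj (w : ℂ) • (coordFun * (polyFun p * szegoFun w)) := by
        conv_lhs => rw [szegoFun_eq w]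
        rw [mul_add, mul_one, mul_smul_comm, mul_left_comm]
      have e3 : Γ (polyFun p * szegoFun w)
          = Γ (polyFun p) + conj (w : ℂ) * Γ' (polyFun p * szegoFun w) := by
        conv_lhs => rw [e2]
        rw [map_add, map_smul, hΓ'a, smul_eq_mul]
      have h3 := h w
      rw [e1, map_sub, map_smul, ← hΓ'a, smul_eq_mul, e3]
      generalize Γ' (polyFun p * szegoFun w) = x at h3 ⊢
      rw [map_sub, map_mul, map_add, map_mul, h3, nodePoly_cons]
      simp only [Complex.conj_conj, Polynomial.eval_mul, Polynomial.eval_sub, Polynomial.eval_X,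
        Polynomial.eval_C, ← hp]
      linear_combination (-(p.eval (w : ℂ) * φ w + S.eval (w : ℂ))) * hζζ

/-- Every element of `H(b)` is the sum of a function in `p H²` and a polynomial of degree less than
that of `p`, the coefficients of which are controlled by the norm. -/
theorem exists_decomposition {b : SchurFunction} {B : ℂ → ℂ} (hB : IsDiscExtension b B)
    {s : Multiset ℂ} (hs : ∀ η ∈ s, ‖η‖ = 1) {C D : ℝ} (hC : 0 ≤ C) {κ : ℂ → ℂ}
    (hκ : DiffContOnCl ℂ κ (ball 0 1))
    (hp : ∀ z ∈ sphere (0 : ℂ) 1, 1 - ‖B z‖ ^ 2 ≤ C * ‖(nodePoly s).eval z‖ ^ 2)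
    (hκp : ∀ z ∈ sphere (0 : ℂ) 1, ‖conj (B z) - κ z‖ ≤ D * ‖(nodePoly s).eval z‖) :
    ∃ K : ℝ, 0 ≤ K ∧ ∀ f : Space b, ∃ (φ : ℂ → ℂ) (S : Polynomial ℂ), IsHardyTwo φ ∧
      S.degree < s.card ∧ (∀ i, ‖S.coeff i‖ ≤ K * ‖f‖) ∧
      ∀ w : 𝔻, f w = (nodePoly s).eval (w : ℂ) * φ w + S.eval (w : ℂ) := by
  obtain ⟨K, hK, h⟩ := exists_decomposition_of_functional s hs
  refine ⟨K * √(C + D ^ 2), by positivity, fun f => ?_⟩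
  set p := nodePoly s with hp_def
  set T : (𝔻 →₀ ℂ) →ₗ[ℂ] _ :=
    Finsupp.linearCombination ℂ fun w : 𝔻 => toL2 (polyFun p * szegoFun w) with hT
  have hTn : ∀ c, ‖T c‖ = √(Real.circleAverage (fun z => ‖p.eval z * szegoSum c z‖ ^ 2) 0 1) := by
    intro c
    have cp : ContinuousOn (fun z => p.eval z) (sphere 0 1) := p.continuous.continuousOn
    have ch := continuousOn_sphere_of_diffContOnCl (diffContOnCl_szegoSum c)
    have hc : ContinuousOn (fun z => p.eval z * szegoSum c z) (sphere 0 1) := by fun_prop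
    rw [← norm_toL2_onCircle_sq hc, Real.sqrt_sq (norm_nonneg _), hT,
      Finsupp.linearCombination_apply, Finsupp.sum]
    simp only [← map_smul, ← map_sum]
    congr 2
    ext θ
    rw [ContinuousMap.sum_apply, onCircle_apply, szegoSum, Finset.mul_sum]
    refine Finset.sum_congr rfl fun w _ => ?_
    simp only [ContinuousMap.smul_apply, ContinuousMap.mul_apply, polyFun_apply, szegoFun,
      onCircle_apply, smul_eq_mul]
    ring
  -- The pairing of `f` with kernel sums is bounded by `‖p h‖` in `L²`, so it is given by a vector
  -- `y` of `L²`; evaluating at a single kernel exhibits `f` as `P₊(p̄ y)`.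
  obtain ⟨y, hy, hyT⟩ := exists_inner_eq_of_norm_le T
    (((InnerProductSpace.toDual ℂ (Space b)) f).toLinearMap ∘ₗ kernelSum b)
    (C := ‖f‖ * √(C + D ^ 2)) (by positivity) fun c => by
      have h1 : ‖⟪f, kernelSum b c⟫_ℂ‖ ≤ ‖f‖ * ‖kernelSum b c‖ := norm_inner_le_norm _ _
      refine h1.trans ?_
      rw [mul_assoc, hTn]
      exact mul_le_mul_of_nonneg_left (norm_kernelSum_le hB hC hκ hp hκp c) (norm_nonneg _)
  obtain ⟨φ, S, hφ, hSd, hSc, hS⟩ := h (‖f‖ * √(C + D ^ 2))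
    (((InnerProductSpace.toDual ℂ _) y).toLinearMap ∘ₗ toL2.toLinearMap) (by positivity) fun F => by
      have h1 : ‖⟪y, toL2 F⟫_ℂ‖ ≤ ‖y‖ * ‖toL2 F‖ := norm_inner_le_norm _ _
      exact h1.trans (mul_le_mul_of_nonneg_right hy (norm_nonneg _))
  refine ⟨φ, S, hφ, hSd, fun i => (hSc i).trans_eq (by ring), fun w => ?_⟩
  rw [← hS w]
  have h1 := hyT (Finsupp.single w 1)
  rw [hT, Finsupp.linearCombination_single, one_smul] at h1
  have h2 : ⟪y, toL2 (polyFun p * szegoFun w)⟫_ℂ = ⟪f, kernelVec b w⟫_ℂ := by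
    rw [h1]
    show ⟪f, kernelSum b (Finsupp.single w 1)⟫_ℂ = _
    rw [kernelSum, Finsupp.linearCombination_single, one_smul]
  show f w = conj ⟪y, toL2 (polyFun p * szegoFun w)⟫_ℂ
  rw [h2, inner_conj_symm, inner_kernelVec]

/-! ### Growth of `H²` functions and orders of vanishing at boundary points -/

/-- Cauchy–Schwarz in the reproducing formula for the dilations of `φ`, with `‖s_w‖² = 1 / (1 -
|w|²)` for the Szegő kernel `s_w`. -/
theorem IsHardyTwo.exists_norm_sq_le {φ : ℂ → ℂ} (hφ : IsHardyTwo φ) :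
    ∃ D : ℝ, 0 ≤ D ∧ ∀ w : 𝔻, ‖φ w‖ ^ 2 * (1 - ‖(w : ℂ)‖ ^ 2) ≤ D := by
  obtain ⟨hd, D, hD⟩ := hφ
  have hD0 : 0 ≤ D :=
    (Real.circleAverage_nonneg_of_nonneg fun z _ => sq_nonneg _).trans (hD 0 le_rfl one_pos)
  refine ⟨D, hD0, fun w => ?_⟩
  have hw := w.norm_lt_one
  have lim : Tendsto (fun t : ℝ => ‖φ ((t : ℂ) * w)‖ ^ 2 * (1 - ‖(w : ℂ)‖ ^ 2)) (𝓝[<] 1)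
      (𝓝 (‖φ w‖ ^ 2 * (1 - ‖(w : ℂ)‖ ^ 2))) :=
    (((tendsto_dilate hd (mem_ball_zero_iff.2 hw)).norm).pow 2).mul_const _
  refine le_of_tendsto lim ?_
  filter_upwards [eventually_mem_Ioo_nhdsLT_one] with t ht
  have hdt := diffContOnCl_dilate hd ht.1.le ht.2
  have cs := continuousOn_sphere_of_diffContOnCl (diffContOnCl_szego w)
  have h1 := norm_circleAverage_mul_conj_le (continuousOn_sphere_of_diffContOnCl hdt) cs
  have h2 : Real.circleAverage (fun z => φ ((t : ℂ) * z) * conj (szego w z)) 0 1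
      = φ ((t : ℂ) * w) := circleAverage_mul_szego hdt hw
  have hpos : 0 < 1 - ‖(w : ℂ)‖ ^ 2 := by nlinarith [norm_nonneg (w : ℂ)]
  have h3 : Real.circleAverage (fun z => ‖szego w z‖ ^ 2) 0 1 = 1 / (1 - ‖(w : ℂ)‖ ^ 2) := by
    have h4 : Real.circleAverage (fun z => szego w z * conj (szego w z)) 0 1 = szego w w :=
      circleAverage_mul_szego (diffContOnCl_szego w) hw
    have e : (fun z => szego w z * conj (szego w z))
        = Complex.ofRealCLM ∘ fun z => ‖szego w z‖ ^ 2 := by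
      funext z; simp [Complex.mul_conj, Complex.normSq_eq_norm_sq]
    rw [e, ContinuousLinearMap.circleAverage_comp_comm _
      (circleIntegrable_of_continuousOn (by fun_prop))] at h4
    apply Complex.ofReal_injective
    rw [Complex.ofRealCLM_apply] at h4
    rw [h4, szego, mul_comm (conj (w : ℂ)), Complex.mul_conj, Complex.normSq_eq_norm_sq]
    push_cast
    rfl
  rw [h2, h3, circleAverage_dilate (fun z => ‖φ z‖ ^ 2)] at h1
  have h5 := pow_le_pow_left₀ (norm_nonneg _) h1 2
  have h6 : 0 ≤ Real.circleAverage (fun z => ‖φ z‖ ^ 2) 0 t :=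
    Real.circleAverage_nonneg_of_nonneg fun z _ => sq_nonneg _
  rw [mul_pow, Real.sq_sqrt h6, Real.sq_sqrt (by positivity), mul_one_div,
    le_div_iff₀ hpos] at h5
  exact h5.trans (hD t ht.1.le ht.2)

theorem nhdsWithin_ball_neBot {ζ : ℂ} (hζ : ‖ζ‖ = 1) : (𝓝[ball (0 : ℂ) 1] ζ).NeBot := by
  rw [← mem_closure_iff_nhdsWithin_neBot, closure_ball _ one_ne_zero]
  simp [hζ]

theorem nhdsWithin_ball_le_punctured {ζ : ℂ} (hζ : ‖ζ‖ = 1) : 𝓝[ball (0 : ℂ) 1] ζ ≤ 𝓝[≠] ζ := by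
  refine nhdsWithin_mono _ fun z hz => ?_
  rintro rfl
  rw [mem_ball_zero_iff] at hz
  exact hz.ne hζ

theorem tendsto_radial {ζ : ℂ} (hζ : ‖ζ‖ = 1) :
    Tendsto (fun t : ℝ => (t : ℂ) * ζ) (𝓝[<] 1) (𝓝[ball (0 : ℂ) 1] ζ) := by
  refine tendsto_nhdsWithin_iff.2 ⟨?_, ?_⟩
  · have : Continuous fun t : ℝ => (t : ℂ) * ζ := by fun_prop
    have h := this.tendsto 1
    simp only [Complex.ofReal_one, one_mul] at h
    exact h.mono_left nhdsWithin_le_nhds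
  · filter_upwards [eventually_mem_Ioo_nhdsLT_one] with t ht
    exact ofReal_mul_mem_ball ht.1.le ht.2 hζ.le

/-- Two analytic functions that agree in the disc near a boundary point agree near that point. -/
theorem eventuallyEq_of_eventuallyEq_ball {F G : ℂ → ℂ} {ζ : ℂ} (hζ : ‖ζ‖ = 1)
    (hF : AnalyticAt ℂ F ζ) (hG : AnalyticAt ℂ G ζ)
    (h : ∀ᶠ z in 𝓝[ball (0 : ℂ) 1] ζ, F z = G z) : F =ᶠ[𝓝 ζ] G := by
  have := nhdsWithin_ball_neBot hζ
  exact (hF.frequently_eq_iff_eventually_eq hG).1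
    (h.frequently.filter_mono (nhdsWithin_ball_le_punctured hζ))

/-- If `F` is analytic at a boundary point `ζ` and `F = (z - ζ) ^ m * p₁ * φ` in the disc with `φ`
in `H²`, then `F` vanishes to order at least `m` at `ζ`. -/
theorem le_analyticOrderAt_of_eq_mul {F φ : ℂ → ℂ} (hφ : IsHardyTwo φ) {ζ : ℂ} (hζ : ‖ζ‖ = 1)
    (hF : AnalyticAt ℂ F ζ) {p₁ : ℂ → ℂ} (hp₁ : ContinuousAt p₁ ζ) {m : ℕ}
    (h : ∀ᶠ z in 𝓝[ball (0 : ℂ) 1] ζ, F z = (z - ζ) ^ m * p₁ z * φ z) :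
    (m : ℕ∞) ≤ analyticOrderAt F ζ := by
  by_contra hlt
  rw [not_le] at hlt
  obtain ⟨k, hk⟩ := ENat.ne_top_iff_exists.1 (ne_top_of_lt hlt)
  rw [← hk] at hlt
  have hkm : k < m := by exact_mod_cast hlt
  -- If the order were `k < m`, cancelling `(z - ζ)^k` would leave `G = (z - ζ)^(m-k) p₁ φ` with
  -- `G(ζ) ≠ 0`. Along the radius `|φ|² ≤ D / (1 - t²)`, so even one remaining factor `1 - t` forces
  -- the right side to tend to zero.
  obtain ⟨G, hG, hG0, hFG⟩ := (hF.analyticOrderAt_eq_natCast).1 hk.symm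
  obtain ⟨D, hD0, hD⟩ := hφ.exists_norm_sq_le
  have hlim := tendsto_radial hζ
  have hGlim : Tendsto (fun t : ℝ => ‖G ((t : ℂ) * ζ)‖ ^ 2) (𝓝[<] 1) (𝓝 (‖G ζ‖ ^ 2)) :=
    ((hG.continuousAt.tendsto.comp (hlim.mono_right nhdsWithin_le_nhds)).norm).pow 2
  have hplim : Tendsto (fun t : ℝ => ‖p₁ ((t : ℂ) * ζ)‖ ^ 2) (𝓝[<] 1) (𝓝 (‖p₁ ζ‖ ^ 2)) :=
    ((hp₁.tendsto.comp (hlim.mono_right nhdsWithin_le_nhds)).norm).pow 2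
  have ht0 : Tendsto (fun t : ℝ => (1 - t) * D) (𝓝[<] 1) (𝓝 0) := by
    have : Continuous fun t : ℝ => (1 - t) * D := by fun_prop
    have h := this.tendsto 1
    simp only [sub_self, zero_mul] at h
    exact h.mono_left nhdsWithin_le_nhds
  have hz := ht0.mul hplim
  rw [zero_mul] at hz
  have hle : ∀ᶠ t : ℝ in 𝓝[<] 1,
      ‖G ((t : ℂ) * ζ)‖ ^ 2 ≤ (1 - t) * D * ‖p₁ ((t : ℂ) * ζ)‖ ^ 2 := by
    filter_upwards [eventually_mem_Ioo_nhdsLT_one, hlim.eventually h,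
      (hlim.mono_right nhdsWithin_le_nhds).eventually hFG] with t ht h1 h2
    have hne : (t : ℂ) * ζ - ζ ≠ 0 := by
      have : (t : ℂ) * ζ - ζ = ((t - 1 : ℝ) : ℂ) * ζ := by push_cast; ring
      rw [this]
      refine mul_ne_zero (Complex.ofReal_ne_zero.2 (by linarith)) ?_
      rintro rfl; simp at hζ
    have hnorm : ‖(t : ℂ) * ζ - ζ‖ = 1 - t := by
      have : (t : ℂ) * ζ - ζ = ((t - 1 : ℝ) : ℂ) * ζ := by push_cast; ring
      rw [this, norm_mul, hζ, mul_one, Complex.norm_real, Real.norm_eq_abs, abs_sub_comm,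
        abs_of_pos (by linarith)]
    obtain ⟨j, rfl⟩ := Nat.exists_eq_add_of_lt hkm
    have h3 : G ((t : ℂ) * ζ)
        = ((t : ℂ) * ζ - ζ) ^ (j + 1) * p₁ ((t : ℂ) * ζ) * φ ((t : ℂ) * ζ) := by
      rw [h1, smul_eq_mul] at h2
      refine mul_left_cancel₀ (pow_ne_zero k hne) ?_
      rw [← h2]; ring
    set w : 𝔻 := Complex.UnitDisc.mk ((t : ℂ) * ζ)
      (by simpa using ofReal_mul_mem_ball ht.1.le ht.2 hζ.le) with hw
    have h4 : ‖φ ((t : ℂ) * ζ)‖ ^ 2 * (1 - t ^ 2) ≤ D := by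
      have := hD w
      have hwn : ‖(w : ℂ)‖ = t := by
        simp [hw, hζ, abs_of_pos ht.1]
      rw [hwn] at this
      exact this
    have hpow : (1 - t) ^ (j + 1) ≤ 1 - t :=
      pow_le_of_le_one (by linarith) (by linarith) (by omega)
    rw [h3, norm_mul, norm_mul, norm_pow, hnorm, mul_pow, mul_pow]
    have h5 : ((1 - t) ^ (j + 1)) ^ 2 ≤ (1 - t) ^ 2 :=
      pow_le_pow_left₀ (pow_nonneg (by linarith) _) hpow 2
    have h6 : (1 - t) ^ 2 * ‖φ ((t : ℂ) * ζ)‖ ^ 2 ≤ (1 - t) * D := by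
      nlinarith [mul_nonneg (mul_nonneg ht.1.le (sub_nonneg.2 ht.2.le))
        (sq_nonneg ‖φ ((t : ℂ) * ζ)‖)]
    calc ((1 - t) ^ (j + 1)) ^ 2 * ‖p₁ ((t : ℂ) * ζ)‖ ^ 2 * ‖φ ((t : ℂ) * ζ)‖ ^ 2
        ≤ (1 - t) ^ 2 * ‖p₁ ((t : ℂ) * ζ)‖ ^ 2 * ‖φ ((t : ℂ) * ζ)‖ ^ 2 := by gcongr
      _ = (1 - t) ^ 2 * ‖φ ((t : ℂ) * ζ)‖ ^ 2 * ‖p₁ ((t : ℂ) * ζ)‖ ^ 2 := by ring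
      _ ≤ _ := by gcongr
  have h0 : ‖G ζ‖ ^ 2 ≤ 0 := le_of_tendsto_of_tendsto hGlim hz hle
  exact hG0 (norm_le_zero_iff.1 (by nlinarith [norm_nonneg (G ζ)]))

/-! ### Polynomials and their derivatives -/

theorem analyticAt_eval (T : Polynomial ℂ) (ζ : ℂ) : AnalyticAt ℂ (fun z => T.eval z) ζ :=
  T.differentiable.analyticAt ζ

theorem exists_eval_eq_pow_rootMultiplicity_mul {T : Polynomial ℂ} (hT : T ≠ 0) (ζ : ℂ) :
    ∃ T₁ : Polynomial ℂ, T₁.eval ζ ≠ 0 ∧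
      ∀ z, T.eval z = (z - ζ) ^ T.rootMultiplicity ζ * T₁.eval z := by
  refine ⟨T /ₘ (Polynomial.X - Polynomial.C ζ) ^ T.rootMultiplicity ζ,
    Polynomial.eval_divByMonic_pow_rootMultiplicity_ne_zero ζ hT, fun z => ?_⟩
  conv_lhs => rw [← Polynomial.pow_mul_divByMonic_rootMultiplicity_eq T ζ]
  simp

theorem analyticOrderAt_eval {T : Polynomial ℂ} (hT : T ≠ 0) (ζ : ℂ) :
    analyticOrderAt (fun z => T.eval z) ζ = T.rootMultiplicity ζ := by
  obtain ⟨T₁, h1, h2⟩ := exists_eval_eq_pow_rootMultiplicity_mul hT ζ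
  rw [(analyticAt_eval T ζ).analyticOrderAt_eq_natCast]
  exact ⟨fun z => T₁.eval z, analyticAt_eval T₁ ζ, h1,
    Eventually.of_forall fun z => by rw [smul_eq_mul]; exact h2 z⟩

theorem nodePoly_rootMultiplicity (s : Multiset ℂ) (ζ : ℂ) :
    (nodePoly s).rootMultiplicity ζ = s.count ζ := by
  rw [← Polynomial.count_roots, nodePoly_roots]

theorem le_analyticOrderAt_of_eq_nodePoly_mul {F φ : ℂ → ℂ} (hφ : IsHardyTwo φ) {ζ : ℂ}
    (hζ : ‖ζ‖ = 1) (hF : AnalyticAt ℂ F ζ) {s : Multiset ℂ}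
    (h : ∀ᶠ z in 𝓝[ball (0 : ℂ) 1] ζ, F z = (nodePoly s).eval z * φ z) :
    (s.count ζ : ℕ∞) ≤ analyticOrderAt F ζ := by
  obtain ⟨T₁, -, h2⟩ := exists_eval_eq_pow_rootMultiplicity_mul (nodePoly_monic s).ne_zero ζ
  rw [nodePoly_rootMultiplicity] at h2
  exact le_analyticOrderAt_of_eq_mul hφ hζ hF T₁.continuous.continuousAt
    (h.mono fun z hz => by rw [hz, h2])

/-- A polynomial of degree less than the number of nodes that vanishes at the nodes is zero. -/
theorem eq_zero_of_count_le_analyticOrderAt {T : Polynomial ℂ} {s : Multiset ℂ}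
    (hd : T.degree < s.card)
    (h : ∀ ζ ∈ s, (s.count ζ : ℕ∞) ≤ analyticOrderAt (fun z => T.eval z) ζ) : T = 0 := by
  by_contra hT
  have hle : s ≤ T.roots := by
    rw [Multiset.le_iff_count]
    intro ζ
    by_cases hζ : ζ ∈ s
    · have := h ζ hζ
      rw [analyticOrderAt_eval hT] at this
      rw [Polynomial.count_roots]
      exact_mod_cast this
    · rw [Multiset.count_eq_zero_of_notMem hζ]; exact Nat.zero_le _
  have h1 := (Multiset.card_le_card hle).trans (Polynomial.card_roots' T)
  rw [Polynomial.degree_eq_natDegree hT] at hd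
  have : T.natDegree < s.card := by exact_mod_cast hd
  omega

/-- The difference `S - S' = p (φ' - φ)` is a polynomial, hence analytic at the nodes, and the
growth of `H²` functions makes it vanish at each node to full multiplicity. Its degree is too small
for that many zeros. -/
theorem nodePoly_decomposition_unique {s : Multiset ℂ} (hs : ∀ η ∈ s, ‖η‖ = 1)
    {φ φ' : ℂ → ℂ} (hφ : IsHardyTwo φ) (hφ' : IsHardyTwo φ') {S S' : Polynomial ℂ}
    (hS : S.degree < s.card) (hS' : S'.degree < s.card)
    (h : ∀ w : 𝔻, (nodePoly s).eval (w : ℂ) * φ w + S.eval (w : ℂ)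
      = (nodePoly s).eval (w : ℂ) * φ' w + S'.eval (w : ℂ)) : S = S' := by
  rw [← sub_eq_zero]
  refine eq_zero_of_count_le_analyticOrderAt
    ((Polynomial.degree_sub_le _ _).trans_lt (max_lt hS hS')) fun ζ hζ => ?_
  refine le_analyticOrderAt_of_eq_nodePoly_mul (hφ'.add (hφ.const_mul (-1))) (hs ζ hζ)
    (analyticAt_eval _ _) ?_
  filter_upwards [self_mem_nhdsWithin] with z hz
  have := h (Complex.UnitDisc.mk z (by simpa using hz))
  simp only [Complex.UnitDisc.coe_mk] at this
  rw [Polynomial.eval_sub]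
  linear_combination this

theorem iteratedDeriv_eval (T : Polynomial ℂ) (ℓ : ℕ) :
    iteratedDeriv ℓ (fun z => T.eval z) = fun z => (Polynomial.derivative^[ℓ] T).eval z := by
  induction ℓ with
  | zero => simp
  | succ ℓ ih =>
    rw [iteratedDeriv_succ, ih, Function.iterate_succ_apply']
    funext z
    exact Polynomial.deriv _

/-- Turns derivatives in the variable `conj λ`, as used for the derivative kernels, into conjugates
of ordinary derivatives. -/
theorem iteratedDeriv_conj_conj (f : ℂ → ℂ) (ℓ : ℕ) :
    iteratedDeriv ℓ (fun x => conj (f (conj x))) = fun x => conj (iteratedDeriv ℓ f (conj x)) := by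
  induction ℓ with
  | zero => simp
  | succ ℓ ih =>
    rw [iteratedDeriv_succ, ih, iteratedDeriv_succ]
    exact deriv_conj_conj (f := iteratedDeriv ℓ f)

/-! ### The structure of `H(b)` when `1 - |b|²` is comparable to `|p|²` on the circle -/

/-- `1 - |b|²` is comparable on the unit circle to `|p|²`, where `p` is the monic polynomial with
roots `s` on the unit circle, `conj b` agrees up to `O(|p|)` with an analytic function, and `b`
continues analytically across the points of `s`. -/
structure IsBoundaryWeight (b : SchurFunction) (s : Multiset ℂ) : Prop where
  norm_eq_one : ∀ η ∈ s, ‖η‖ = 1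
  exists_bounds : ∃ (B κ : ℂ → ℂ) (C D : ℝ), IsDiscExtension b B ∧ DiffContOnCl ℂ κ (ball 0 1) ∧
    0 ≤ C ∧ (∀ z ∈ sphere (0 : ℂ) 1, ‖(nodePoly s).eval z‖ ^ 2 ≤ C * (1 - ‖B z‖ ^ 2)) ∧
    (∀ z ∈ sphere (0 : ℂ) 1, 1 - ‖B z‖ ^ 2 ≤ C * ‖(nodePoly s).eval z‖ ^ 2) ∧
    ∀ z ∈ sphere (0 : ℂ) 1, ‖conj (B z) - κ z‖ ≤ D * ‖(nodePoly s).eval z‖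
  exists_extension : ∀ η ∈ s, ∃ F, IsAnalyticExtensionAt b η F

theorem IsBoundaryWeight.mul_mem {b : SchurFunction} {s : Multiset ℂ} (h : IsBoundaryWeight b s)
    {φ : ℂ → ℂ} (hφ : IsHardyTwo φ) :
    (fun z : 𝔻 => (nodePoly s).eval (z : ℂ) * φ z) ∈ spaceFunctions b := by
  obtain ⟨B, κ, C, D, hB, hκ, hC, h1, h2, h3⟩ := h.exists_bounds
  exact mul_mem_spaceFunctions hB hC h1 hφ

theorem IsBoundaryWeight.eval_mem {b : SchurFunction} {s : Multiset ℂ} (h : IsBoundaryWeight b s)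
    (S : Polynomial ℂ) : (fun z : 𝔻 => S.eval (z : ℂ)) ∈ spaceFunctions b := by
  obtain ⟨B, κ, C, D, hB, hκ, hC, h1, h2, h3⟩ := h.exists_bounds
  have hp0 : (nodePoly s).coeff 0 ≠ 0 := by
    rw [Polynomial.coeff_zero_eq_eval_zero]
    intro h0
    have := h.norm_eq_one 0 (nodePoly_eval_eq_zero.1 h0)
    simp at this
  have e : (fun z : 𝔻 => S.eval (z : ℂ))
      = ∑ i ∈ Finset.range (S.natDegree + 1), S.coeff i • fun z : 𝔻 => (z : ℂ) ^ i := by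
    funext z
    rw [Finset.sum_apply, Polynomial.eval_eq_sum_range]
    rfl
  rw [e]
  exact Submodule.sum_mem _ fun i _ => Submodule.smul_mem _ _
    (pow_mem_spaceFunctions hB hC h1 hp0 i)

theorem IsBoundaryWeight.exists_decomposition {b : SchurFunction} {s : Multiset ℂ}
    (h : IsBoundaryWeight b s) :
    ∃ K : ℝ, 0 ≤ K ∧ ∀ f : Space b, ∃ (φ : ℂ → ℂ) (S : Polynomial ℂ), IsHardyTwo φ ∧
      S.degree < s.card ∧ (∀ i, ‖S.coeff i‖ ≤ K * ‖f‖) ∧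
      ∀ w : 𝔻, f w = (nodePoly s).eval (w : ℂ) * φ w + S.eval (w : ℂ) := by
  obtain ⟨B, κ, C, D, hB, hκ, hC, h1, h2, h3⟩ := h.exists_bounds
  exact DBR.exists_decomposition hB h.norm_eq_one hC hκ h2 h3

/-- The right side depends on `s` alone and not on `b`: two functions with the same boundary weight
have the same space. -/
theorem IsBoundaryWeight.mem_spaceFunctions_iff {b : SchurFunction} {s : Multiset ℂ}
    (h : IsBoundaryWeight b s) (f : 𝔻 → ℂ) :
    f ∈ spaceFunctions b ↔ ∃ (φ : ℂ → ℂ) (S : Polynomial ℂ), IsHardyTwo φ ∧ S.degree < s.card ∧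
      ∀ w : 𝔻, f w = (nodePoly s).eval (w : ℂ) * φ w + S.eval (w : ℂ) := by
  constructor
  · rintro ⟨F, rfl⟩
    obtain ⟨K, -, hK⟩ := h.exists_decomposition
    obtain ⟨φ, S, hφ, hS, -, hf⟩ := hK F
    exact ⟨φ, S, hφ, hS, hf⟩
  · rintro ⟨φ, S, hφ, -, hf⟩
    have e : f = (fun z : 𝔻 => (nodePoly s).eval (z : ℂ) * φ z) + fun z : 𝔻 => S.eval (z : ℂ) :=
      funext hf
    rw [e]
    exact Submodule.add_mem _ (h.mul_mem hφ) (h.eval_mem S)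

/-- The functional that assigns to `p φ + S` the value `S^(ℓ)(ζ)` is represented by an element of
`H(b)`. -/
theorem IsBoundaryWeight.exists_representer {b : SchurFunction} {s : Multiset ℂ}
    (h : IsBoundaryWeight b s) (ζ : ℂ) (ℓ : ℕ) :
    ∃ v : Space b, ∀ (f : Space b) (φ : ℂ → ℂ) (S : Polynomial ℂ), IsHardyTwo φ →
      S.degree < s.card →
      (∀ w : 𝔻, f w = (nodePoly s).eval (w : ℂ) * φ w + S.eval (w : ℂ)) →
      ⟪v, f⟫_ℂ = (Polynomial.derivative^[ℓ] S).eval ζ := by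
  obtain ⟨K, hK0, hK⟩ := h.exists_decomposition
  choose φ S hφ hSd hSc hf using hK
  -- Uniqueness of the remainder is what makes the chosen map `f ↦ S f` linear.
  have huniq : ∀ (f : Space b) (φ' : ℂ → ℂ) (S' : Polynomial ℂ), IsHardyTwo φ' →
      S'.degree < s.card →
      (∀ w : 𝔻, f w = (nodePoly s).eval (w : ℂ) * φ' w + S'.eval (w : ℂ)) → S f = S' :=
    fun f φ' S' hφ' hS' hf' => nodePoly_decomposition_unique h.norm_eq_one (hφ f) hφ' (hSd f) hS'
      fun w => by rw [← hf, ← hf']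
  let T : Space b →ₗ[ℂ] Polynomial ℂ :=
    { toFun := S
      map_add' := fun f g => huniq _ (fun z => φ f z + φ g z) _ ((hφ f).add (hφ g))
        ((Polynomial.degree_add_le _ _).trans_lt (max_lt (hSd f) (hSd g))) fun w => by
          have h1 : (f + g) w = f w + g w := by rw [RKHS.coe_add]; rfl
          rw [h1, hf f, hf g, Polynomial.eval_add]
          ring
      map_smul' := fun c f => huniq _ (fun z => c * φ f z) _ ((hφ f).const_mul c)
        ((Polynomial.degree_smul_le _ _).trans_lt (hSd f)) fun w => by
          have h1 : (c • f) w = c * f w := by rw [RKHS.coe_smul]; rfl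
          rw [h1, hf f, RingHom.id_apply, Polynomial.eval_smul, smul_eq_mul]
          ring }
  let E : Polynomial ℂ →ₗ[ℂ] ℂ := Polynomial.leval ζ ∘ₗ (Polynomial.derivative ^ ℓ)
  have hE : ∀ P : Polynomial ℂ, E P = (Polynomial.derivative^[ℓ] P).eval ζ := fun P => by
    simp [E, Module.End.pow_apply]
  -- The coefficients of `S f` are bounded by `K ‖f‖`, and there are only `s.card` of them, so the
  -- functional is bounded.
  let Λ : Space b →L[ℂ] ℂ := (E ∘ₗ T).mkContinuous
    (∑ i ∈ Finset.range s.card, K * ‖E (Polynomial.monomial i 1)‖) fun f => by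
      have hn : (S f).natDegree < s.card ∨ S f = 0 := by
        by_cases h0 : S f = 0
        · exact Or.inr h0
        · have := hSd f
          rw [Polynomial.degree_eq_natDegree h0] at this
          exact Or.inl (by exact_mod_cast this)
      have h1 : S f = ∑ i ∈ Finset.range s.card, (S f).coeff i • Polynomial.monomial i (1 : ℂ) := by
        rcases hn with hn | hn
        · conv_lhs => rw [Polynomial.as_sum_range' (S f) s.card hn]
          exact Finset.sum_congr rfl fun i _ => by rw [Polynomial.smul_monomial, smul_eq_mul, mul_one]
        · simp [hn]
      show ‖E (S f)‖ ≤ _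
      rw [h1, map_sum, Finset.sum_mul]
      refine (norm_sum_le _ _).trans (Finset.sum_le_sum fun i _ => ?_)
      rw [map_smul, norm_smul]
      calc ‖(S f).coeff i‖ * ‖E (Polynomial.monomial i 1)‖
          ≤ K * ‖f‖ * ‖E (Polynomial.monomial i 1)‖ :=
            mul_le_mul_of_nonneg_right (hSc f i) (norm_nonneg _)
        _ = _ := by ring
  refine ⟨(InnerProductSpace.toDual ℂ (Space b)).symm Λ, fun f φ' S' hφ' hS' hf' => ?_⟩
  rw [InnerProductSpace.toDual_symm_apply, ← hE, ← huniq f φ' S' hφ' hS' hf']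
  rfl

theorem IsAnalyticExtensionAt.eventuallyEq {f F G : ℂ → ℂ} {ζ : ℂ} (hζ : ‖ζ‖ = 1)
    (hF : IsAnalyticExtensionAt f ζ F) (hG : IsAnalyticExtensionAt f ζ G) : F =ᶠ[𝓝 ζ] G :=
  eventuallyEq_of_eventuallyEq_ball hζ hF.1 hG.1 (by
    filter_upwards [hF.2, hG.2] with z h1 h2 using h1.trans h2.symm)

/-- The derivative kernel at a boundary point is unique. -/
theorem IsKernelDeriv.unique {b : ℂ → ℂ} {ℓ : ℕ} {ζ : ℂ} (hζ : ‖ζ‖ = 1) {v v' : 𝔻 → ℂ}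
    (h : IsKernelDeriv b ℓ ζ v) (h' : IsKernelDeriv b ℓ ζ v') : v = v' := by
  obtain ⟨F, hF, hv⟩ := h
  obtain ⟨G, hG, hv'⟩ := h'
  funext z
  rw [hv, hv']
  refine Filter.EventuallyEq.iteratedDeriv_eq ℓ ?_
  have h1 : Tendsto (fun x : ℂ => conj x) (𝓝 (conj ζ)) (𝓝 ζ) := by
    have := Complex.continuous_conj.tendsto (conj ζ)
    rwa [Complex.conj_conj] at this
  filter_upwards [h1.eventually (hF.eventuallyEq hζ hG)] with x hx
  rw [hx]

/-- An element of `H(b)` representing the functional `p φ + S ↦ S^(ℓ)(ζ)`, with `ℓ` less than the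
multiplicity of `ζ`, is the derivative kernel of order `ℓ` at `ζ`. -/
theorem IsBoundaryWeight.isKernelDeriv {b : SchurFunction} {s : Multiset ℂ}
    (h : IsBoundaryWeight b s) {ζ : ℂ} {ℓ : ℕ} (hℓ : ℓ < s.count ζ) {v : Space b}
    (hv : ∀ (f : Space b) (φ : ℂ → ℂ) (S : Polynomial ℂ), IsHardyTwo φ → S.degree < s.card →
      (∀ w : 𝔻, f w = (nodePoly s).eval (w : ℂ) * φ w + S.eval (w : ℂ)) →
      ⟪v, f⟫_ℂ = (Polynomial.derivative^[ℓ] S).eval ζ) :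
    IsKernelDeriv b ℓ ζ v := by
  have hζs : ζ ∈ s := Multiset.count_pos.1 (by omega)
  have hζ := h.norm_eq_one ζ hζs
  obtain ⟨F, hF⟩ := h.exists_extension ζ hζs
  refine ⟨F, hF, fun z => ?_⟩
  obtain ⟨K, -, hK⟩ := h.exists_decomposition
  obtain ⟨φ, S, hφ, hSd, -, hf⟩ := hK (kernelVec b z)
  have h1 : v z = conj ((Polynomial.derivative^[ℓ] S).eval ζ) := by
    rw [← hv _ φ S hφ hSd hf, ← inner_kernelVec, inner_conj_symm]
  -- The continuation to a neighbourhood of `ζ` of the kernel function at `z`. In the disc `k - S =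
  -- p φ`, so `k - S` vanishes at `ζ` to order at least the multiplicity of the node, which exceeds
  -- `ℓ`; hence `S^(ℓ)(ζ) = k^(ℓ)(ζ)`.
  set k : ℂ → ℂ := fun w => (1 - conj (b z) * F w) / (1 - conj (z : ℂ) * w) with hk
  have hka : AnalyticAt ℂ k ζ := by
    have hne := one_sub_conj_mul_ne_zero z.norm_lt_one hζ.le
    exact (analyticAt_const.sub (analyticAt_const.mul hF.1)).div
      (analyticAt_const.sub (analyticAt_const.mul analyticAt_id)) hne
  have hord : (s.count ζ : ℕ∞) ≤ analyticOrderAt (fun w => k w - S.eval w) ζ := by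
    refine le_analyticOrderAt_of_eq_nodePoly_mul hφ hζ (hka.sub (analyticAt_eval S ζ)) ?_
    filter_upwards [self_mem_nhdsWithin, hF.2] with w hw hFw
    have := hf (Complex.UnitDisc.mk w (by simpa using hw))
    rw [kernelVec_apply] at this
    simp only [Complex.UnitDisc.coe_mk, kernelFun] at this
    show (1 - conj (b z) * F w) / (1 - conj (z : ℂ) * w) - S.eval w = _
    rw [hFw, this]
    ring
  have h2 := (natCast_le_analyticOrderAt_iff_iteratedDeriv_eq_zero
    (hka.sub (analyticAt_eval S ζ))).1 hord ℓ hℓ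
  have h3 : iteratedDeriv ℓ k ζ = (Polynomial.derivative^[ℓ] S).eval ζ := by
    have := iteratedDeriv_sub (n := ℓ) (x := ζ) (hka.contDiffAt)
      ((analyticAt_eval S ζ).contDiffAt)
    rw [iteratedDeriv_eval] at this
    rw [this] at h2
    exact sub_eq_zero.1 h2
  -- Hermitian symmetry of the kernel exchanges the roles of the two variables.
  have h4 : (fun x : ℂ => (1 - conj (F (conj x)) * b z) / (1 - x * (z : ℂ)))
      = fun x => conj (k (conj x)) := by
    funext x
    simp only [hk, map_div₀, map_sub, map_one, map_mul, Complex.conj_conj]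
    ring
  rw [h1, h4, iteratedDeriv_conj_conj]
  simp only [Complex.conj_conj]
  rw [h3]

theorem mem_mulHardyTwo {φ : ℂ → ℂ} {f : 𝔻 → ℂ} :
    f ∈ mulHardyTwo φ ↔ ∃ F : ℂ → ℂ, IsHardyTwo F ∧ ∀ z : 𝔻, f z = φ z * F z := by
  constructor
  · rintro ⟨g, ⟨F, hF, hg⟩, rfl⟩
    exact ⟨F, hF, fun z => by simp [hg]⟩
  · rintro ⟨F, hF, hf⟩
    exact ⟨fun z => F z, ⟨F, hF, fun z => rfl⟩, funext fun z => by simp [hf]⟩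

theorem mem_subspaceOf {b : SchurFunction} {M : Submodule ℂ (𝔻 → ℂ)} {f : Space b} :
    f ∈ subspaceOf b M ↔ ⇑f ∈ M := Iff.rfl

/-- The orthogonal decomposition of `H(b)`. -/
theorem IsBoundaryWeight.orthogonal_decomposition {b : SchurFunction} {s : Multiset ℂ}
    (h : IsBoundaryWeight b s) {n : ℕ} {ζ : Fin n → ℂ} {m : Fin n → ℕ}
    (hcount : ∀ j, s.count (ζ j) = m j) (hmem : ∀ η ∈ s, ∃ j, ζ j = η) :
    ∃ v : (j : Fin n) → Fin (m j) → Space b,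
      (∀ (j : Fin n) (ℓ : Fin (m j)), IsKernelDeriv b ℓ (ζ j) (v j ℓ)) ∧
      (∀ (j : Fin n) (ℓ : Fin (m j)),
        ∀ f ∈ subspaceOf b (mulHardyTwo fun z => (nodePoly s).eval z), ⟪f, v j ℓ⟫_ℂ = 0) ∧
      (subspaceOf b (mulHardyTwo fun z => (nodePoly s).eval z) ⟂
        Submodule.span ℂ (Set.range fun p : (j : Fin n) × Fin (m j) => v p.1 p.2)) ∧
      subspaceOf b (mulHardyTwo fun z => (nodePoly s).eval z) ⊔
        Submodule.span ℂ (Set.range fun p : (j : Fin n) × Fin (m j) => v p.1 p.2) = ⊤ := by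
  choose v hv using fun (j : Fin n) (ℓ : Fin (m j)) => h.exists_representer (ζ j) ℓ
  have horth : ∀ (j : Fin n) (ℓ : Fin (m j)),
      ∀ f ∈ subspaceOf b (mulHardyTwo fun z => (nodePoly s).eval z), ⟪f, v j ℓ⟫_ℂ = 0 := by
    intro j ℓ f hf
    obtain ⟨φ, hφ, hf⟩ := mem_mulHardyTwo.1 (mem_subspaceOf.1 hf)
    rw [← inner_conj_symm, hv j ℓ f φ 0 hφ (by
      rw [Polynomial.degree_zero]; exact WithBot.bot_lt_coe _) fun w => by
      rw [Polynomial.eval_zero, add_zero]; exact hf w]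
    simp
  set V := Submodule.span ℂ (Set.range fun p : (j : Fin n) × Fin (m j) => v p.1 p.2) with hV
  refine ⟨v, fun j ℓ => h.isKernelDeriv (by rw [hcount]; exact ℓ.2) (hv j ℓ), horth, ?_, ?_⟩
  · rw [Submodule.isOrtho_iff_inner_eq]
    intro f hf g hg
    induction hg using Submodule.span_induction with
    | mem x hx =>
      obtain ⟨p, rfl⟩ := hx
      exact horth p.1 p.2 f hf
    | zero => exact inner_zero_right f
    | add x y _ _ hx hy => rw [inner_add_right, hx, hy, add_zero]
    | smul c x _ hx => rw [inner_smul_right, hx, mul_zero]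
  · rw [eq_top_iff]
    intro f _
    have : FiniteDimensional ℂ V := FiniteDimensional.span_of_finite ℂ (Set.finite_range _)
    -- The span is finite-dimensional, so `f` can be projected onto it. For the component `g`
    -- orthogonal to the span, all derivatives of the remainder `S` below the multiplicities vanish
    -- at the nodes; the degree bound forces `S = 0` and leaves `g` in `p H²`.
    set g := f - V.starProjection f with hg
    have hgV : ∀ j ℓ, ⟪v j ℓ, g⟫_ℂ = 0 := fun j ℓ =>
      Submodule.inner_right_of_mem_orthogonal (K := V)
        (Submodule.subset_span ⟨⟨j, ℓ⟩, rfl⟩) (V.sub_starProjection_mem_orthogonal f)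
    have hgM : g ∈ subspaceOf b (mulHardyTwo fun z => (nodePoly s).eval z) := by
      obtain ⟨K, -, hK⟩ := h.exists_decomposition
      obtain ⟨φ, S, hφ, hSd, -, hf⟩ := hK g
      have hS : S = 0 := by
        refine eq_zero_of_count_le_analyticOrderAt hSd fun η hη => ?_
        obtain ⟨j, rfl⟩ := hmem η hη
        rw [hcount, natCast_le_analyticOrderAt_iff_iteratedDeriv_eq_zero (analyticAt_eval S _)]
        intro ℓ hℓ
        rw [iteratedDeriv_eval]
        exact (hv j ⟨ℓ, hℓ⟩ g φ S hφ hSd hf).symm.trans (hgV j ⟨ℓ, hℓ⟩)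
      refine mem_subspaceOf.2 (mem_mulHardyTwo.2 ⟨φ, hφ, fun w => ?_⟩)
      have := hf w
      rw [hS, Polynomial.eval_zero, add_zero] at this
      exact this
    have e : f = g + V.starProjection f := by rw [hg, sub_add_cancel]
    rw [e]
    exact Submodule.add_mem_sup hgM (V.starProjection_apply_mem f)

/-! ### Rational functions on the closed disc -/

theorem conj_mul_self_of_norm_eq_one {z : ℂ} (hz : ‖z‖ = 1) : conj z * z = 1 := by
  rw [mul_comm, Complex.mul_conj, Complex.normSq_eq_norm_sq, hz]; simp

/-- A rational function bounded by one on the disc has a representation without poles on the closed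
disc. -/
theorem exists_eq_div_ne_zero_closedBall (q : SchurFunction) (hrat : IsRational q) :
    ∃ P Q : Polynomial ℂ, (∀ z ∈ closedBall (0 : ℂ) 1, Q.eval z ≠ 0) ∧
      ∀ z ∈ ball (0 : ℂ) 1, q z = P.eval z / Q.eval z := by
  obtain ⟨P, Q, hPQ⟩ := hrat
  have hQ : Q ≠ 0 := by
    rintro rfl
    exact (hPQ 0 (by simp)).1 (by simp)
  have hg : EuclideanDomain.gcd P Q ≠ 0 := fun h => hQ (EuclideanDomain.gcd_eq_zero_iff.1 h).2
  have hbez := EuclideanDomain.gcd_eq_gcd_ab P Q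
  obtain ⟨P', hP'⟩ := EuclideanDomain.gcd_dvd_left P Q
  obtain ⟨Q', hQ'⟩ := EuclideanDomain.gcd_dvd_right P Q
  set u := EuclideanDomain.gcdA P Q
  set v := EuclideanDomain.gcdB P Q
  set g := EuclideanDomain.gcd P Q
  have hcop : P' * u + Q' * v = 1 := by
    refine mul_left_cancel₀ hg ?_
    rw [mul_one]
    conv_rhs => rw [hbez, hP', hQ']
    ring
  have hball : ∀ z ∈ ball (0 : ℂ) 1, Q'.eval z ≠ 0 ∧ q z = P'.eval z / Q'.eval z := by
    intro z hz
    obtain ⟨h1, h2⟩ := hPQ z hz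
    rw [hQ', Polynomial.eval_mul] at h1
    rw [hP', hQ', Polynomial.eval_mul, Polynomial.eval_mul,
      mul_div_mul_left _ _ (left_ne_zero_of_mul h1)] at h2
    exact ⟨right_ne_zero_of_mul h1, h2⟩
  -- Boundedness in this form survives on the closed disc. A zero of `Q'` there would be a zero of
  -- `P'` as well, against the Bézout identity.
  have hle : ∀ z ∈ closedBall (0 : ℂ) 1, ‖P'.eval z‖ ≤ ‖Q'.eval z‖ := by
    intro z hz
    rw [← closure_ball _ one_ne_zero] at hz
    refine le_on_closure (f := fun z => ‖P'.eval z‖) (g := fun z => ‖Q'.eval z‖) (fun w hw => ?_)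
      P'.continuous.norm.continuousOn Q'.continuous.norm.continuousOn hz
    obtain ⟨h1, h2⟩ := hball w hw
    have h3 := q.norm_le_one w hw
    rwa [h2, norm_div, div_le_one (norm_pos_iff.2 h1)] at h3
  refine ⟨P', Q', fun z hz h0 => ?_, fun z hz => (hball z hz).2⟩
  have hP0 : P'.eval z = 0 := by
    have := hle z hz
    rw [h0, norm_zero] at this
    exact norm_le_zero_iff.1 this
  have := congrArg (Polynomial.eval z) hcop
  simp [hP0, h0] at this

/-! ### Fejér–Riesz factorization -/

/-- On the unit circle, `|Q|² - |P|²` is a polynomial up to a power of the variable. -/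
theorem exists_eval_mul_conj_pow (P Q : Polynomial ℂ) :
    ∃ (W : Polynomial ℂ) (d : ℕ), ∀ z : ℂ, ‖z‖ = 1 →
      W.eval z * conj z ^ d = ((‖Q.eval z‖ ^ 2 - ‖P.eval z‖ ^ 2 : ℝ) : ℂ) := by
  set d := max P.natDegree Q.natDegree
  -- On the circle `z̄ = 1/z`, so `conj(R(z))` is the polynomial with reversed and conjugated
  -- coefficients times `z̄^d`.
  have key : ∀ R : Polynomial ℂ, R.natDegree ≤ d → ∀ z : ℂ, ‖z‖ = 1 →
      ((R.map (starRingEnd ℂ)).reflect d).eval z * conj z ^ d = conj (R.eval z) := by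
    intro R hR z hz
    have hz0 : z ≠ 0 := by rintro rfl; simp at hz
    have hzz := conj_mul_self_of_norm_eq_one hz
    let _ : Invertible (conj z) := ⟨z, by rw [mul_comm]; exact hzz, hzz⟩
    have h1 := Polynomial.eval₂_reflect_mul_pow (RingHom.id ℂ) (conj z) d
      (R.map (starRingEnd ℂ)) (Polynomial.natDegree_map_le.trans hR)
    have h2 : ⅟(conj z) = z := rfl
    rw [h2, Polynomial.eval₂_id, Polynomial.eval₂_id, Polynomial.eval_map_apply] at h1
    exact h1
  refine ⟨Q * (Q.map (starRingEnd ℂ)).reflect d - P * (P.map (starRingEnd ℂ)).reflect d, d,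
    fun z hz => ?_⟩
  have h1 := key P (le_max_left _ _) z hz
  have h2 := key Q (le_max_right _ _) z hz
  rw [Polynomial.eval_sub, Polynomial.eval_mul, Polynomial.eval_mul, sub_mul, mul_assoc, mul_assoc,
    h1, h2, Complex.mul_conj, Complex.mul_conj, Complex.normSq_eq_norm_sq,
    Complex.normSq_eq_norm_sq]
  push_cast
  rfl

theorem sub_sq_eq_of_norm_eq_one {z η : ℂ} (hz : ‖z‖ = 1) (hη : ‖η‖ = 1) :
    (z - η) ^ 2 = -(z * η) * ((‖z - η‖ ^ 2 : ℝ) : ℂ) := by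
  rw [← Complex.normSq_eq_norm_sq, ← Complex.mul_conj, map_sub]
  linear_combination (z - η) * (η * conj_mul_self_of_norm_eq_one hz
    - z * conj_mul_self_of_norm_eq_one hη)

/-- A zero on the unit circle of a polynomial that is nonnegative on the circle, up to a power of
the variable, has even multiplicity. -/
theorem even_rootMultiplicity {W : Polynomial ℂ} (hW : W ≠ 0) {d : ℕ}
    (h : ∀ z : ℂ, ‖z‖ = 1 → ∃ x : ℝ, 0 ≤ x ∧ W.eval z * conj z ^ d = x) {η : ℂ} (hη : ‖η‖ = 1) :
    Even (W.rootMultiplicity η) := by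
  by_contra hodd
  rw [Nat.not_even_iff_odd] at hodd
  obtain ⟨i, hi⟩ := hodd
  obtain ⟨T, hT0, hT⟩ := exists_eval_eq_pow_rootMultiplicity_mul hW η
  rw [hi] at hT
  have hη0 : η ≠ 0 := by rintro rfl; simp at hη
  -- Parametrize the circle by `z = η e^{it}`. Since `(z - η)² = -z η |z - η|²`, for odd
  -- multiplicity `2 i + 1` the quotient of `W z̄^d` by `|z - η|^(2i)` is `A(t) (z - η)`. It is
  -- nonnegative and vanishes at `t = 0`, hence has derivative zero there; but the derivative is
  -- `A(0) η I`, which is not zero.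
  set A : ℝ → ℂ := fun t => (conj η * exp (-(t * I))) ^ d * (-(η * exp (t * I) * η)) ^ i
    * T.eval (η * exp (t * I)) with hA
  have hd1 : ∀ t : ℝ, HasDerivAt (fun t : ℝ => η * exp (t * I)) (η * (exp (t * I) * I)) t := by
    intro t
    have h1 : HasDerivAt (fun t : ℝ => (t : ℂ) * I) I t := by
      simpa using (Complex.ofRealCLM.hasDerivAt (x := t)).mul_const I
    exact (h1.cexp).const_mul η
  have hAd : DifferentiableAt ℝ A 0 := by
    have h1 : DifferentiableAt ℝ (fun t : ℝ => η * exp (t * I)) 0 := (hd1 0).differentiableAt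
    have h2 : DifferentiableAt ℝ (fun t : ℝ => T.eval (η * exp (t * I))) 0 :=
      ((T.differentiable.differentiableAt).restrictScalars ℝ).comp 0 h1
    have h3 : DifferentiableAt ℝ (fun t : ℝ => exp (-((t : ℂ) * I))) 0 := by
      have h1 : HasDerivAt (fun t : ℝ => (t : ℂ) * I) I 0 := by
        simpa using (Complex.ofRealCLM.hasDerivAt (x := 0)).mul_const I
      exact h1.neg.cexp.differentiableAt
    have h4 : DifferentiableAt ℝ (fun t : ℝ => -(η * exp (t * I) * η)) 0 :=
      (h1.mul_const η).neg
    exact (((h3.const_mul (conj η)).pow d).mul (h4.pow i)).mul h2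
  set f : ℝ → ℂ := fun t => A t * (η * exp (t * I) - η) with hf
  have hfd : HasDerivAt f (A 0 * (η * I)) 0 := by
    have h1 := hAd.hasDerivAt.fun_mul ((hd1 0).sub_const η)
    convert! h1 using 1
    simp
  have hne : A 0 * (η * I) ≠ 0 := by
    refine mul_ne_zero ?_ (mul_ne_zero hη0 I_ne_zero)
    simp only [hA]
    refine mul_ne_zero (mul_ne_zero (pow_ne_zero _ (mul_ne_zero (by simpa using hη0)
      (exp_ne_zero _))) (pow_ne_zero _ ?_)) (by simpa using hT0)
    simp [hη0]
  have hnonneg : ∀ t : ℝ, ∃ x : ℝ, 0 ≤ x ∧ f t = x := by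
    intro t
    set z := η * exp (t * I) with hz
    have hz1 : ‖z‖ = 1 := by rw [hz, norm_mul, hη, Complex.norm_exp_ofReal_mul_I, one_mul]
    have hcz : conj η * exp (-(t * I)) = conj z := by
      rw [hz, map_mul, ← Complex.exp_conj, map_mul, Complex.conj_ofReal, Complex.conj_I, mul_neg]
    obtain ⟨x, hx0, hx⟩ := h z hz1
    by_cases hzη : z = η
    · exact ⟨0, le_rfl, by simp [hf, ← hz, hzη]⟩
    · have hpos : 0 < ‖z - η‖ ^ 2 := by
        have := norm_pos_iff.2 (sub_ne_zero.2 hzη); positivity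
      refine ⟨x / (‖z - η‖ ^ 2) ^ i, by positivity, ?_⟩
      rw [Complex.ofReal_div, ← hx, eq_div_iff (by exact_mod_cast (pow_pos hpos i).ne'), hT,
        pow_succ (z - η) (2 * i), pow_mul (z - η) 2 i, sub_sq_eq_of_norm_eq_one hz1 hη]
      simp only [hf, hA, hcz, ← hz]
      push_cast
      ring
  have hre : HasDerivAt (fun t => (f t).re) (A 0 * (η * I)).re 0 :=
    Complex.reCLM.hasFDerivAt.comp_hasDerivAt 0 hfd
  have him : HasDerivAt (fun t => (f t).im) (A 0 * (η * I)).im 0 :=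
    Complex.imCLM.hasFDerivAt.comp_hasDerivAt 0 hfd
  have him0 : (fun t => (f t).im) = fun _ => 0 := by
    funext t
    obtain ⟨x, -, hx⟩ := hnonneg t
    rw [hx, Complex.ofReal_im]
  rw [him0] at him
  have hf0 : f 0 = 0 := by simp [hf]
  have hmin : IsLocalMin (fun t => (f t).re) 0 := by
    refine Eventually.of_forall fun t => ?_
    obtain ⟨x, hx0, hx⟩ := hnonneg t
    simp only [hf0, hx, Complex.zero_re, Complex.ofReal_re]
    exact hx0
  exact hne (Complex.ext (hmin.hasDerivAt_eq_zero hre) (him.unique (hasDerivAt_const 0 0)))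

theorem nodePoly_add (s t : Multiset ℂ) : nodePoly (s + t) = nodePoly s * nodePoly t := by
  simp [nodePoly]

/-- Extraction of the zeros on the unit circle. -/
theorem exists_eq_nodePoly_sq_mul {W : Polynomial ℂ} (hW : W ≠ 0)
    (h : ∀ η : ℂ, ‖η‖ = 1 → Even (W.rootMultiplicity η)) :
    ∃ (s : Multiset ℂ) (W₁ : Polynomial ℂ), (∀ η ∈ s, ‖η‖ = 1) ∧ W = nodePoly s ^ 2 * W₁ ∧
      ∀ z : ℂ, ‖z‖ = 1 → W₁.eval z ≠ 0 := by
  classical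
  set r := W.roots.filter fun η => ‖η‖ = 1 with hr
  -- Each root on the circle is taken with half its multiplicity, so that `p²` absorbs all of it.
  set s : Multiset ℂ := ∑ η ∈ r.toFinset, (W.rootMultiplicity η / 2) • {η} with hs
  have hcount : ∀ η, ‖η‖ = 1 → s.count η = W.rootMultiplicity η / 2 := by
    intro η hη
    rw [hs, Multiset.count_sum']
    simp only [Multiset.count_nsmul, Multiset.count_singleton, mul_ite, mul_one, mul_zero,
      Finset.sum_ite_eq]
    split_ifs with hmem
    · rfl
    · have : W.rootMultiplicity η = 0 := by
        rw [← Polynomial.count_roots, Multiset.count_eq_zero]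
        intro hη'
        exact hmem (Multiset.mem_toFinset.2 (Multiset.mem_filter.2 ⟨hη', hη⟩))
      rw [this, Nat.zero_div]
  have hsmem : ∀ η ∈ s, ‖η‖ = 1 := by
    intro η hη
    rw [hs, Multiset.mem_sum] at hη
    obtain ⟨a, ha, hηa⟩ := hη
    rw [Multiset.mem_singleton.1 (Multiset.mem_of_mem_nsmul hηa)]
    exact (Multiset.mem_filter.1 (Multiset.mem_toFinset.1 ha)).2
  have hle : s + s ≤ W.roots := by
    rw [Multiset.le_iff_count]
    intro η
    rw [Multiset.count_add]
    by_cases hη : ‖η‖ = 1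
    · rw [hcount η hη, Polynomial.count_roots]; omega
    · rw [Multiset.count_eq_zero.2 fun h => hη (hsmem η h)]; exact Nat.zero_le _
  have hdvd : nodePoly (s + s) ∣ W := (Multiset.prod_X_sub_C_dvd_iff_le_roots hW _).2 hle
  obtain ⟨W₁, hW₁⟩ := hdvd
  refine ⟨s, W₁, hsmem, by rw [sq, ← nodePoly_add]; exact hW₁, fun z hz h0 => ?_⟩
  have hW₁0 : W₁ ≠ 0 := by rintro rfl; exact hW (by rw [hW₁, mul_zero])
  have h1 := Polynomial.rootMultiplicity_mul (x := z) (hW₁ ▸ hW : nodePoly (s + s) * W₁ ≠ 0)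
  rw [← hW₁, nodePoly_rootMultiplicity, Multiset.count_add, hcount z hz] at h1
  have h2 := (Polynomial.rootMultiplicity_pos hW₁0).2 h0
  have h3 := Nat.div_mul_cancel (h z hz).two_dvd
  omega

/-- Reflection of the zeros inside the unit disc. -/
theorem exists_norm_eq_ne_zero_closedBall {W : Polynomial ℂ}
    (h : ∀ z : ℂ, ‖z‖ = 1 → W.eval z ≠ 0) :
    ∃ A : Polynomial ℂ, (∀ z ∈ closedBall (0 : ℂ) 1, A.eval z ≠ 0) ∧
      ∀ z : ℂ, ‖z‖ = 1 → ‖A.eval z‖ = ‖W.eval z‖ := by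
  have hW : W ≠ 0 := by rintro rfl; exact h 1 (by simp) (by simp)
  have key : ∀ r : Multiset ℂ, (∀ α ∈ r, ‖α‖ ≠ 1) →
      ∃ A : Polynomial ℂ, (∀ z ∈ closedBall (0 : ℂ) 1, A.eval z ≠ 0) ∧
      ∀ z : ℂ, ‖z‖ = 1 → ‖A.eval z‖ = ‖(nodePoly r).eval z‖ := by
    intro r
    induction r using Multiset.induction with
    | empty => exact fun _ => ⟨1, by simp, by simp⟩
    | cons α r ih =>
      intro hr
      obtain ⟨A, hA, hA'⟩ := ih fun β hβ => hr β (Multiset.mem_cons_of_mem hβ)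
      rcases lt_or_gt_of_ne (hr α (Multiset.mem_cons_self α r)) with hα | hα
      · refine ⟨(1 - Polynomial.C (conj α) * Polynomial.X) * A, fun z hz => ?_, fun z hz => ?_⟩
        · rw [Polynomial.eval_mul]
          refine mul_ne_zero ?_ (hA z hz)
          simpa using one_sub_conj_mul_ne_zero hα (by simpa using hz)
        · rw [nodePoly_cons, Polynomial.eval_mul, Polynomial.eval_mul, norm_mul, norm_mul, hA' z hz]
          congr 1
          simp only [Polynomial.eval_sub, Polynomial.eval_one, Polynomial.eval_mul,
            Polynomial.eval_C, Polynomial.eval_X]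
          have e : 1 - conj α * z = z * conj (z - α) := by
            rw [map_sub]; linear_combination -conj_mul_self_of_norm_eq_one hz
          rw [e, norm_mul, hz, one_mul, RCLike.norm_conj]
      · refine ⟨(Polynomial.X - Polynomial.C α) * A, fun z hz => ?_, fun z hz => ?_⟩
        · rw [Polynomial.eval_mul]
          refine mul_ne_zero ?_ (hA z hz)
          rw [Polynomial.eval_sub, Polynomial.eval_X, Polynomial.eval_C]
          intro h0
          rw [sub_eq_zero] at h0
          have : ‖z‖ ≤ 1 := by simpa using hz
          rw [h0] at this
          linarith
        · rw [nodePoly_cons, Polynomial.eval_mul, Polynomial.eval_mul, norm_mul, norm_mul, hA' z hz]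
  obtain ⟨A, hA, hA'⟩ := key W.roots fun α hα h1 => h α h1 (Polynomial.isRoot_of_mem_roots hα)
  refine ⟨Polynomial.C W.leadingCoeff * A, fun z hz => ?_, fun z hz => ?_⟩
  · rw [Polynomial.eval_mul, Polynomial.eval_C]
    exact mul_ne_zero (Polynomial.leadingCoeff_ne_zero.2 hW) (hA z hz)
  · have e := (IsAlgClosed.splits W).eq_prod_roots
    conv_rhs => rw [e]
    rw [Polynomial.eval_mul, Polynomial.eval_mul, norm_mul, norm_mul, hA' z hz]
    rfl

/-- A zero-free analytic function on a disc has an analytic logarithm. -/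
theorem exists_log_on_ball {f : ℂ → ℂ} {c : ℂ} {R : ℝ} (hR : 0 < R)
    (hf : DifferentiableOn ℂ f (ball c R)) (h0 : ∀ z ∈ ball c R, f z ≠ 0) :
    ∃ ℓ : ℂ → ℂ, DifferentiableOn ℂ ℓ (ball c R) ∧ ∀ z ∈ ball c R, exp (ℓ z) = f z := by
  have hfd : ∀ z ∈ ball c R, DifferentiableAt ℂ f z := fun z hz =>
    hf.differentiableAt (isOpen_ball.mem_nhds hz)
  have hd : DifferentiableOn ℂ (fun z => deriv f z / f z) (ball c R) :=
    (hf.deriv isOpen_ball).fun_div hf h0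
  have hc : c ∈ ball c R := mem_ball_self hR
  obtain ⟨ℓ, hℓc, hℓ⟩ := hd.isExactOn_ball.with_val_at c (log (f c))
  refine ⟨ℓ, fun z hz => (hℓ z hz).differentiableAt.differentiableWithinAt, fun z hz => ?_⟩
  have hder : ∀ w ∈ ball c R, HasDerivAt (fun w => f w * exp (-ℓ w)) 0 w := by
    intro w hw
    have h := (hfd w hw).hasDerivAt.fun_mul (hℓ w hw).fun_neg.cexp
    convert! h using 1
    have := h0 w hw
    field_simp
    ring
  have hconst : f z * exp (-ℓ z) = f c * exp (-ℓ c) :=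
    (convex_ball c R).is_const_of_fderivWithin_eq_zero (𝕜 := ℂ)
      (f := fun w => f w * exp (-ℓ w))
      (fun w hw => (hder w hw).differentiableAt.differentiableWithinAt)
      (fun w hw => by
        rw [fderivWithin_of_isOpen isOpen_ball hw, (hder w hw).hasFDerivAt.fderiv]
        ext; simp) hz hc
  rw [hℓc, Complex.exp_neg, Complex.exp_neg, Complex.exp_log (h0 c hc),
    mul_inv_cancel₀ (h0 c hc)] at hconst
  field_simp at hconst
  exact hconst.symm

theorem exists_ball_subset_of_closedBall_subset {U : Set ℂ} (hU : IsOpen U)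
    (h : closedBall (0 : ℂ) 1 ⊆ U) : ∃ R : ℝ, 1 < R ∧ ball (0 : ℂ) R ⊆ U := by
  obtain ⟨δ, hδ, h1⟩ := (isCompact_closedBall (0 : ℂ) 1).exists_thickening_subset_open hU h
  rw [thickening_closedBall hδ zero_le_one] at h1
  exact ⟨δ + 1, by linarith, h1⟩

/-- On the unit circle, `1 - |P/Q|²` is the squared modulus of a polynomial with zeros on the circle
times a function that is analytic and zero-free near the closed disc. -/
theorem exists_outer_factor {P Q : Polynomial ℂ} (hQ : ∀ z ∈ closedBall (0 : ℂ) 1, Q.eval z ≠ 0)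
    (hle : ∀ z : ℂ, ‖z‖ = 1 → ‖P.eval z / Q.eval z‖ ≤ 1)
    (hne : ∃ z : ℂ, ‖z‖ = 1 ∧ ‖P.eval z / Q.eval z‖ ≠ 1) :
    ∃ (s : Multiset ℂ) (R : ℝ) (ℓ : ℂ → ℂ), (∀ η ∈ s, ‖η‖ = 1) ∧ 1 < R ∧
      DifferentiableOn ℂ ℓ (ball 0 R) ∧ ∀ z : ℂ, ‖z‖ = 1 →
        1 - ‖P.eval z / Q.eval z‖ ^ 2 = ‖(nodePoly s).eval z * exp (ℓ z)‖ ^ 2 := by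
  obtain ⟨W, d, hWd⟩ := exists_eval_mul_conj_pow P Q
  have hQ1 : ∀ z : ℂ, ‖z‖ = 1 → 0 < ‖Q.eval z‖ := fun z hz =>
    norm_pos_iff.2 (hQ z (by simp [hz]))
  have hPQ : ∀ z : ℂ, ‖z‖ = 1 → 0 ≤ ‖Q.eval z‖ ^ 2 - ‖P.eval z‖ ^ 2 := by
    intro z hz
    have := hle z hz
    rw [norm_div, div_le_one (hQ1 z hz)] at this
    have := pow_le_pow_left₀ (norm_nonneg _) this 2
    linarith
  have hW : W ≠ 0 := by
    rintro rfl
    obtain ⟨z, hz, hz1⟩ := hne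
    have h1 := hWd z hz
    rw [Polynomial.eval_zero, zero_mul] at h1
    have h2 : ‖Q.eval z‖ ^ 2 - ‖P.eval z‖ ^ 2 = 0 := by exact_mod_cast h1.symm
    refine hz1 ?_
    rw [norm_div, div_eq_one_iff_eq (hQ1 z hz).ne']
    exact (sq_eq_sq₀ (norm_nonneg _) (norm_nonneg _)).1 (by linarith)
  obtain ⟨s, W₁, hs, hWW₁, hW₁⟩ := exists_eq_nodePoly_sq_mul hW fun η hη =>
    even_rootMultiplicity hW (d := d) (fun z hz => ⟨_, hPQ z hz, hWd z hz⟩) hη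
  obtain ⟨A, hA, hAW⟩ := exists_norm_eq_ne_zero_closedBall hW₁
  have hopen : IsOpen {z : ℂ | (A * Q).eval z ≠ 0} :=
    isOpen_ne_fun (A * Q).continuous continuous_const
  obtain ⟨R, hR, hball⟩ := exists_ball_subset_of_closedBall_subset hopen fun z hz => by
    rw [Set.mem_ofPred_eq, Polynomial.eval_mul]; exact mul_ne_zero (hA z hz) (hQ z hz)
  have hAQ : ∀ z ∈ ball (0 : ℂ) R, A.eval z ≠ 0 ∧ Q.eval z ≠ 0 := fun z hz => by
    have := hball hz
    rw [Set.mem_ofPred_eq, Polynomial.eval_mul] at this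
    exact ⟨left_ne_zero_of_mul this, right_ne_zero_of_mul this⟩
  -- The cofactor `W₁` may vanish inside the disc; `A` has the same modulus on the circle and no
  -- zeros in the closed disc. Half of this logarithm is the required exponent: `|e^{ℓ/2}|² = |W₁| /
  -- |Q|²` on the circle.
  obtain ⟨ℓ, hℓ, hℓe⟩ := exists_log_on_ball (f := fun z => A.eval z / Q.eval z ^ 2)
    (by linarith : (0 : ℝ) < R)
    (A.differentiable.differentiableOn.fun_div (Q.differentiable.pow 2).differentiableOn
      fun z hz => pow_ne_zero 2 (hAQ z hz).2)
    fun z hz => div_ne_zero (hAQ z hz).1 (pow_ne_zero 2 (hAQ z hz).2)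
  refine ⟨s, R, fun z => ℓ z / 2, hs, hR, hℓ.div_const 2, fun z hz => ?_⟩
  have hzR : z ∈ ball (0 : ℂ) R := by rw [mem_ball_zero_iff, hz]; exact hR
  have h1 : ‖exp (ℓ z / 2)‖ ^ 2 = ‖W₁.eval z‖ / ‖Q.eval z‖ ^ 2 := by
    rw [← norm_pow, ← Complex.exp_nat_mul, Nat.cast_ofNat, mul_div_cancel₀ _ two_ne_zero, hℓe z hzR,
      norm_div, norm_pow, hAW z hz]
  have h2 : ‖Q.eval z‖ ^ 2 - ‖P.eval z‖ ^ 2 = ‖(nodePoly s).eval z‖ ^ 2 * ‖W₁.eval z‖ := by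
    have h3 := congrArg norm (hWd z hz)
    rw [Complex.norm_real, Real.norm_of_nonneg (hPQ z hz), norm_mul, norm_pow, RCLike.norm_conj, hz,
      one_pow, mul_one, hWW₁, Polynomial.eval_mul, Polynomial.eval_pow, norm_mul, norm_pow] at h3
    exact h3.symm
  have := (hQ1 z hz).ne'
  rw [norm_mul, mul_pow, h1, norm_div, div_pow, ← mul_div_assoc, ← h2]
  field_simp

/-! ### Boundary weights of powers of rational functions -/

/-- Local bounds on a compact set give a global one. -/
theorem exists_forall_le_mul_of_isCompact {K : Set ℂ} (hK : IsCompact K) {u v : ℂ → ℝ}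
    (hv : ∀ z, 0 ≤ v z) (h : ∀ x ∈ K, ∃ D : ℝ, ∀ᶠ z in 𝓝[K] x, u z ≤ D * v z) :
    ∃ D : ℝ, ∀ z ∈ K, u z ≤ D * v z := by
  refine hK.induction_on (p := fun t => ∃ D : ℝ, ∀ z ∈ t, u z ≤ D * v z) ⟨0, by simp⟩
    (fun t t' ht ⟨D, hD⟩ => ⟨D, fun z hz => hD z (ht hz)⟩) ?_ ?_
  · rintro t t' ⟨D, hD⟩ ⟨D', hD'⟩
    refine ⟨max D D', ?_⟩
    rintro z (hz | hz)
    · exact (hD z hz).trans (mul_le_mul_of_nonneg_right (le_max_left _ _) (hv z))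
    · exact (hD' z hz).trans (mul_le_mul_of_nonneg_right (le_max_right _ _) (hv z))
  · intro x hx
    obtain ⟨D, hD⟩ := h x hx
    exact ⟨_, hD, D, fun z hz => hz⟩

/-- Simultaneous Hermite interpolation of analytic germs by a polynomial. -/
theorem exists_interpolation (s : Multiset ℂ) (F : ℂ → ℂ → ℂ)
    (hF : ∀ η ∈ s, AnalyticAt ℂ (F η) η) :
    ∃ (c : Polynomial ℂ) (G : ℂ → ℂ → ℂ), ∀ η ∈ s, AnalyticAt ℂ (G η) η ∧
      ∀ᶠ z in 𝓝 η, F η z = c.eval z + (nodePoly s).eval z * G η z := by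
  classical
  induction s using Multiset.induction generalizing F with
  | empty => exact ⟨0, 0, by simp⟩
  | cons ζ s ih =>
    -- Newton interpolation: every germ is replaced by its divided difference at `ζ`, with the value
    -- of the germ at `ζ` subtracted even at the other nodes, so that one polynomial serves all of
    -- them.
    set F' : ℂ → ℂ → ℂ := fun η => if η = ζ then dslope (F ζ) ζ else
      fun z => (F η z - F ζ ζ) / (z - ζ) with hF'
    have hF'a : ∀ η ∈ ζ ::ₘ s, AnalyticAt ℂ (F' η) η ∧
        ∀ᶠ z in 𝓝 η, F η z = F ζ ζ + (z - ζ) * F' η z := by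
      intro η hη
      by_cases h : η = ζ
      · subst h
        simp only [hF', if_pos]
        obtain ⟨p, hp⟩ := hF η hη
        refine ⟨⟨_, hp.has_fpower_series_dslope_fslope⟩, Eventually.of_forall fun z => ?_⟩
        have := sub_smul_dslope (F η) η z
        rw [smul_eq_mul] at this
        rw [this]; ring
      · simp only [hF', if_neg h]
        refine ⟨((hF η hη).sub analyticAt_const).div (analyticAt_id.sub analyticAt_const)
          (sub_ne_zero.2 h), ?_⟩
        filter_upwards [isOpen_ne.mem_nhds h] with z hz
        have : z - ζ ≠ 0 := sub_ne_zero.2 hz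
        field_simp
        ring
    obtain ⟨c, G, hG⟩ := ih F' fun η hη => (hF'a η (Multiset.mem_cons_of_mem hη)).1
    have hG' : ∀ η ∈ ζ ::ₘ s, ∃ g, AnalyticAt ℂ g η ∧
        ∀ᶠ z in 𝓝 η, F' η z = c.eval z + (nodePoly s).eval z * g z := by
      intro η hη
      by_cases hs : η ∈ s
      · exact ⟨G η, hG η hs⟩
      -- The induction hypothesis says nothing about the new node when it is not already in `s`;
      -- there `p` does not vanish and one can divide.
      · have hp : (nodePoly s).eval η ≠ 0 := fun h => hs (nodePoly_eval_eq_zero.1 h)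
        refine ⟨fun z => (F' η z - c.eval z) / (nodePoly s).eval z,
          ((hF'a η hη).1.sub (analyticAt_eval c η)).div (analyticAt_eval _ η) hp, ?_⟩
        filter_upwards [(nodePoly s).continuous.continuousAt.eventually_ne hp] with z hz
        field_simp
        ring
    choose! g hg using hG'
    refine ⟨Polynomial.C (F ζ ζ) + (Polynomial.X - Polynomial.C ζ) * c, g, fun η hη =>
      ⟨(hg η hη).1, ?_⟩⟩
    filter_upwards [(hg η hη).2, (hF'a η hη).2] with z h1 h2
    rw [h2, h1, nodePoly_cons]
    simp only [Polynomial.eval_add, Polynomial.eval_mul, Polynomial.eval_sub, Polynomial.eval_C,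
      Polynomial.eval_X]
    ring

/-- An analytic logarithm continues across every boundary point where the function does not
vanish. -/
theorem exists_log_extension {L f : ℂ → ℂ} {η : ℂ} (hη : ‖η‖ = 1)
    (hL : DifferentiableOn ℂ L (ball 0 1)) (hf : AnalyticAt ℂ f η) (hf0 : f η ≠ 0)
    (h : ∀ z ∈ ball (0 : ℂ) 1, exp (L z) = f z) : ∃ ℓ, IsAnalyticExtensionAt L η ℓ := by
  obtain ⟨ε, hε, hball⟩ := Metric.eventually_nhds_iff_ball.1
    (hf.eventually_analyticAt.and (hf.continuousAt.eventually_ne hf0))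
  obtain ⟨ℓ, hℓ, hℓe⟩ := exists_log_on_ball hε
    (fun z hz => (hball z hz).1.differentiableAt.differentiableWithinAt) fun z hz => (hball z hz).2
  have hU : IsOpen (ball η ε ∩ ball (0 : ℂ) 1) := isOpen_ball.inter isOpen_ball
  have hUη : ball η ε ∩ ball (0 : ℂ) 1 ∈ 𝓝[ball (0 : ℂ) 1] η :=
    inter_mem (mem_nhdsWithin_of_mem_nhds (ball_mem_nhds η hε)) self_mem_nhdsWithin
  have := nhdsWithin_ball_neBot hη
  obtain ⟨z₀, hz₀⟩ := nonempty_of_mem hUη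
  have hgd : ∀ w ∈ ball η ε ∩ ball (0 : ℂ) 1, DifferentiableAt ℂ (fun w => L w - ℓ w) w := fun w hw =>
    (hL.differentiableAt (isOpen_ball.mem_nhds hw.2)).sub
      (hℓ.differentiableAt (isOpen_ball.mem_nhds hw.1))
  have hexp : ∀ w ∈ ball η ε ∩ ball (0 : ℂ) 1, exp (L w - ℓ w) = 1 := fun w hw => by
    rw [Complex.exp_sub, h w hw.2, hℓe w hw.1, div_self (hball w hw.1).2]
  -- Two logarithms of the same function differ by a constant on a convex set, here the intersection
  -- of two balls; the local one shifted by this constant is the continuation.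
  have hconst : ∀ z ∈ ball η ε ∩ ball (0 : ℂ) 1, L z - ℓ z = L z₀ - ℓ z₀ := by
    intro z hz
    refine ((convex_ball η ε).inter (convex_ball 0 1)).is_const_of_fderivWithin_eq_zero (𝕜 := ℂ)
      (f := fun w => L w - ℓ w) (fun w hw => (hgd w hw).differentiableWithinAt) (fun w hw => ?_)
      hz hz₀
    have h1 := (hgd w hw).hasDerivAt.cexp
    have h2 : HasDerivAt (fun w => exp (L w - ℓ w)) 0 w :=
      (hasDerivAt_const w (1 : ℂ)).congr_of_eventuallyEq
        (by filter_upwards [hU.mem_nhds hw] with y hy using hexp y hy)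
    have h3 := h1.unique h2
    rw [hexp w hw, one_mul] at h3
    rw [fderivWithin_of_isOpen hU hw, (hgd w hw).hasDerivAt.hasFDerivAt.fderiv, h3]
    ext; simp
  refine ⟨fun z => ℓ z + (L z₀ - ℓ z₀), ((hℓ.analyticAt (ball_mem_nhds η hε)).add analyticAt_const),
    ?_⟩
  filter_upwards [hUη] with z hz
  rw [← hconst z hz]; ring

/-- For `r ≥ 1` this is Bernoulli's inequality together with `y^r ≤ y`. For `r < 1` the same is
applied to `y^r` with exponent `1/r`, which exchanges the two inequalities. It is the reason why the
nodes do not depend on `r`. -/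
theorem exists_one_sub_rpow_le (r : ℝ) (hr : 0 < r) :
    ∃ C : ℝ, 0 < C ∧ ∀ y : ℝ, 0 ≤ y → y ≤ 1 → 1 - y ^ r ≤ C * (1 - y) ∧ 1 - y ≤ C * (1 - y ^ r) := by
  have key : ∀ r : ℝ, 1 ≤ r → ∀ y : ℝ, 0 ≤ y → y ≤ 1 →
      1 - y ^ r ≤ r * (1 - y) ∧ 1 - y ≤ r * (1 - y ^ r) := by
    intro r hr y h0 h1
    have h2 := one_add_mul_self_le_rpow_one_add (s := y - 1) (by linarith) hr
    rw [add_sub_cancel] at h2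
    have h3 : y ^ r ≤ y := by
      simpa using Real.rpow_le_rpow_of_exponent_ge' h0 h1 zero_le_one hr
    constructor
    · linarith
    · nlinarith
  rcases le_total 1 r with h | h
  · exact ⟨r, hr, key r h⟩
  · refine ⟨r⁻¹, inv_pos.2 hr, fun y h0 h1 => ?_⟩
    have := key r⁻¹ ((one_le_inv₀ hr).2 h) (y ^ r) (Real.rpow_nonneg h0 r)
      (Real.rpow_le_one h0 h1 hr.le)
    rw [Real.rpow_rpow_inv h0 hr.ne'] at this
    exact this.symm

/-- Schwarz reflection: this function coincides with `conj F` on the circle, where `conj z⁻¹ = z`,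
and so gives `b̄` an analytic germ at each node. -/
theorem analyticAt_conj_conj_inv {F : ℂ → ℂ} {η : ℂ} (hη : ‖η‖ = 1) (hF : AnalyticAt ℂ F η) :
    AnalyticAt ℂ (fun z => conj (F (conj z⁻¹))) η := by
  have hη0 : η ≠ 0 := by rintro rfl; simp at hη
  have hfix : conj η⁻¹ = η := by
    rw [map_inv₀]; exact inv_eq_of_mul_eq_one_right (conj_mul_self_of_norm_eq_one hη)
  have hc : ContinuousAt (fun z : ℂ => conj z⁻¹) η :=
    Complex.continuous_conj.continuousAt.comp (continuousAt_inv₀ hη0)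
  rw [analyticAt_iff_eventually_differentiableAt]
  have h1 : ∀ᶠ w in 𝓝 η, DifferentiableAt ℂ F w :=
    hF.eventually_analyticAt.mono fun w hw => hw.differentiableAt
  have h2 : ∀ᶠ z in 𝓝 η, DifferentiableAt ℂ F (conj z⁻¹) :=
    hc.tendsto.eventually (by rw [hfix]; exact h1)
  filter_upwards [h2, isOpen_ne.mem_nhds hη0] with z hz hz0
  have h3 : DifferentiableAt ℂ (fun w => conj (F (conj w))) z⁻¹ := by
    have := hz.conj_conj
    rw [Complex.conj_conj] at this
    exact this
  exact h3.comp z (differentiableAt_inv hz0)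

/-- The continuous extension to the closed disc of a power of a rational function. -/
theorem exists_isDiscExtension_rpow {b : SchurFunction} {L f : ℂ → ℂ} {r : ℝ} (hr : 0 < r)
    (hL : DifferentiableOn ℂ L (ball 0 1)) (hb : ∀ z ∈ ball (0 : ℂ) 1, b z = exp (r * L z))
    (hf : ∀ z ∈ closedBall (0 : ℂ) 1, AnalyticAt ℂ f z)
    (hLf : ∀ z ∈ ball (0 : ℂ) 1, exp (L z) = f z) :
    ∃ B, IsDiscExtension b B ∧ (∀ z ∈ closedBall (0 : ℂ) 1, ‖B z‖ = ‖f z‖ ^ r) ∧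
      ∀ η : ℂ, ‖η‖ = 1 → f η ≠ 0 → ∃ F, IsAnalyticExtensionAt b η F ∧
        ∀ᶠ z in 𝓝[sphere (0 : ℂ) 1] η, B z = F z := by
  have hfc : ContinuousOn f (closedBall 0 1) := fun z hz =>
    (hf z hz).continuousAt.continuousWithinAt
  have hnorm : ∀ z ∈ ball (0 : ℂ) 1, ‖b z‖ = ‖f z‖ ^ r := by
    intro z hz
    rw [hb z hz, ← hLf z hz, Complex.norm_exp, Complex.norm_exp, Complex.re_ofReal_mul, mul_comm,
      Real.exp_mul]
  have hext : ∀ η : ℂ, ‖η‖ = 1 → f η ≠ 0 → ∃ F, IsAnalyticExtensionAt b η F := by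
    intro η hη h0
    obtain ⟨ℓ, hℓ, hℓL⟩ := exists_log_extension hη hL (hf η (by simp [hη])) h0 hLf
    refine ⟨fun z => exp (r * ℓ z), (analyticAt_const.mul hℓ).cexp, ?_⟩
    filter_upwards [hℓL, self_mem_nhdsWithin] with z h1 h2
    rw [h1, hb z h2]
  have hlim : ∀ z ∈ closedBall (0 : ℂ) 1, ∃ y, Tendsto b.toFun (𝓝[ball 0 1] z) (𝓝 y) := by
    intro z hz
    -- At a zero of `f` the logarithm does not continue, but `|b| = |f|^r` tends to zero; at every
    -- other boundary point the logarithm continues and gives the limit.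
    by_cases h0 : f z = 0
    · refine ⟨0, tendsto_zero_iff_norm_tendsto_zero.2 ?_⟩
      have h1 : Tendsto (fun w => ‖f w‖ ^ r) (𝓝[ball 0 1] z) (𝓝 0) := by
        have := ((hf z hz).continuousAt.norm.rpow_const (p := r) (Or.inr hr.le)).tendsto
        rw [h0, norm_zero, Real.zero_rpow hr.ne'] at this
        exact this.mono_left nhdsWithin_le_nhds
      refine h1.congr' ?_
      filter_upwards [self_mem_nhdsWithin] with w hw using (hnorm w hw).symm
    · by_cases hzb : z ∈ ball (0 : ℂ) 1
      · exact ⟨_, (b.differentiableOn.continuousOn z hzb)⟩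
      · have hz1 : ‖z‖ = 1 := le_antisymm (by simpa using hz) (by simpa using hzb)
        obtain ⟨F, hF, hFb⟩ := hext z hz1 h0
        exact ⟨_, (hF.continuousAt.tendsto.mono_left nhdsWithin_le_nhds).congr' hFb⟩
  set B := extendFrom (ball (0 : ℂ) 1) b.toFun with hB
  have hcl : closure (ball (0 : ℂ) 1) = closedBall 0 1 := closure_ball _ one_ne_zero
  have hBc : ContinuousOn B (closedBall 0 1) := continuousOn_extendFrom hcl.ge hlim
  have hBb : Set.EqOn B b.toFun (ball 0 1) := fun z hz =>
    extendFrom_eq (subset_closure hz) (b.differentiableOn.continuousOn z hz)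
  refine ⟨B, ⟨⟨b.differentiableOn.congr hBb, by rwa [hcl]⟩, hBb⟩, ?_, ?_⟩
  · have : Set.EqOn (fun z => ‖B z‖) (fun z => ‖f z‖ ^ r) (closedBall 0 1) := by
      refine Set.EqOn.of_subset_closure (s := ball 0 1) (fun z hz => ?_) hBc.norm
        (hfc.norm.rpow_const fun _ _ => Or.inr hr.le) ball_subset_closedBall hcl.ge
      simp only [hBb hz, hnorm z hz]
    exact this
  · intro η hη h0
    obtain ⟨F, hF, hFb⟩ := hext η hη h0
    refine ⟨F, ⟨hF, hFb⟩, ?_⟩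
    -- At a circle point near `η`, `B` is defined as a limit from the disc; the continuation must
    -- therefore agree with `b` in the disc near that point as well as near `η`.
    have h1 : ∀ᶠ z in 𝓝 η, ∀ᶠ w in 𝓝 z, w ∈ ball (0 : ℂ) 1 → F w = b w :=
      eventually_eventually_nhds.2 (eventually_nhdsWithin_iff.1 hFb)
    filter_upwards [mem_nhdsWithin_of_mem_nhds h1,
      mem_nhdsWithin_of_mem_nhds hF.eventually_analyticAt, self_mem_nhdsWithin] with z h2 h3 h4
    refine extendFrom_eq (hcl.ge (sphere_subset_closedBall h4)) ?_
    exact (h3.continuousAt.tendsto.mono_left nhdsWithin_le_nhds).congr'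
      (eventually_nhdsWithin_iff.2 h2)

/-- At a node `|f| = 1`, so `b` continues analytically there, and by reflection so does `b̄` along
the circle. Hermite interpolation of these germs gives a polynomial `c` with `b̄ - c = p G` on the
circle near each node; away from the nodes `p` is bounded below, and compactness yields `D`. Zeros
of `f` on the circle are not nodes, and continuity of `B` is enough there. -/
theorem isBoundaryWeight_rpow {b : SchurFunction} {L f g : ℂ → ℂ} {r : ℝ} (hr : 0 < r)
    (hL : DifferentiableOn ℂ L (ball 0 1)) (hb : ∀ z ∈ ball (0 : ℂ) 1, b z = exp (r * L z))
    (hf : ∀ z ∈ closedBall (0 : ℂ) 1, AnalyticAt ℂ f z)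
    (hLf : ∀ z ∈ ball (0 : ℂ) 1, exp (L z) = f z) {s : Multiset ℂ} (hs : ∀ η ∈ s, ‖η‖ = 1)
    (hg : ContinuousOn g (sphere 0 1)) (hfle : ∀ z : ℂ, ‖z‖ = 1 → ‖f z‖ ≤ 1)
    (hfg : ∀ z : ℂ, ‖z‖ = 1 → 1 - ‖f z‖ ^ 2 = ‖(nodePoly s).eval z * exp (g z)‖ ^ 2) :
    IsBoundaryWeight b s := by
  obtain ⟨B, hB, hBn, hBF⟩ := exists_isDiscExtension_rpow hr hL hb hf hLf
  have hfs : ∀ η ∈ s, f η ≠ 0 := by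
    intro η hη h0
    have := hfg η (hs η hη)
    rw [h0, nodePoly_eval_eq_zero.2 hη] at this
    simp at this
  choose! F hF hFB using fun η (hη : η ∈ s) => hBF η (hs η hη) (hfs η hη)
  obtain ⟨c, G, hG⟩ := exists_interpolation s (fun η z => conj (F η (conj z⁻¹))) fun η hη =>
    analyticAt_conj_conj_inv (hs η hη) (hF η hη).1
  have hBc : ContinuousOn B (sphere 0 1) := continuousOn_sphere_of_diffContOnCl hB.diffContOnCl
  obtain ⟨D, hD⟩ := exists_forall_le_mul_of_isCompact (isCompact_sphere (0 : ℂ) 1)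
    (u := fun z => ‖conj (B z) - c.eval z‖) (v := fun z => ‖(nodePoly s).eval z‖)
    (fun z => norm_nonneg _) (by
      intro x hx
      by_cases hxs : x ∈ s
      · obtain ⟨hGa, hGe⟩ := hG x hxs
        have hGb : ∀ᶠ z in 𝓝 x, ‖G x z‖ < ‖G x x‖ + 1 :=
          hGa.continuousAt.norm.eventually_lt_const (lt_add_one _)
        refine ⟨‖G x x‖ + 1, ?_⟩
        filter_upwards [hFB x hxs, mem_nhdsWithin_of_mem_nhds hGe, mem_nhdsWithin_of_mem_nhds hGb,
          self_mem_nhdsWithin] with z h1 h2 h3 h4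
        have hz : conj z⁻¹ = z := by
          rw [map_inv₀]
          exact inv_eq_of_mul_eq_one_right (conj_mul_self_of_norm_eq_one (by simpa using h4))
        simp only [hz] at h2
        rw [h1, h2, add_sub_cancel_left, norm_mul, mul_comm]
        exact mul_le_mul_of_nonneg_right h3.le (norm_nonneg _)
      · have hp : ‖(nodePoly s).eval x‖ ≠ 0 := fun h =>
          hxs (nodePoly_eval_eq_zero.1 (norm_eq_zero.1 h))
        have hpc : ContinuousWithinAt (fun z => ‖(nodePoly s).eval z‖) (sphere 0 1) x :=
          (nodePoly s).continuous.norm.continuousWithinAt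
        have huc : ContinuousWithinAt (fun z => ‖conj (B z) - c.eval z‖) (sphere 0 1) x :=
          ((Complex.continuous_conj.continuousAt.comp_continuousWithinAt (hBc x hx)).sub
            c.continuous.continuousWithinAt).norm
        refine ⟨‖conj (B x) - c.eval x‖ / ‖(nodePoly s).eval x‖ + 1, ?_⟩
        filter_upwards [(huc.div hpc hp).eventually_lt_const (lt_add_one _),
          hpc.eventually_ne hp] with z h1 h2
        exact ((div_lt_iff₀ (lt_of_le_of_ne (norm_nonneg _) h2.symm)).1 h1).le)
  obtain ⟨C, hC0, hC⟩ := exists_one_sub_rpow_le r hr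
  have hgc : ContinuousOn (fun z => ‖exp (g z)‖ ^ 2) (sphere 0 1) := (hg.cexp.norm).pow 2
  obtain ⟨M, hM⟩ := (isCompact_sphere (0 : ℂ) 1).bddAbove_image hgc
  obtain ⟨M', hM'⟩ := (isCompact_sphere (0 : ℂ) 1).bddAbove_image
    (hgc.inv₀ fun z _ => pow_ne_zero 2 (norm_ne_zero_iff.2 (exp_ne_zero _)))
  have hB2 : ∀ z ∈ sphere (0 : ℂ) 1, 1 - (‖f z‖ ^ 2) ^ r = 1 - ‖B z‖ ^ 2 := by
    intro z hz
    rw [hBn z (sphere_subset_closedBall hz), ← Real.rpow_natCast_mul (norm_nonneg _),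
      ← Real.rpow_mul_natCast (norm_nonneg _), mul_comm]
  -- `M` and `M'` bound `|e^g|²` and its inverse on the circle; `C` compares `1 - |f|^(2r)` with `1
  -- - |f|²`. One constant serves both inequalities.
  refine ⟨hs, ⟨B, fun z => c.eval z, max (C * M) (C * M'), D, hB, c.differentiable.diffContOnCl,
    ?_, ?_, ?_, hD⟩, fun η hη => ⟨F η, hF η hη⟩⟩
  · have h1 : (1 : ℂ) ∈ sphere (0 : ℂ) 1 := by simp
    have := hM (Set.mem_image_of_mem _ h1)
    exact le_max_of_le_left (mul_nonneg hC0.le (le_trans (by positivity) this))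
  · intro z hz
    have hz1 : ‖z‖ = 1 := by simpa using hz
    have h1 := (hC (‖f z‖ ^ 2) (by positivity) (pow_le_one₀ (norm_nonneg _) (hfle z hz1))).2
    rw [hB2 z hz, hfg z hz1, norm_mul, mul_pow] at h1
    have h2 : (‖exp (g z)‖ ^ 2)⁻¹ ≤ M' := hM' (Set.mem_image_of_mem _ hz)
    have h3 : 0 < ‖exp (g z)‖ ^ 2 := pow_pos (norm_pos_iff.2 (exp_ne_zero _)) 2
    have h4 : 0 ≤ 1 - ‖B z‖ ^ 2 := by
      nlinarith [hB.norm_le_one hz1.le, norm_nonneg (B z)]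
    calc ‖(nodePoly s).eval z‖ ^ 2
        = ‖(nodePoly s).eval z‖ ^ 2 * ‖exp (g z)‖ ^ 2 * (‖exp (g z)‖ ^ 2)⁻¹ := by field_simp
      _ ≤ C * (1 - ‖B z‖ ^ 2) * M' := mul_le_mul h1 h2 (by positivity) (by positivity)
      _ = C * M' * (1 - ‖B z‖ ^ 2) := by ring
      _ ≤ _ := mul_le_mul_of_nonneg_right (le_max_right _ _) h4
  · intro z hz
    have hz1 : ‖z‖ = 1 := by simpa using hz
    have h1 := (hC (‖f z‖ ^ 2) (by positivity) (pow_le_one₀ (norm_nonneg _) (hfle z hz1))).1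
    rw [hB2 z hz, hfg z hz1, norm_mul, mul_pow] at h1
    have h2 : ‖exp (g z)‖ ^ 2 ≤ M := hM (Set.mem_image_of_mem _ hz)
    calc 1 - ‖B z‖ ^ 2 ≤ C * (‖(nodePoly s).eval z‖ ^ 2 * ‖exp (g z)‖ ^ 2) := h1
      _ ≤ C * (‖(nodePoly s).eval z‖ ^ 2 * M) := by gcongr
      _ = C * M * ‖(nodePoly s).eval z‖ ^ 2 := by ring
      _ ≤ _ := mul_le_mul_of_nonneg_right (le_max_left _ _) (by positivity)

/-! ### Poisson integrals -/

/-- The Herglotz integral of a function on the unit circle. -/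
def herglotzIntegral (w : ℂ → ℝ) (z : ℂ) : ℂ :=
  Real.circleAverage (fun ζ => herglotzRieszKernel 0 z ζ • (w ζ : ℂ)) 0 1

/-- The Poisson integral of a function on the unit circle. -/
def poissonIntegral (w : ℂ → ℝ) (z : ℂ) : ℝ :=
  Real.circleAverage (fun ζ => (herglotzRieszKernel 0 z ζ).re * w ζ) 0 1

theorem circleMap_zero_eq_mul (t θ : ℝ) : circleMap 0 t θ = t * circleMap 0 1 θ := by
  simp [circleMap]

theorem re_herglotzIntegral {w : ℂ → ℝ} (hw : CircleIntegrable w 0 1) {z : ℂ}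
    (hz : z ∈ ball (0 : ℂ) 1) : (herglotzIntegral w z).re = poissonIntegral w z :=
  re_circleAverage_herglotzRieszKernel_smul hw hz

theorem differentiableOn_herglotzIntegral {w : ℂ → ℝ} (hw : CircleIntegrable w 0 1) :
    DifferentiableOn ℂ (herglotzIntegral w) (ball 0 1) := by
  refine differentiableOn_circleAverage_herglotzRieszKernel_smul ?_
  simp only [CircleIntegrable, intervalIntegrable_iff] at hw ⊢
  exact Complex.ofRealCLM.integrable_comp hw

theorem continuousOn_re_herglotzRieszKernel {z : ℂ} (hz : z ∈ ball (0 : ℂ) 1) :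
    ContinuousOn (fun ζ => (herglotzRieszKernel 0 z ζ).re) (sphere 0 |1|) :=
  Complex.continuous_re.comp_continuousOn (continuousOn_herglotzRieszKernel_sphere hz)

theorem re_herglotzRieszKernel_nonneg {z ζ : ℂ} (hz : z ∈ ball (0 : ℂ) 1)
    (hζ : ζ ∈ sphere (0 : ℂ) 1) : 0 ≤ (herglotzRieszKernel 0 z ζ).re := by
  refine le_trans ?_ (le_re_herglotzRieszKernel hζ hz)
  have : ‖z‖ < 1 := by simpa using hz
  rw [sub_zero]
  exact div_nonneg (by linarith) (by positivity)

theorem circleIntegrable_re_herglotzRieszKernel_mul {w : ℂ → ℝ} (hw : CircleIntegrable w 0 1)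
    {z : ℂ} (hz : z ∈ ball (0 : ℂ) 1) :
    CircleIntegrable (fun ζ => (herglotzRieszKernel 0 z ζ).re * w ζ) 0 1 :=
  hw.continuousOn_mul (continuousOn_re_herglotzRieszKernel hz)

theorem poissonIntegral_add {v w : ℂ → ℝ} (hv : CircleIntegrable v 0 1)
    (hw : CircleIntegrable w 0 1) {z : ℂ} (hz : z ∈ ball (0 : ℂ) 1) :
    poissonIntegral (fun ζ => v ζ + w ζ) z = poissonIntegral v z + poissonIntegral w z := by
  rw [poissonIntegral, poissonIntegral, poissonIntegral, ← Real.circleAverage_fun_add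
    (circleIntegrable_re_herglotzRieszKernel_mul hv hz)
    (circleIntegrable_re_herglotzRieszKernel_mul hw hz)]
  simp only [mul_add]

theorem poissonIntegral_sub {v w : ℂ → ℝ} (hv : CircleIntegrable v 0 1)
    (hw : CircleIntegrable w 0 1) {z : ℂ} (hz : z ∈ ball (0 : ℂ) 1) :
    poissonIntegral (fun ζ => v ζ - w ζ) z = poissonIntegral v z - poissonIntegral w z := by
  rw [poissonIntegral, poissonIntegral, poissonIntegral, ← Real.circleAverage_fun_sub
    (circleIntegrable_re_herglotzRieszKernel_mul hv hz)
    (circleIntegrable_re_herglotzRieszKernel_mul hw hz)]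
  simp only [mul_sub]

theorem abs_poissonIntegral_le {v w : ℂ → ℝ} (hv : CircleIntegrable v 0 1)
    (hw : CircleIntegrable w 0 1) (h : ∀ ζ ∈ sphere (0 : ℂ) 1, |v ζ| ≤ w ζ) {z : ℂ}
    (hz : z ∈ ball (0 : ℂ) 1) : |poissonIntegral v z| ≤ poissonIntegral w z := by
  refine Real.abs_circleAverage_le_circleAverage_abs.trans (Real.circleAverage_mono
    (circleIntegrable_re_herglotzRieszKernel_mul hv hz).abs
    (circleIntegrable_re_herglotzRieszKernel_mul hw hz) fun ζ hζ => ?_)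
  rw [abs_one] at hζ
  rw [Pi.abs_apply, abs_mul, abs_of_nonneg (re_herglotzRieszKernel_nonneg hz hζ)]
  exact mul_le_mul_of_nonneg_left (h ζ hζ) (re_herglotzRieszKernel_nonneg hz hζ)

theorem poissonIntegral_re {F : ℂ → ℂ} (hF : DiffContOnCl ℂ F (ball 0 1)) {z : ℂ}
    (hz : z ∈ ball (0 : ℂ) 1) : poissonIntegral (fun ζ => (F ζ).re) z = (F z).re := by
  have h := hF.circleAverage_re_herglotzRieszKernel_smul hz
  have hKF : CircleIntegrable ((Complex.re ∘ herglotzRieszKernel 0 z) • F) 0 1 := by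
    refine CircleIntegrable.continuousOn_smul ?_ (continuousOn_re_herglotzRieszKernel hz)
    exact circleIntegrable_of_continuousOn (continuousOn_sphere_of_diffContOnCl hF)
  rw [← h]
  refine Eq.trans ?_ (Complex.reCLM.circleAverage_comp_comm hKF)
  refine congrArg (fun f => Real.circleAverage f 0 1) (funext fun ζ => ?_)
  simp

theorem poissonIntegral_const (c : ℝ) {z : ℂ} (hz : z ∈ ball (0 : ℂ) 1) :
    poissonIntegral (fun _ => c) z = c := by
  simpa using poissonIntegral_re (F := fun _ => (c : ℂ)) diffContOnCl_const hz

/-- A Poisson integral has the mean value property. -/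
theorem circleAverage_poissonIntegral {w : ℂ → ℝ} (hw : CircleIntegrable w 0 1) {t : ℝ}
    (h0 : 0 ≤ t) (h1 : t < 1) :
    Real.circleAverage (fun ζ => poissonIntegral w (t * ζ)) 0 1 = Real.circleAverage w 0 1 := by
  have hd := diffContOnCl_dilate (differentiableOn_herglotzIntegral hw) h0 h1
  have h2 := poissonIntegral_re hd (mem_ball_self one_pos)
  -- At the origin the Poisson kernel is 1, so a circle average is the Poisson integral at the
  -- origin.
  have hk : ∀ ζ ∈ sphere (0 : ℂ) |1|, (herglotzRieszKernel 0 0 ζ).re = 1 := by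
    intro ζ hζ
    have : ζ ≠ 0 := by rintro rfl; simp at hζ
    simp [herglotzRieszKernel_def, this]
  rw [mul_zero, re_herglotzIntegral hw (mem_ball_self one_pos)] at h2
  calc Real.circleAverage (fun ζ => poissonIntegral w (t * ζ)) 0 1
      = poissonIntegral (fun ζ => (herglotzIntegral w (t * ζ)).re) 0 := by
        refine Real.circleAverage_congr_sphere fun ζ hζ => ?_
        simp only [hk ζ hζ, one_mul]
        exact (re_herglotzIntegral hw (ofReal_mul_mem_ball h0 h1 (by simp at hζ; exact hζ.le))).symm
    _ = poissonIntegral w 0 := h2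
    _ = _ := Real.circleAverage_congr_sphere fun ζ hζ => by simp only [hk ζ hζ, one_mul]

theorem tendsto_circleAverage_zero {E : Type*} [NormedAddCommGroup E] [NormedSpace ℝ E]
    {F : ℝ → ℂ → E} {l : Filter ℝ} [l.IsCountablyGenerated] {C : ℝ}
    (hc : ∀ᶠ t in l, ContinuousOn (F t) (sphere 0 1))
    (hC : ∀ᶠ t in l, ∀ ζ ∈ sphere (0 : ℂ) 1, ‖F t ζ‖ ≤ C)
    (h : ∀ᵐ θ : ℝ, Tendsto (fun t => F t (circleMap 0 1 θ)) l (𝓝 0)) :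
    Tendsto (fun t => Real.circleAverage (F t) 0 1) l (𝓝 0) := by
  have hmem : ∀ θ : ℝ, circleMap 0 1 θ ∈ sphere (0 : ℂ) 1 := fun θ =>
    circleMap_mem_sphere 0 zero_le_one θ
  have := intervalIntegral.tendsto_integral_filter_of_dominated_convergence
    (a := 0) (b := 2 * Real.pi) (μ := MeasureTheory.volume) (l := l) (f := fun _ => (0 : E))
    (F := fun t θ => F t (circleMap 0 1 θ)) (fun _ => C) ?_ ?_ intervalIntegrable_const ?_
  · have h2 := this.const_smul (2 * Real.pi)⁻¹
    simpa [Real.circleAverage_def] using h2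
  · filter_upwards [hc] with t ht
    exact (ht.comp_continuous (continuous_circleMap 0 1) hmem).aestronglyMeasurable
  · filter_upwards [hC] with t ht
    exact Eventually.of_forall fun θ _ => ht _ (hmem θ)
  · filter_upwards [h] with θ hθ _ using hθ

theorem circleIntegrable_max_abs_sub {w : ℂ → ℝ} (hw : CircleIntegrable w 0 1) (M : ℝ) :
    CircleIntegrable (fun ζ => max (|w ζ| - M) 0) 0 1 := by
  have h := hw.abs.sub (circleIntegrable_const M 0 1)
  simp only [CircleIntegrable, intervalIntegrable_iff] at h ⊢
  exact h.pos_part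

theorem tendsto_circleAverage_max_abs_sub {w : ℂ → ℝ} (hw : CircleIntegrable w 0 1) :
    Tendsto (fun M : ℕ => Real.circleAverage (fun ζ => max (|w ζ| - M) 0) 0 1) atTop (𝓝 0) := by
  have := intervalIntegral.tendsto_integral_filter_of_dominated_convergence
    (a := 0) (b := 2 * Real.pi) (μ := MeasureTheory.volume) (l := atTop) (f := fun _ => (0 : ℝ))
    (F := fun (M : ℕ) θ => max (|w (circleMap 0 1 θ)| - M) 0)
    (fun θ => |w (circleMap 0 1 θ)|) ?_ ?_ hw.abs ?_
  · have h2 := this.const_smul (2 * Real.pi)⁻¹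
    simpa [Real.circleAverage_def] using h2
  · refine Eventually.of_forall fun M => ?_
    have h := circleIntegrable_max_abs_sub hw M
    simp only [CircleIntegrable, intervalIntegrable_iff] at h
    exact h.aestronglyMeasurable
  · refine Eventually.of_forall fun M => Eventually.of_forall fun θ _ => ?_
    rw [Real.norm_of_nonneg (le_max_right _ _)]
    exact max_le (by simp) (abs_nonneg _)
  · refine Eventually.of_forall fun θ _ => ?_
    refine tendsto_const_nhds.congr' ?_
    filter_upwards [eventually_ge_atTop ⌈|w (circleMap 0 1 θ)|⌉₊] with M hM
    rw [max_eq_right]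
    linarith [Nat.ceil_le.1 hM]

theorem continuousOn_poissonIntegral_dilate {w : ℂ → ℝ} (hw : CircleIntegrable w 0 1) {t : ℝ}
    (h0 : 0 ≤ t) (h1 : t < 1) :
    ContinuousOn (fun ζ => poissonIntegral w (t * ζ)) (sphere 0 1) := by
  have h := continuousOn_sphere_of_diffContOnCl
    (diffContOnCl_dilate (differentiableOn_herglotzIntegral hw) h0 h1)
  refine (Complex.continuous_re.comp_continuousOn h).congr fun ζ hζ => ?_
  exact (re_herglotzIntegral hw (ofReal_mul_mem_ball h0 h1 (by simp at hζ; exact hζ.le))).symm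

/-- The Poisson integral of an integrable function is determined by its radial limits. -/
theorem poissonIntegral_eq_zero {w : ℂ → ℝ} (hw : CircleIntegrable w 0 1)
    (h : ∀ᵐ θ : ℝ, Tendsto (fun t : ℝ => poissonIntegral w (circleMap 0 t θ)) (𝓝[<] 1) (𝓝 0))
    {z : ℂ} (hz : z ∈ ball (0 : ℂ) 1) : poissonIntegral w z = 0 := by
  have hsph : ∀ {t : ℝ} {ζ : ℂ}, 0 ≤ t → t < 1 → ζ ∈ sphere (0 : ℂ) |1| → t * ζ ∈ ball (0 : ℂ) 1 :=
    fun h0 h1 hζ => ofReal_mul_mem_ball h0 h1 (by simp at hζ; exact hζ.le)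
  -- The radial convergence has no evident dominating function, so `w` is truncated: `|P[w]| ≤
  -- min(|P[w]|, M) + P[(|w| - M)₊]`. Dominated convergence handles the first term. The mean of the
  -- second over every circle is that of `(|w| - M)₊`, which is small for large `M`.
  have hA : Tendsto (fun t : ℝ => Real.circleAverage (fun ζ => |poissonIntegral w (t * ζ)|) 0 1)
      (𝓝[<] 1) (𝓝 0) := by
    refine tendsto_order.2 ⟨fun c hc => Eventually.of_forall fun t => lt_of_lt_of_le hc
      (Real.circleAverage_nonneg_of_nonneg fun _ _ => abs_nonneg _), fun ε hε => ?_⟩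
    obtain ⟨M, hM⟩ := ((tendsto_order.1 (tendsto_circleAverage_max_abs_sub hw)).2 (ε / 2)
      (half_pos hε)).exists
    have hv := circleIntegrable_max_abs_sub hw M
    have hmin := tendsto_circleAverage_zero (l := 𝓝[<] (1 : ℝ)) (C := M)
      (F := fun (t : ℝ) ζ => min |poissonIntegral w (t * ζ)| (M : ℝ)) (by
        filter_upwards [eventually_mem_Ioo_nhdsLT_one] with t ht
        exact ((continuousOn_poissonIntegral_dilate hw ht.1.le ht.2).abs).inf continuousOn_const) (by
        refine Eventually.of_forall fun t ζ _ => ?_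
        rw [Real.norm_of_nonneg (le_min (abs_nonneg _) (Nat.cast_nonneg _))]
        exact min_le_right _ _) (by
        filter_upwards [h] with θ hθ
        have h2 : Tendsto (fun t : ℝ => min |poissonIntegral w (t * circleMap 0 1 θ)| (M : ℝ))
            (𝓝[<] 1) (𝓝 (min |0| (M : ℝ))) := by
          simp only [← circleMap_zero_eq_mul]
          exact hθ.abs.min tendsto_const_nhds
        simpa using h2)
    filter_upwards [eventually_mem_Ioo_nhdsLT_one, (tendsto_order.1 hmin).2 _ (half_pos hε)]
      with t ht h2
    have hcP := continuousOn_poissonIntegral_dilate hw ht.1.le ht.2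
    have hcV := continuousOn_poissonIntegral_dilate hv ht.1.le ht.2
    calc Real.circleAverage (fun ζ => |poissonIntegral w (t * ζ)|) 0 1
        ≤ Real.circleAverage (fun ζ => min |poissonIntegral w (t * ζ)| (M : ℝ)
            + poissonIntegral (fun ζ => max (|w ζ| - M) 0) (t * ζ)) 0 1 := by
          refine Real.circleAverage_mono (circleIntegrable_of_continuousOn hcP.abs)
            (circleIntegrable_of_continuousOn ((hcP.abs.inf continuousOn_const).add hcV))
            fun ζ hζ => ?_
          have hb := hsph ht.1.le ht.2 hζ
          have h3 : |poissonIntegral w (t * ζ)|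
              ≤ M + poissonIntegral (fun ζ => max (|w ζ| - M) 0) (t * ζ) := by
            have h6 := poissonIntegral_add (circleIntegrable_const (M : ℝ) 0 1) hv hb
            rw [poissonIntegral_const (M : ℝ) hb] at h6
            rw [← h6]
            refine abs_poissonIntegral_le hw ((circleIntegrable_const _ 0 1).add hv)
              (fun ξ _ => ?_) hb
            show |w ξ| ≤ M + max (|w ξ| - M) 0
            linarith [le_max_left (|w ξ| - M) 0]
          have h4 : 0 ≤ poissonIntegral (fun ζ => max (|w ζ| - M) 0) (t * ζ) :=
            (abs_nonneg _).trans (abs_poissonIntegral_le hv hv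
              (fun ξ _ => (abs_of_nonneg (le_max_right _ _)).le) hb)
          rcases le_total |poissonIntegral w (t * ζ)| (M : ℝ) with h5 | h5
          · rw [min_eq_left h5]; linarith
          · rw [min_eq_right h5]; exact h3
      _ = Real.circleAverage (fun ζ => min |poissonIntegral w (t * ζ)| (M : ℝ)) 0 1
            + Real.circleAverage (fun ζ => max (|w ζ| - M) 0) 0 1 := by
          rw [Real.circleAverage_fun_add
            (circleIntegrable_of_continuousOn (hcP.abs.inf continuousOn_const))
            (circleIntegrable_of_continuousOn hcV), circleAverage_poissonIntegral hv ht.1.le ht.2]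
      _ < ε := by linarith
  -- The upper bound of the Poisson kernel at `z`. As `P[w](t z)` is the Poisson integral of `ζ ↦
  -- P[w](t ζ)`, it is at most `C` times the mean shown to tend to zero.
  set C := (1 + ‖z - 0‖) / (1 - ‖z - 0‖) with hC
  have hbound : ∀ᶠ t : ℝ in 𝓝[<] 1, |poissonIntegral w (t * z)|
      ≤ C * Real.circleAverage (fun ζ => |poissonIntegral w (t * ζ)|) 0 1 := by
    filter_upwards [eventually_mem_Ioo_nhdsLT_one] with t ht
    have hcP := continuousOn_poissonIntegral_dilate hw ht.1.le ht.2
    have hd := diffContOnCl_dilate (differentiableOn_herglotzIntegral hw) ht.1.le ht.2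
    have e : poissonIntegral w (t * z)
        = Real.circleAverage (fun ζ => (herglotzRieszKernel 0 z ζ).re * poissonIntegral w (t * ζ))
          0 1 := by
      rw [← re_herglotzIntegral hw (ofReal_mul_mem_ball ht.1.le ht.2
        (by simp at hz; exact hz.le)), ← poissonIntegral_re hd hz]
      refine Real.circleAverage_congr_sphere fun ζ hζ => ?_
      simp only [re_herglotzIntegral hw (hsph ht.1.le ht.2 hζ)]
    rw [e, ← smul_eq_mul, ← Real.circleAverage_fun_smul]
    refine Real.abs_circleAverage_le_circleAverage_abs.trans (Real.circleAverage_mono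
      (circleIntegrable_re_herglotzRieszKernel_mul (circleIntegrable_of_continuousOn hcP) hz).abs
      (circleIntegrable_of_continuousOn (hcP.abs.fun_const_smul C)) fun ζ hζ => ?_)
    rw [abs_one] at hζ
    rw [Pi.abs_apply, abs_mul, abs_of_nonneg (re_herglotzRieszKernel_nonneg hz hζ), smul_eq_mul]
    exact mul_le_mul_of_nonneg_right (re_herglotzRieszKernel_le hζ hz) (abs_nonneg _)
  have hlim : Tendsto (fun t : ℝ => |poissonIntegral w (t * z)|) (𝓝[<] 1)
      (𝓝 |poissonIntegral w z|) := by
    have h2 := ((Complex.continuous_re.tendsto _).comp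
      (tendsto_dilate (differentiableOn_herglotzIntegral hw) hz)).abs
    rw [re_herglotzIntegral hw hz] at h2
    refine h2.congr' ?_
    filter_upwards [eventually_mem_Ioo_nhdsLT_one] with t ht
    rw [Function.comp_apply, re_herglotzIntegral hw (ofReal_mul_mem_ball ht.1.le ht.2
        (by simp at hz; exact hz.le))]
  have hlim' := hA.const_mul C
  rw [mul_zero] at hlim'
  exact abs_nonpos_iff.1 (le_of_tendsto_of_tendsto hlim hlim' hbound)

/-- For `|η| = 1` the function `log |z - η|` is the Poisson integral of its boundary values in spite
of the singularity at `η`. In other words `p` is outer, which makes it comparable with the mate. -/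
theorem poissonIntegral_sum_log {s : Multiset ℂ} (hs : ∀ η ∈ s, ‖η‖ = 1) :
    CircleIntegrable (fun ζ => (s.map fun η => Real.log ‖ζ - η‖).sum) 0 1 ∧
      ∀ z ∈ ball (0 : ℂ) 1, poissonIntegral (fun ζ => (s.map fun η => Real.log ‖ζ - η‖).sum) z
        = Real.log ‖(nodePoly s).eval z‖ := by
  induction s using Multiset.induction with
  | empty =>
    refine ⟨by simp, fun z hz => ?_⟩
    simpa using poissonIntegral_const 0 hz
  | cons η s ih =>
    obtain ⟨h1, h2⟩ := ih fun ξ hξ => hs ξ (Multiset.mem_cons_of_mem hξ)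
    have hη := hs η (Multiset.mem_cons_self η s)
    have hlog : CircleIntegrable (fun ζ => Real.log ‖ζ - η‖) 0 1 :=
      circleIntegrable_log_norm_sub_const 1
    simp only [Multiset.map_cons, Multiset.sum_cons]
    refine ⟨hlog.add h1, fun z hz => ?_⟩
    rw [poissonIntegral_add hlog h1 hz, h2 z hz, nodePoly_cons, Polynomial.eval_mul, norm_mul,
      Real.log_mul]
    · congr 1
      have := circleAverage_re_herglotzRieszKernel_mul_log (ρ := η) (w := z) (c := 0) (R := 1)
        (by simpa using hη) hz
      rw [Polynomial.eval_sub, Polynomial.eval_X, Polynomial.eval_C, ← this]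
      rfl
    · rw [Polynomial.eval_sub, Polynomial.eval_X, Polynomial.eval_C, norm_ne_zero_iff, sub_ne_zero]
      rintro rfl
      simp at hz
      linarith
    · rw [norm_ne_zero_iff]
      intro h0
      have := hs z (Multiset.mem_cons_of_mem (nodePoly_eval_eq_zero.1 h0))
      simp at hz
      linarith

/-! ### The Pythagorean mate -/

theorem tendsto_circleMap_radial (θ : ℝ) :
    Tendsto (fun t : ℝ => circleMap 0 t θ) (𝓝[<] 1) (𝓝[ball (0 : ℂ) 1] (circleMap 0 1 θ)) := by
  have h := tendsto_radial (ζ := circleMap 0 1 θ) (by simp)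
  simpa only [← circleMap_zero_eq_mul] using h

theorem IsOuter.exists_log_norm_eq {a : ℂ → ℂ} (ha : IsOuter a) :
    ∃ u : ℂ → ℝ, CircleIntegrable u 0 1 ∧ ∀ z ∈ ball (0 : ℂ) 1,
      a z ≠ 0 ∧ Real.log ‖a z‖ = poissonIntegral u z := by
  obtain ⟨c, u, hc, hu, h⟩ := ha
  refine ⟨u, hu, fun z hz => ?_⟩
  have e : Real.circleAverage (fun ζ => (ζ + z) / (ζ - z) * (u ζ : ℂ)) 0 1
      = herglotzIntegral u z := by
    simp [herglotzIntegral, herglotzRieszKernel_def]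
  have hc0 : c ≠ 0 := by rintro rfl; simp at hc
  rw [h z hz, e]
  refine ⟨mul_ne_zero hc0 (exp_ne_zero _), ?_⟩
  rw [norm_mul, hc, one_mul, Complex.norm_exp, Real.log_exp, re_herglotzIntegral hu hz]

/-- The boundary modulus of a Pythagorean mate. -/
theorem IsPythagoreanMate.ae_tendsto {a b : SchurFunction} (h : IsPythagoreanMate a b) {f : ℂ → ℂ}
    (hf : ContinuousOn f (closedBall 0 1)) (hbf : ∀ z ∈ ball (0 : ℂ) 1, b z = f z) :
    ∀ᵐ θ : ℝ, ∃ α : ℂ, Tendsto (fun t : ℝ => a (circleMap 0 t θ)) (𝓝[<] 1) (𝓝 α) ∧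
      ‖α‖ ^ 2 = 1 - ‖f (circleMap 0 1 θ)‖ ^ 2 := by
  filter_upwards [h.2.2] with θ hθ
  obtain ⟨α, β, hα, hβ, hαβ⟩ := hθ
  refine ⟨α, hα, ?_⟩
  have h1 : Tendsto (fun t : ℝ => b (circleMap 0 t θ)) (𝓝[<] 1) (𝓝 (f (circleMap 0 1 θ))) := by
    have h2 : Tendsto f (𝓝[ball 0 1] (circleMap 0 1 θ)) (𝓝 (f (circleMap 0 1 θ))) :=
      (hf _ (sphere_subset_closedBall (circleMap_mem_sphere 0 zero_le_one θ))).mono_left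
        (nhdsWithin_mono _ ball_subset_closedBall)
    refine ((h2.congr' ?_).comp (tendsto_circleMap_radial θ))
    filter_upwards [self_mem_nhdsWithin] with z hz using (hbf z hz).symm
  rw [tendsto_nhds_unique h1 hβ]
  linarith

/-- A function with a Pythagorean mate is not unimodular on the whole circle. -/
theorem IsPythagoreanMate.exists_norm_ne_one {a b : SchurFunction} (h : IsPythagoreanMate a b)
    {f : ℂ → ℂ} (hf : ContinuousOn f (closedBall 0 1)) (hbf : ∀ z ∈ ball (0 : ℂ) 1, b z = f z) :
    ∃ z : ℂ, ‖z‖ = 1 ∧ ‖f z‖ ≠ 1 := by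
  by_contra! hcon
  -- If `|f| = 1` on the whole circle, `a` has radial limits zero almost everywhere; being bounded,
  -- its means tend to zero. But each mean equals `a(0)`, which is positive.
  have hlim : Tendsto (fun t : ℝ => Real.circleAverage (fun ζ => a (t * ζ)) 0 1) (𝓝[<] 1)
      (𝓝 0) := by
    refine tendsto_circleAverage_zero (C := 1) ?_ ?_ ?_
    · filter_upwards [eventually_mem_Ioo_nhdsLT_one] with t ht
      exact continuousOn_sphere_of_diffContOnCl
        (diffContOnCl_dilate a.differentiableOn ht.1.le ht.2)
    · filter_upwards [eventually_mem_Ioo_nhdsLT_one] with t ht ζ hζ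
      exact a.norm_le_one _ (ofReal_mul_mem_ball ht.1.le ht.2 (by simp at hζ; exact hζ.le))
    · filter_upwards [h.ae_tendsto hf hbf] with θ hθ
      obtain ⟨α, hα, hα2⟩ := hθ
      rw [hcon _ (by simp)] at hα2
      have : α = 0 := by simpa using hα2
      rw [this] at hα
      simpa only [← circleMap_zero_eq_mul] using hα
  have hconst : (fun t : ℝ => Real.circleAverage (fun ζ => a (t * ζ)) 0 1) =ᶠ[𝓝[<] 1]
      fun _ => a 0 := by
    filter_upwards [eventually_mem_Ioo_nhdsLT_one] with t ht
    have := (diffContOnCl_dilate a.differentiableOn ht.1.le ht.2)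
    rw [DiffContOnCl.circleAverage (by simpa using this), mul_zero]
  have h0 : a 0 = 0 := tendsto_nhds_unique (tendsto_const_nhds.congr' hconst.symm) hlim
  have := h.2.1.1
  rw [h0] at this
  simp at this

theorem nodePoly_eval_ne_zero {s : Multiset ℂ} (hs : ∀ η ∈ s, ‖η‖ = 1) {z : ℂ}
    (hz : z ∈ ball (0 : ℂ) 1) : (nodePoly s).eval z ≠ 0 := by
  intro h0
  have := hs z (nodePoly_eval_eq_zero.1 h0)
  simp at hz
  linarith

/-- The Pythagorean mate is determined, up to a unimodular constant, by the outer factor. -/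
theorem IsPythagoreanMate.exists_eq {a b : SchurFunction} (h : IsPythagoreanMate a b) {f g : ℂ → ℂ}
    (hf : ContinuousOn f (closedBall 0 1)) (hbf : ∀ z ∈ ball (0 : ℂ) 1, b z = f z)
    {s : Multiset ℂ} (hs : ∀ η ∈ s, ‖η‖ = 1) (hg : DiffContOnCl ℂ g (ball 0 1))
    (hfg : ∀ z : ℂ, ‖z‖ = 1 → 1 - ‖f z‖ ^ 2 = ‖(nodePoly s).eval z * exp (g z)‖ ^ 2) :
    ∃ c : ℂ, c ≠ 0 ∧ ∀ z ∈ ball (0 : ℂ) 1, a z = c * ((nodePoly s).eval z * exp (g z)) := by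
  obtain ⟨u, hu, hau⟩ := h.1.exists_log_norm_eq
  obtain ⟨hsi, hsp⟩ := poissonIntegral_sum_log hs
  have hgi : CircleIntegrable (fun ζ => (g ζ).re) 0 1 := circleIntegrable_of_continuousOn
    (Complex.continuous_re.comp_continuousOn (continuousOn_sphere_of_diffContOnCl hg))
  set a₀ : ℂ → ℂ := fun z => (nodePoly s).eval z * exp (g z) with ha₀
  have ha₀0 : ∀ z ∈ ball (0 : ℂ) 1, a₀ z ≠ 0 := fun z hz =>
    mul_ne_zero (nodePoly_eval_ne_zero hs hz) (exp_ne_zero _)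
  -- The Poisson integral of `w` is `log |a / a₀|`. Its radial limits vanish almost everywhere
  -- because `|a|` and `|a₀|` agree on the boundary, so it is identically zero.
  set w : ℂ → ℝ := fun ζ => u ζ - ((s.map fun η => Real.log ‖ζ - η‖).sum + (g ζ).re) with hw
  have hwi : CircleIntegrable w 0 1 := hu.sub (hsi.add hgi)
  have hwp : ∀ z ∈ ball (0 : ℂ) 1, poissonIntegral w z = Real.log ‖a z‖ - Real.log ‖a₀ z‖ := by
    intro z hz
    have h1 : poissonIntegral w z = poissonIntegral u z - poissonIntegral
        (fun ζ => (s.map fun η => Real.log ‖ζ - η‖).sum + (g ζ).re) z :=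
      poissonIntegral_sub hu (hsi.add hgi) hz
    rw [h1, poissonIntegral_add hsi hgi hz, hsp z hz, poissonIntegral_re hg hz, (hau z hz).2,
      ha₀, norm_mul,
      Real.log_mul (norm_ne_zero_iff.2 (nodePoly_eval_ne_zero hs hz))
        (norm_ne_zero_iff.2 (exp_ne_zero _)), Complex.norm_exp, Real.log_exp]
  -- At a node the boundary value of `a₀` is zero and the limit of the logarithms is not available;
  -- the nodes form a null set.
  have hcount : ∀ᵐ θ : ℝ, circleMap 0 1 θ ∉ s := by
    have h1 : ({z : ℂ | z ∈ s} : Set ℂ).Countable := by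
      classical
      exact (s.toFinset.finite_toSet.subset fun z hz => by simpa using hz).countable
    have h2 := (h1.preimage_circleMap 0 one_ne_zero).ae_notMem MeasureTheory.volume
    filter_upwards [h2] with θ hθ using hθ
  have hzero : ∀ z ∈ ball (0 : ℂ) 1, poissonIntegral w z = 0 := by
    intro z hz
    refine poissonIntegral_eq_zero hwi ?_ hz
    filter_upwards [hcount, h.ae_tendsto hf hbf] with θ hθ hα
    obtain ⟨α, hα, hα2⟩ := hα
    have hζ : ‖circleMap 0 1 θ‖ = 1 := by simp
    rw [hfg _ hζ] at hα2
    have hne : ‖a₀ (circleMap 0 1 θ)‖ ≠ 0 := norm_ne_zero_iff.2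
      (mul_ne_zero (fun h0 => hθ (nodePoly_eval_eq_zero.1 h0)) (exp_ne_zero _))
    have hnorm : ‖α‖ = ‖a₀ (circleMap 0 1 θ)‖ :=
      (sq_eq_sq₀ (norm_nonneg _) (norm_nonneg _)).1 hα2
    have h1 : Tendsto (fun t : ℝ => a₀ (circleMap 0 t θ)) (𝓝[<] 1) (𝓝 (a₀ (circleMap 0 1 θ))) := by
      have hgc : ContinuousOn a₀ (closedBall 0 1) := by
        have := hg.continuousOn
        rw [closure_ball _ one_ne_zero] at this
        exact (nodePoly s).continuous.continuousOn.mul this.cexp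
      have h2 : Tendsto a₀ (𝓝[ball 0 1] (circleMap 0 1 θ)) (𝓝 (a₀ (circleMap 0 1 θ))) :=
        (hgc _ (sphere_subset_closedBall (circleMap_mem_sphere 0 zero_le_one θ))).mono_left
          (nhdsWithin_mono _ ball_subset_closedBall)
      exact h2.comp (tendsto_circleMap_radial θ)
    have h3 := (hα.norm.log (by rw [hnorm]; exact hne)).sub (h1.norm.log hne)
    rw [hnorm, sub_self] at h3
    refine h3.congr' ?_
    filter_upwards [(tendsto_circleMap_radial θ).eventually self_mem_nhdsWithin] with t ht
    exact (hwp _ ht).symm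
  have hnorm : ∀ z ∈ ball (0 : ℂ) 1, ‖a z / a₀ z‖ = 1 := by
    intro z hz
    have h1 := hwp z hz
    rw [hzero z hz, eq_comm, sub_eq_zero] at h1
    rw [norm_div, Real.log_injOn_pos (norm_pos_iff.2 (hau z hz).1) (norm_pos_iff.2 (ha₀0 z hz)) h1,
      div_self (norm_ne_zero_iff.2 (ha₀0 z hz))]
  have h0 : (0 : ℂ) ∈ ball (0 : ℂ) 1 := by simp
  -- An analytic function of constant modulus attains its maximum modulus inside, hence is constant.
  have hconst := Complex.eqOn_of_isPreconnected_of_isMaxOn_norm (f := fun z => a z / a₀ z)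
    (convex_ball (0 : ℂ) 1).isPreconnected isOpen_ball
    (a.differentiableOn.fun_div ((nodePoly s).differentiable.differentiableOn.mul
      hg.differentiableOn.cexp) ha₀0) h0
    (fun z hz => by
      simp only [Set.mem_ofPred_eq, Function.comp_apply, hnorm z hz, hnorm 0 h0, le_refl])
  refine ⟨a 0 / a₀ 0, div_ne_zero (hau 0 h0).1 (ha₀0 0 h0), fun z hz => ?_⟩
  have : a z / a₀ z = a 0 / a₀ 0 := hconst hz
  rw [← this]
  exact (div_mul_cancel₀ _ (ha₀0 z hz)).symm

/-! ### Multiples of `H²` and the circle zeros of the mate -/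

theorem IsHardyTwo.bounded_mul {F g : ℂ → ℂ} (hF : IsHardyTwo F)
    (hg : DifferentiableOn ℂ g (ball 0 1)) {C : ℝ} (hC : ∀ z ∈ ball (0 : ℂ) 1, ‖g z‖ ≤ C) :
    IsHardyTwo (fun z => g z * F z) := by
  obtain ⟨hFd, D, hD⟩ := hF
  refine ⟨hg.mul hFd, C ^ 2 * D, fun ρ h0 h1 => ?_⟩
  calc Real.circleAverage (fun z => ‖g z * F z‖ ^ 2) 0 ρ
      ≤ Real.circleAverage (fun z => (C ^ 2) • ‖F z‖ ^ 2) 0 ρ := by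
        refine Real.circleAverage_mono (circleIntegrable_norm_sq (hg.mul hFd) h0 h1)
          (circleIntegrable_norm_sq hFd h0 h1).const_smul fun z hz => ?_
        have hz' : z ∈ ball (0 : ℂ) 1 := by
          rw [abs_of_nonneg h0] at hz
          have : ‖z‖ = ρ := by simpa using hz
          rw [mem_ball_zero_iff]; linarith
        rw [norm_mul, mul_pow, smul_eq_mul]
        exact mul_le_mul_of_nonneg_right
          (pow_le_pow_left₀ (norm_nonneg _) (hC z hz') 2) (by positivity)
    _ = C ^ 2 * Real.circleAverage (fun z => ‖F z‖ ^ 2) 0 ρ := by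
        rw [Real.circleAverage_fun_smul, smul_eq_mul]
    _ ≤ C ^ 2 * D := mul_le_mul_of_nonneg_left (hD ρ h0 h1) (by positivity)

theorem mulHardyTwo_mul_le {p g : ℂ → ℂ} (hg : DiffContOnCl ℂ g (ball 0 1)) :
    mulHardyTwo (fun z => p z * g z) ≤ mulHardyTwo p := by
  have hgc := hg.continuousOn
  rw [closure_ball _ one_ne_zero] at hgc
  obtain ⟨C, hC⟩ := (isCompact_closedBall (0 : ℂ) 1).exists_bound_of_continuousOn hgc
  intro φ hφ
  obtain ⟨F, hF, hφF⟩ := mem_mulHardyTwo.1 hφ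
  refine mem_mulHardyTwo.2 ⟨_, hF.bounded_mul hg.differentiableOn fun z hz =>
    hC z (ball_subset_closedBall hz), fun z => ?_⟩
  rw [hφF z, mul_assoc]

theorem mulHardyTwo_congr {p q : ℂ → ℂ} (h : ∀ z ∈ ball (0 : ℂ) 1, p z = q z) :
    mulHardyTwo p = mulHardyTwo q := by
  have e : (fun z : 𝔻 => p z) = fun z : 𝔻 => q z :=
    funext fun z => h z (mem_ball_zero_iff.2 z.norm_lt_one)
  rw [mulHardyTwo, mulHardyTwo, e]

/-- Both `c e^g` and its inverse are bounded in the disc, so multiplication by either preserves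
`H²`. -/
theorem mulHardyTwo_mul_exp {p g : ℂ → ℂ} {c : ℂ} (hc : c ≠ 0) (hg : DiffContOnCl ℂ g (ball 0 1)) :
    mulHardyTwo (fun z => c * (p z * exp (g z))) = mulHardyTwo p := by
  have hexp : ∀ {k : ℂ → ℂ} (d : ℂ), DiffContOnCl ℂ k (ball 0 1) →
      DiffContOnCl ℂ (fun z => d * exp (k z)) (ball 0 1) := fun d hk =>
    ⟨hk.differentiableOn.cexp.const_mul d, hk.continuousOn.cexp.const_mul d⟩
  apply le_antisymm
  · rw [mulHardyTwo_congr (q := fun z => p z * (c * exp (g z))) fun z _ => by ring]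
    exact mulHardyTwo_mul_le (hexp c hg)
  · conv_lhs => rw [mulHardyTwo_congr (p := p)
      (q := fun z => c * (p z * exp (g z)) * (c⁻¹ * exp (-g z))) fun z _ => by
        rw [Complex.exp_neg]; have := exp_ne_zero (g z); field_simp]
    exact mulHardyTwo_mul_le (hexp c⁻¹ hg.neg)

theorem analyticOrderAt_mul_exp {s : Multiset ℂ} {g : ℂ → ℂ} {c η : ℂ} (hc : c ≠ 0)
    (hg : AnalyticAt ℂ g η) :
    analyticOrderAt (fun z => c * ((nodePoly s).eval z * exp (g z))) η = s.count η := by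
  classical
  have h1 : AnalyticAt ℂ (fun z => c * exp (g z)) η := analyticAt_const.mul hg.cexp
  have h2 : analyticOrderAt (fun z => c * exp (g z)) η = 0 :=
    h1.analyticOrderAt_eq_zero.2 (mul_ne_zero hc (exp_ne_zero _))
  have e : (fun z => c * ((nodePoly s).eval z * exp (g z)))
      = (fun z => (nodePoly s).eval z) * fun z => c * exp (g z) := by
    funext z; simp only [Pi.mul_apply]; ring
  rw [e, analyticOrderAt_mul (analyticAt_eval _ η) h1, h2, add_zero,
    analyticOrderAt_eval (nodePoly_monic s).ne_zero, nodePoly_rootMultiplicity]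

/-- The zeros on the circle of a multiple of `p exp g` are the roots of `p`. -/
theorem hasZeroOfMultiplicity_iff {a g : ℂ → ℂ} {s : Multiset ℂ} {c η : ℂ} (hc : c ≠ 0)
    (hη : ‖η‖ = 1) (hg : AnalyticAt ℂ g η)
    (ha : ∀ z ∈ ball (0 : ℂ) 1, a z = c * ((nodePoly s).eval z * exp (g z))) (k : ℕ) :
    HasZeroOfMultiplicity a η k ↔ 0 < k ∧ s.count η = k := by
  have hext : IsAnalyticExtensionAt a η fun z => c * ((nodePoly s).eval z * exp (g z)) := by
    refine ⟨analyticAt_const.mul ((analyticAt_eval _ η).mul hg.cexp), ?_⟩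
    filter_upwards [self_mem_nhdsWithin] with z hz using (ha z hz).symm
  refine and_congr_right fun _ => ⟨?_, fun h => ⟨_, hext, ?_⟩⟩
  · rintro ⟨F, hF, hFk⟩
    rw [analyticOrderAt_congr (hF.eventuallyEq hη hext), analyticOrderAt_mul_exp hc hg] at hFk
    exact_mod_cast hFk
  · rw [analyticOrderAt_mul_exp hc hg, h]

theorem nodePoly_eval_eq_prod {s : Multiset ℂ} {n : ℕ} {ζ : Fin n → ℂ} {m : Fin n → ℕ}
    (hinj : Function.Injective ζ) (hcount : ∀ j, s.count (ζ j) = m j)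
    (hmem : ∀ η ∈ s, ∃ j, ζ j = η) (z : ℂ) :
    (nodePoly s).eval z = ∏ j, (z - ζ j) ^ m j := by
  classical
  have e : s = ∑ j, m j • {ζ j} := by
    ext η
    rw [Multiset.count_sum']
    simp only [Multiset.count_nsmul, Multiset.count_singleton]
    by_cases hη : ∃ j, ζ j = η
    · obtain ⟨j, rfl⟩ := hη
      rw [hcount, Finset.sum_eq_single j]
      · simp
      · intro i _ hij
        rw [if_neg fun h => hij (hinj h).symm, mul_zero]
      · simp
    · rw [Multiset.count_eq_zero.2 fun h => hη (hmem η h), Finset.sum_eq_zero]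
      intro i _
      rw [if_neg fun h => hη ⟨i, h.symm⟩, mul_zero]
  have key : ∀ t : Finset (Fin n), (nodePoly (∑ j ∈ t, m j • {ζ j})).eval z
      = ∏ j ∈ t, (z - ζ j) ^ m j := by
    intro t
    induction t using Finset.induction_on with
    | empty => simp
    | insert i t hi ih =>
      rw [Finset.sum_insert hi, Finset.prod_insert hi, nodePoly_add, Polynomial.eval_mul, ih]
      congr 1
      simp [nodePoly, Multiset.map_nsmul, Multiset.prod_nsmul]
  rw [e, key]

/-! ### Unimodular functions -/

/-- The maximum principle for `f` and for `1/f`. -/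
theorem norm_eq_one_of_norm_eq_one_on_sphere {f : ℂ → ℂ} (hf : DiffContOnCl ℂ f (ball 0 1))
    (h0 : ∀ z ∈ ball (0 : ℂ) 1, f z ≠ 0) (h1 : ∀ z : ℂ, ‖z‖ = 1 → ‖f z‖ = 1) {z : ℂ}
    (hz : z ∈ ball (0 : ℂ) 1) : ‖f z‖ = 1 := by
  have hfr : ∀ w ∈ frontier (ball (0 : ℂ) 1), ‖f w‖ = 1 := fun w hw => by
    rw [frontier_ball _ one_ne_zero] at hw
    exact h1 w (by simpa using hw)
  have hne : ∀ w ∈ closure (ball (0 : ℂ) 1), f w ≠ 0 := by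
    intro w hw
    rw [closure_ball _ one_ne_zero, ← ball_union_sphere] at hw
    rcases hw with hw | hw
    · exact h0 w hw
    · have := h1 w (by simpa using hw)
      intro h
      simp [h] at this
  refine le_antisymm (Complex.norm_le_of_forall_mem_frontier_norm_le isBounded_ball hf
    (fun w hw => (hfr w hw).le) (subset_closure hz)) ?_
  have h2 := Complex.norm_le_of_forall_mem_frontier_norm_le (C := 1) isBounded_ball (hf.inv hne)
    (fun w hw => by rw [Pi.inv_apply, norm_inv, hfr w hw, inv_one]) (subset_closure hz)
  rw [Pi.inv_apply, norm_inv] at h2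
  exact (inv_le_one₀ (norm_pos_iff.2 (h0 z hz))).1 h2

/-- The diagonal of the kernel vanishes, so every kernel function has norm zero and every element of
the space vanishes at every point. -/
theorem spaceFunctions_eq_bot {b : SchurFunction} (h : ∀ z ∈ ball (0 : ℂ) 1, ‖b z‖ = 1) :
    spaceFunctions b = ⊥ := by
  rw [eq_bot_iff]
  rintro _ ⟨f, rfl⟩
  rw [Submodule.mem_bot]
  funext z
  have hk : kernelVec b z = 0 := by
    rw [← inner_self_eq_zero (𝕜 := ℂ), inner_kernelVec, kernelVec_apply, kernelFun, mul_comm (conj _),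
      Complex.mul_conj, Complex.normSq_eq_norm_sq, h z (mem_ball_zero_iff.2 z.norm_lt_one)]
    simp
  have := inner_kernelVec b z f
  rw [hk, inner_zero_left] at this
  exact this.symm

/-! ### The main theorem -/

theorem spaceFunctions_power_eq_of_norm_eq_one {q : SchurFunction} {L : LogBranch q} {r : ℝ}
    (hr : 0 < r) (h : ∀ z ∈ ball (0 : ℂ) 1, ‖q z‖ = 1) :
    spaceFunctions (q.power L r hr) = spaceFunctions q := by
  rw [spaceFunctions_eq_bot h, spaceFunctions_eq_bot]
  intro z hz
  have h1 := h z hz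
  rw [← L.exp_eq z hz, Complex.norm_exp, Real.exp_eq_one_iff] at h1
  show ‖exp (r * L.toFun z)‖ = 1
  rw [Complex.norm_exp, Complex.re_ofReal_mul, h1, mul_zero, Real.exp_zero]

/-- The boundary behaviour of a zero-free rational Schur function that is not unimodular. -/
theorem exists_isBoundaryWeight {q : SchurFunction} {L : LogBranch q} {P Q : Polynomial ℂ}
    (hQ : ∀ z ∈ closedBall (0 : ℂ) 1, Q.eval z ≠ 0)
    (hq : ∀ z ∈ ball (0 : ℂ) 1, q z = P.eval z / Q.eval z)
    (hne : ∃ z : ℂ, ‖z‖ = 1 ∧ ‖P.eval z / Q.eval z‖ ≠ 1) :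
    ∃ (s : Multiset ℂ) (R : ℝ) (g : ℂ → ℂ), (∀ η ∈ s, ‖η‖ = 1) ∧ 1 < R ∧
      DifferentiableOn ℂ g (ball 0 R) ∧
      (∀ z : ℂ, ‖z‖ = 1 →
        1 - ‖P.eval z / Q.eval z‖ ^ 2 = ‖(nodePoly s).eval z * exp (g z)‖ ^ 2) ∧
      IsBoundaryWeight q s ∧ ∀ (r : ℝ) (hr : 0 < r), IsBoundaryWeight (q.power L r hr) s := by
  have hf : ∀ z ∈ closedBall (0 : ℂ) 1, AnalyticAt ℂ (fun z => P.eval z / Q.eval z) z :=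
    fun z hz => (analyticAt_eval P z).div (analyticAt_eval Q z) (hQ z hz)
  have hle : ∀ z ∈ closedBall (0 : ℂ) 1, ‖P.eval z / Q.eval z‖ ≤ 1 := by
    intro z hz
    have hz' := hz
    rw [← closure_ball _ one_ne_zero] at hz'
    refine le_on_closure (s := ball 0 1) (f := fun z => ‖P.eval z / Q.eval z‖) (g := fun _ => 1)
      (fun w hw => ?_) ?_ continuousOn_const hz'
    · rw [← hq w hw]; exact q.norm_le_one w hw
    · rw [closure_ball _ one_ne_zero]
      exact fun w hw => (hf w hw).continuousAt.norm.continuousWithinAt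
  have hle' : ∀ z : ℂ, ‖z‖ = 1 → ‖P.eval z / Q.eval z‖ ≤ 1 := fun z hz => hle z (by simp [hz])
  obtain ⟨s, R, g, hs, hR, hg, hfg⟩ := exists_outer_factor hQ hle' hne
  have hgc : ContinuousOn g (sphere 0 1) := hg.continuousOn.mono fun z hz => by
    have : ‖z‖ = 1 := by simpa using hz
    rw [mem_ball_zero_iff, this]; exact hR
  have hLf : ∀ z ∈ ball (0 : ℂ) 1, exp (L.toFun z) = P.eval z / Q.eval z := fun z hz => by
    rw [L.exp_eq z hz, hq z hz]
  refine ⟨s, R, g, hs, hR, hg, hfg, ?_, fun r hr => ?_⟩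
  · refine isBoundaryWeight_rpow one_pos L.differentiableOn (fun z hz => ?_) hf hLf hs hgc hle' hfg
    rw [Complex.ofReal_one, one_mul, L.exp_eq z hz]
  · exact isBoundaryWeight_rpow hr L.differentiableOn (fun z hz => rfl) hf hLf hs hgc hle' hfg

end DBR

end

open DBR
theorem theorem2 (q : SchurFunction) (hrat : IsRational q) (hout : IsOuter q)
    (r : ℝ) (hr : 0 < r) (L : LogBranch q) :
    -- `H(q^r) = H(q)` as sets
    (spaceFunctions (q.power L r hr) : Set (𝔻 → ℂ)) = spaceFunctions q ∧
    ∀ a : SchurFunction, IsPythagoreanMate a q →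
      ∀ (n : ℕ) (ζ : Fin n → ℂ) (m : Fin n → ℕ), IsCircleZeros a ζ m →
        -- the derivative kernels at the boundary zeros are well defined
        (∀ (j : Fin n) (ℓ : Fin (m j)),
          ∃! v : 𝔻 → ℂ, IsKernelDeriv (q.power L r hr) ℓ (ζ j) v) ∧
        -- `a H² = (∏ (z - ζ j) ^ m j) H²`, and it lies in `H(q^r)`
        mulHardyTwo a = mulHardyTwo (fun z => ∏ j, (z - ζ j) ^ m j) ∧
        mulHardyTwo a ≤ spaceFunctions (q.power L r hr) ∧
        -- the derivative kernels belong to `H(q^r)`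
        ∃ v : (j : Fin n) → Fin (m j) → Space (q.power L r hr),
          (∀ (j : Fin n) (ℓ : Fin (m j)), IsKernelDeriv (q.power L r hr) ℓ (ζ j) (v j ℓ)) ∧
          -- they are orthogonal to `a H²`
          (∀ (j : Fin n) (ℓ : Fin (m j)), ∀ f ∈ subspaceOf (q.power L r hr) (mulHardyTwo a),
            ⟪f, v j ℓ⟫_ℂ = 0) ∧
          -- `H(q^r)` is the orthogonal sum of `(∏ (z - ζ j) ^ m j) H²` and their span
          (subspaceOf (q.power L r hr) (mulHardyTwo fun z => ∏ j, (z - ζ j) ^ m j) ⟂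
            Submodule.span ℂ (Set.range fun p : (j : Fin n) × Fin (m j) => v p.1 p.2)) ∧
          subspaceOf (q.power L r hr) (mulHardyTwo fun z => ∏ j, (z - ζ j) ^ m j) ⊔
            Submodule.span ℂ (Set.range fun p : (j : Fin n) × Fin (m j) => v p.1 p.2) = ⊤ := by
  obtain ⟨P, Q, hQ, hq⟩ := exists_eq_div_ne_zero_closedBall q hrat
  have hfd : DifferentiableOn ℂ (fun z => P.eval z / Q.eval z) (closedBall 0 1) :=
    P.differentiable.differentiableOn.fun_div Q.differentiable.differentiableOn hQ
  have hq0 : ∀ z ∈ ball (0 : ℂ) 1, P.eval z / Q.eval z ≠ 0 := fun z hz => by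
    rw [← hq z hz, ← L.exp_eq z hz]; exact exp_ne_zero _
  constructor
  -- Outside the unimodular case the two spaces are described by the same nodes `s`; in the
  -- unimodular case both are zero.
  · by_cases hne : ∃ z : ℂ, ‖z‖ = 1 ∧ ‖P.eval z / Q.eval z‖ ≠ 1
    · obtain ⟨s, -, -, -, -, -, -, hqw, hw⟩ := exists_isBoundaryWeight (L := L) hQ hq hne
      ext f
      rw [SetLike.mem_coe, SetLike.mem_coe, hqw.mem_spaceFunctions_iff,
        (hw r hr).mem_spaceFunctions_iff]
    · push Not at hne
      rw [spaceFunctions_power_eq_of_norm_eq_one hr]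
      intro z hz
      rw [hq z hz]
      exact norm_eq_one_of_norm_eq_one_on_sphere (f := fun z => P.eval z / Q.eval z)
        (DifferentiableOn.diffContOnCl (by rwa [closure_ball _ one_ne_zero])) hq0 hne hz
  · intro a ha n ζ m hζ
    -- The existence of a mate excludes the unimodular case.
    obtain ⟨s, R, g, hs, hR, hg, hfg, -, hw⟩ := exists_isBoundaryWeight (L := L) hQ hq
      (ha.exists_norm_ne_one hfd.continuousOn hq)
    replace hw := hw r hr
    have hRball : closedBall (0 : ℂ) 1 ⊆ ball 0 R := closedBall_subset_ball hR
    have hgcl : DiffContOnCl ℂ g (ball 0 1) := DifferentiableOn.diffContOnCl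
      (by rw [closure_ball _ one_ne_zero]; exact hg.mono hRball)
    have hga : ∀ η : ℂ, ‖η‖ = 1 → AnalyticAt ℂ g η := fun η hη =>
      hg.analyticAt (isOpen_ball.mem_nhds (hRball (by simp [hη])))
    obtain ⟨c, hc, hac⟩ := ha.exists_eq hfd.continuousOn hq hs hgcl hfg
    obtain ⟨hinj, hζ1, hζm, hζa⟩ := hζ
    -- As `a = c p e^g` with `e^g` zero-free near the circle, the multiplicities of the circle zeros
    -- of `a` are the multiplicities in `s`.
    have hcount : ∀ j, s.count (ζ j) = m j := fun j =>
      ((hasZeroOfMultiplicity_iff hc (hζ1 j) (hga _ (hζ1 j)) hac (m j)).1 (hζm j)).2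
    have hmem : ∀ η ∈ s, ∃ j, ζ j = η := fun η hη =>
      hζa η (hs η hη) (s.count η) ((hasZeroOfMultiplicity_iff hc (hs η hη) (hga _ (hs η hη)) hac
        _).2 ⟨Multiset.count_pos.2 hη, rfl⟩)
    have hprod : mulHardyTwo (fun z => (nodePoly s).eval z)
        = mulHardyTwo (fun z => ∏ j, (z - ζ j) ^ m j) :=
      mulHardyTwo_congr fun z _ => nodePoly_eval_eq_prod hinj hcount hmem z
    have haH : mulHardyTwo a = mulHardyTwo (fun z => (nodePoly s).eval z) :=
      (mulHardyTwo_congr hac).trans (mulHardyTwo_mul_exp hc hgcl)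
    obtain ⟨v, hv, horth, hperp, htop⟩ := hw.orthogonal_decomposition hcount hmem
    rw [haH, ← hprod]
    refine ⟨fun j ℓ => ⟨_, hv j ℓ, fun v' hv' => hv'.unique (hζ1 j) (hv j ℓ)⟩, rfl, ?_, v, hv, horth,
      hperp, htop⟩
    intro f hf
    obtain ⟨φ, hφ, hfφ⟩ := mem_mulHardyTwo.1 hf
    have := hw.mul_mem hφ
    rwa [← funext hfφ] at this
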